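/- **Setting.** Let $\gamma>\frac13$ and $T>0$. Let $\mathcal A$ be a von Neumann algebra of bounded operators on a complex Hilbert space, with a trace $\varphi$ (a unital, positive, faithful, tracial, weakly continuous linear functional). Let $X:[0,T]\to\mathcal A$ be a path of self-adjoint elements that is $\gamma$-Hölder for the operator norm, and let $\mathcal A_t\subset\mathcal A$ be the von Neumann subalgebra generated by $\{X_s:0\le s\le t\}$. $\hat\otimes$ is the projective tensor product over $\mathbb C$; $\mathcal A_t^{\hat\otimes k}$ is mapped to $\mathcal A^{\hat\otimes k}$ by the inclusion $\mathcal A_t\subset\mathcal A$. A path $W$ in $\mathcal A$ or $\mathcal A^{\hat\otimes k}$ is *adapted* if $W_t\in\mathcal A_t$, resp. $W_t\in\mathcal A_t^{\hat\otimes k}$, for every $t\in[0,T]$. The following formulas extend linearly and continuously, except that $*$ is conjugate-linear: $$(a\otimes b)\sharp x=axb,\quad x\sharp(a\otimes b\otimes c)=(axb)\otimes c,\quad (a\otimes b\otimes c)\sharp x=a\otimes(bxc),\quad (a\otimes b)^*=b^*\otimes a^*.$$ For a Banach space $V$ and an interval $I\subset[0,T]$, put $(\delta f)_{st}=f_t-f_s$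 and $(\delta h)_{sut}=h_{st}-h_{su}-h_{ut}$ for $s\le u\le t$ in $I$. For $\alpha>0$, $\mathcal C_1^\alpha(I;V)$ is the set of continuous $f:I\to V$ with $\mathcal N[f;\mathcal C_1^\alpha(I)]=\sup_{s<t}\|(\delta f)_{st}\|/|t-s|^\alpha<\infty$, and $\mathcal N[f;\mathcal C_1^0(I)]=\sup_{t\in I}\|f_t\|$. $\mathcal C_2^\alpha(I;V)$ is the set of continuous $h$ on $\{s\le t\}$, zero on the diagonal, with $\mathcal N[h;\mathcal C_2^\alpha(I)]=\sup_{s<t}\|h_{st}\|/|t-s|^\alpha<\infty$. $\mathcal C_3^\mu(I;V)$ is the set of finite sums of continuous $h^i$ on $\{s\le u\le t\}$, zero if two of the times are equal, with $\sup_{s<u<t}\|h^i_{sut}\|/(|t-u|^{\alpha_i}|u-s|^{\mu-\alpha_i})<\infty$ for some $0\le\alpha_i\le\mu$. If $\mu>1$ and there is a unique element of $\mathcal C_2^\mu([0,T];V)$ whose image under $\delta$ is $h$, it is denoted $\Lambda h$. A *product Lévy area* above $X$ is a family of bounded operators $\mathbf X_{st}:\mathcal A_s\hat\otimes\mathcal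 A_s\to\mathcal A_t$, $0\le s<t\le T$ (with $\mathbf X_{tt}=0$ by convention), such that $\mathcal N[\mathbf X]:=\sup_{s<t}\|\mathbf X_{st}\|/|t-s|^{2\gamma}<\infty$ and, for all $s<u<t$ and $\mathbf W\in\mathcal A_s\hat\otimes\mathcal A_s$, $$\mathbf X_{st}[\mathbf W]-\mathbf X_{su}[\mathbf W]-\mathbf X_{ut}[\mathbf W]=(\mathbf W\sharp(\delta X)_{su})\,(\delta X)_{ut}.$$ Put $\mathbf X^*_{st}[\mathbf W]=\mathbf X_{st}[\mathbf W^*]^*$, $[\mathbf X_{st}\times\mathrm{Id}](a\otimes b\otimes c)=\mathbf X_{st}[a\otimes b]\,c$ and $[\mathrm{Id}\times\mathbf X^*_{st}](a\otimes b\otimes c)=a\,\mathbf X^*_{st}[b\otimes c]$ on $\mathcal A_s^{\hat\otimes3}$. $\mathcal Q(X)$ is the set of adapted $Y\in\mathcal C_1^\gamma([0,T];\mathcal A)$ with $(\delta Y)_{st}=\mathbf Y^X_s\sharp(\delta X)_{st}+Y^\flat_{st}$, where $\mathbf Y^X\in\mathcal C_1^\gamma([0,T];\mathcal A^{\hat\otimes2})$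 is adapted and $Y^\flat\in\mathcal C_2^{2\gamma}([0,T];\mathcal A)$. For such a decomposition, $$\mathcal N[Y;\mathcal Q(I;X)]=\mathcal N[Y;\mathcal C_1^\gamma(I)]+\mathcal N[\mathbf Y^X;\mathcal C_1^0(I)]+\mathcal N[\mathbf Y^X;\mathcal C_1^\gamma(I)]+\mathcal N[Y^\flat;\mathcal C_2^{2\gamma}(I)].$$ $\mathbf Q(X)$ is the set of adapted $\mathbf U\in\mathcal C_1^\gamma([0,T];\mathcal A^{\hat\otimes2})$ with $(\delta\mathbf U)_{st}=(\delta X)_{st}\sharp\mathbb U^{1}_s+\mathbb U^{2}_s\sharp(\delta X)_{st}+\mathbf U^\flat_{st}$, where $\mathbb U^{1},\mathbb U^{2}\in\mathcal C_1^\gamma([0,T];\mathcal A^{\hat\otimes3})$ are adapted and $\mathbf U^\flat\in\mathcal C_2^{2\gamma}([0,T];\mathcal A^{\hat\otimes2})$. For such a decomposition, $$\mathcal N[\mathbf U;\mathbf Q(I;X)]=\mathcal N[\mathbf U;\mathcal C_1^\gamma(I)]+\sum_{i=1,2}\big\{\mathcal N[\mathbb U^{i};\mathcal C_1^0(I)]+\mathcal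 N[\mathbb U^{i};\mathcal C_1^\gamma(I)]\big\}+\mathcal N[\mathbf U^\flat;\mathcal C_2^{2\gamma}(I)].$$ **Proposition.** Let $\mathbf X$ be a product Lévy area above $X$. For $\mathbf U\in\mathbf Q(X)$ with a decomposition as above, set $\mathcal J_{st}(\mathbf U\sharp dX):=M_{st}-(\Lambda\delta M)_{st}$, where $$M_{st}:=\mathbf U_s\sharp(\delta X)_{st}+[\mathbf X_{st}\times\mathrm{Id}](\mathbb U^{1}_s)+[\mathrm{Id}\times\mathbf X^*_{st}](\mathbb U^{2}_s).$$ 1. $\delta M\in\mathcal C_3^{3\gamma}([0,T];\mathcal A)$, the element $\Lambda\delta M$ of $\mathcal C_2^{3\gamma}([0,T];\mathcal A)$ exists and is unique, and $\mathcal J(\mathbf U\sharp dX)\in\mathcal C_2^\gamma([0,T];\mathcal A)$. 2. If $X$ is differentiable on $[0,T]$ with Lebesgue (Bochner) integrable derivative $X'$, and $\mathbf X_{st}[\mathbf W]=\int_s^t(\mathbf W\sharp(\delta X)_{su})X'_u\,du$ for all $s\le t$ and $\mathbf W\in\mathcal A_s\hat\otimes\mathcal A_s$, then, for all $s\le t$,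 $u\mapsto\mathbf U_u\sharp X'_u$ is integrable on $[s,t]$ and $\mathcal J_{st}(\mathbf U\sharp dX)=\int_s^t\mathbf U_u\sharp X'_u\,du$. 3. For every $A\in\mathcal A$ there is a unique path $Z:[0,T]\to\mathcal A$ with $Z_0=A$ and $(\delta Z)_{st}=\mathcal J_{st}(\mathbf U\sharp dX)$ for all $s\le t$. Moreover $Y:=Z-A$ belongs to $\mathcal Q(X)$, with $\mathbf Y^X=\mathbf U$ in its decomposition; and if $A\in\mathcal A_0$, then $Z\in\mathcal Q(X)$, with $\mathbf Z^X=\mathbf U$. 4. For the path $Z$ of item 3, with $\mathbf Z^X=\mathbf U$ and $Z^\flat_{st}=(\delta Z)_{st}-\mathbf U_s\sharp(\delta X)_{st}$ in the expression $\mathcal N[Z;\mathcal Q(I;X)]$, and every interval $I=[\ell_1,\ell_2]\subset[0,T]$, $$\mathcal N[Z;\mathcal Q(I;X)]\le c_X\big\{1+\mathcal N[\mathbf U;\mathcal C_1^0(I)]+\|\mathbb U^{1}_{\ell_1}\|+\|\mathbb U^{2}_{\ell_1}\|+|I|^\gamma\,\mathcal N[\mathbf U;\mathbf Q(I;X)]\big\},$$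 where $c_X=a+b\,\mathcal N[X;\mathcal C_1^\gamma([0,T])]+c\,\mathcal N[\mathbf X]$ with constants $a,b,c\ge0$ that depend only on $\gamma$ and $T$. -/

import Mathlib

open scoped ENNReal NNReal TensorProduct

universe u

noncomputable section

namespace ProductArea

/-! ### Projective tensor powers -/

section Tensor

variable {B C G : Type*}
  [NormedRing B] [NormedAlgebra ℂ B] [NormedRing C] [NormedAlgebra ℂ C]
  [NormedAddCommGroup G] [NormedSpace ℂ G]

/-- The projective tensor power of `B` with `k` factors: the completion of the algebraic tensor
power over `ℂ` for the projective norm, which is the norm that Mathlib puts on `⨂[ℂ] _, B`. -/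
def PT (B : Type*) [NormedRing B] [NormedAlgebra ℂ B] (k : ℕ) : Type _ :=
  UniformSpace.Completion (⨂[ℂ] _ : Fin k, B)

instance (k : ℕ) : NormedAddCommGroup (PT B k) :=
  inferInstanceAs (NormedAddCommGroup (UniformSpace.Completion (⨂[ℂ] _ : Fin k, B)))

instance (k : ℕ) : NormedSpace ℂ (PT B k) :=
  inferInstanceAs (NormedSpace ℂ (UniformSpace.Completion (⨂[ℂ] _ : Fin k, B)))

instance (k : ℕ) : CompleteSpace (PT B k) :=
  inferInstanceAs (CompleteSpace (UniformSpace.Completion (⨂[ℂ] _ : Fin k, B)))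

/-- The canonical map of the algebraic tensor power to its completion. -/
def toPT (B : Type*) [NormedRing B] [NormedAlgebra ℂ B] (k : ℕ) :
    (⨂[ℂ] _ : Fin k, B) →L[ℂ] PT B k :=
  UniformSpace.Completion.toComplL (𝕜 := ℂ) (E := ⨂[ℂ] _ : Fin k, B)

/-- The elementary tensors, as a bounded multilinear map. -/
def tens (B : Type*) [NormedRing B] [NormedAlgebra ℂ B] (k : ℕ) :
    ContinuousMultilinearMap ℂ (fun _ : Fin k => B) (PT B k) :=
  (toPT B k).compContinuousMultilinearMap (PiTensorProduct.tprodL ℂ)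

/-- The bounded linear map on the projective tensor power that extends a bounded multilinear map
(given on elementary tensors). -/
def extPT [CompleteSpace G] {k : ℕ} (f : ContinuousMultilinearMap ℂ (fun _ : Fin k => B) G) :
    PT B k →L[ℂ] G :=
  ContinuousLinearMap.fromCompletion (α := ⨂[ℂ] _ : Fin k, B) (PiTensorProduct.liftIsometry ℂ (fun _ : Fin k => B) G f)

theorem extPT_toPT [CompleteSpace G] {k : ℕ}
    (f : ContinuousMultilinearMap ℂ (fun _ : Fin k => B) G) (x : ⨂[ℂ] _ : Fin k, B) :
    extPT f (toPT B k x) = PiTensorProduct.lift f.toMultilinearMap x := by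
  have h := ContinuousLinearMap.fromCompletion_apply_coe
    (PiTensorProduct.liftIsometry ℂ (fun _ : Fin k => B) G f) x
  rw [PiTensorProduct.liftIsometry_apply_apply] at h
  exact h

theorem extPT_tens [CompleteSpace G] {k : ℕ}
    (f : ContinuousMultilinearMap ℂ (fun _ : Fin k => B) G) (v : Fin k → B) :
    extPT f (tens B k v) = f v := by
  have h := extPT_toPT f (PiTensorProduct.tprod ℂ v)
  rw [PiTensorProduct.lift.tprod] at h
  simpa [tens] using h

/-- The elementary tensor `a ⊗ b`. -/
def tens₂ (a b : B) : PT B 2 := tens B 2 ![a, b]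

theorem norm_tens_le {k : ℕ} (v : Fin k → B) : ‖tens B k v‖ ≤ ∏ i, ‖v i‖ := by
  have h : ‖toPT B k (PiTensorProduct.tprod ℂ v)‖ = ‖PiTensorProduct.tprod ℂ v‖ :=
    UniformSpace.Completion.norm_coe _
  have h' := PiTensorProduct.projectiveSeminorm_tprod_le (𝕜 := ℂ) v
  simpa [tens, h] using h'

theorem norm_tens₂_le (a b : B) : ‖tens₂ a b‖ ≤ ‖a‖ * ‖b‖ := by
  simpa [tens₂, Fin.prod_univ_two] using norm_tens_le ![a, b]

theorem update_vec_zero {B : Type*} (a b x : B) : Function.update ![a, b] 0 x = ![x, b] := by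
  ext i; fin_cases i <;> rfl

theorem update_vec_one {B : Type*} (a b x : B) : Function.update ![a, b] 1 x = ![a, x] := by
  ext i; fin_cases i <;> rfl

theorem tens₂_add_left (a a' b : B) : tens₂ (a + a') b = tens₂ a b + tens₂ a' b := by
  have h := (tens B 2).map_update_add ![a, b] 0 a a'
  rwa [update_vec_zero, update_vec_zero, update_vec_zero] at h

theorem tens₂_smul_left (c : ℂ) (a b : B) : tens₂ (c • a) b = c • tens₂ a b := by
  have h := (tens B 2).map_update_smul ![a, b] 0 c a
  rwa [update_vec_zero, update_vec_zero] at h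

theorem tens₂_add_right (a b b' : B) : tens₂ a (b + b') = tens₂ a b + tens₂ a b' := by
  have h := (tens B 2).map_update_add ![a, b] 1 b b'
  rwa [update_vec_one, update_vec_one, update_vec_one] at h

theorem tens₂_smul_right (c : ℂ) (a b : B) : tens₂ a (c • b) = c • tens₂ a b := by
  have h := (tens B 2).map_update_smul ![a, b] 1 c b
  rwa [update_vec_one, update_vec_one] at h

/-- A bounded bilinear map, as a bounded multilinear map on two factors. -/
def mk₂ (f : B → B → G) (C : ℝ)
    (hal : ∀ a a' b, f (a + a') b = f a b + f a' b) (hsl : ∀ (z : ℂ) a b, f (z • a) b = z • f a b)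
    (har : ∀ a b b', f a (b + b') = f a b + f a b') (hsr : ∀ (z : ℂ) a b, f a (z • b) = z • f a b)
    (hC : ∀ a b, ‖f a b‖ ≤ C * (‖a‖ * ‖b‖)) :
    ContinuousMultilinearMap ℂ (fun _ : Fin 2 => B) G :=
  MultilinearMap.mkContinuous
    (MultilinearMap.mk' (fun v : Fin 2 → B => f (v 0) (v 1))
      (by intro m i x y; fin_cases i <;> simp [hal, har])
      (by intro m i c x; fin_cases i <;> simp [hsl, hsr]))
    C (by intro m; simpa [Fin.prod_univ_two] using hC (m 0) (m 1))

/-- A bounded trilinear map, as a bounded multilinear map on three factors. -/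
def mk₃ (f : B → B → B → G) (C : ℝ)
    (h1 : ∀ a a' b c, f (a + a') b c = f a b c + f a' b c)
    (s1 : ∀ (z : ℂ) a b c, f (z • a) b c = z • f a b c)
    (h2 : ∀ a b b' c, f a (b + b') c = f a b c + f a b' c)
    (s2 : ∀ (z : ℂ) a b c, f a (z • b) c = z • f a b c)
    (h3 : ∀ a b c c', f a b (c + c') = f a b c + f a b c')
    (s3 : ∀ (z : ℂ) a b c, f a b (z • c) = z • f a b c)
    (hC : ∀ a b c, ‖f a b c‖ ≤ C * (‖a‖ * ‖b‖ * ‖c‖)) :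
    ContinuousMultilinearMap ℂ (fun _ : Fin 3 => B) G :=
  MultilinearMap.mkContinuous
    (MultilinearMap.mk' (fun v : Fin 3 → B => f (v 0) (v 1) (v 2))
      (by intro m i x y; fin_cases i <;> simp [h1, h2, h3])
      (by intro m i c x; fin_cases i <;> simp [s1, s2, s3]))
    C (by intro m; simpa [Fin.prod_univ_three] using hC (m 0) (m 1) (m 2))

/-- `(a ⊗ b) ♯ x = a x b`. -/
def sharp [CompleteSpace B] (U : PT B 2) (x : B) : B :=
  extPT (mk₂ (fun a b : B => a * x * b) ‖x‖
    (by intros; simp [add_mul]) (by intros; simp)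
    (by intros; simp [mul_add]) (by intros; simp)
    (by intro a b
        calc ‖a * x * b‖ ≤ ‖a‖ * ‖x‖ * ‖b‖ := norm_mul₃_le
          _ = ‖x‖ * (‖a‖ * ‖b‖) := by ring)) U

/-- `x ♯ (a ⊗ b ⊗ c) = (a x b) ⊗ c`. -/
def sharpL (x : B) (W : PT B 3) : PT B 2 :=
  extPT (mk₃ (fun a b c : B => tens₂ (a * x * b) c) ‖x‖
    (by intros; simp [add_mul, tens₂_add_left]) (by intros; simp [tens₂_smul_left])
    (by intros; simp [mul_add, tens₂_add_left]) (by intros; simp [tens₂_smul_left])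
    (by intros; simp [tens₂_add_right]) (by intros; simp [tens₂_smul_right])
    (by intro a b c
        calc ‖tens₂ (a * x * b) c‖ ≤ ‖a * x * b‖ * ‖c‖ := norm_tens₂_le _ _
          _ ≤ ‖a‖ * ‖x‖ * ‖b‖ * ‖c‖ := by gcongr; exact norm_mul₃_le
          _ = ‖x‖ * (‖a‖ * ‖b‖ * ‖c‖) := by ring)) W

/-- `(a ⊗ b ⊗ c) ♯ x = a ⊗ (b x c)`. -/
def sharpR (W : PT B 3) (x : B) : PT B 2 :=
  extPT (mk₃ (fun a b c : B => tens₂ a (b * x * c)) ‖x‖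
    (by intros; simp [tens₂_add_left]) (by intros; simp [tens₂_smul_left])
    (by intros; simp [add_mul, tens₂_add_right]) (by intros; simp [tens₂_smul_right])
    (by intros; simp [mul_add, tens₂_add_right]) (by intros; simp [tens₂_smul_right])
    (by intro a b c
        calc ‖tens₂ a (b * x * c)‖ ≤ ‖a‖ * ‖b * x * c‖ := norm_tens₂_le _ _
          _ ≤ ‖a‖ * (‖b‖ * ‖x‖ * ‖c‖) := by gcongr; exact norm_mul₃_le
          _ = ‖x‖ * (‖a‖ * ‖b‖ * ‖c‖) := by ring)) W

/-- The map of projective tensor powers induced by a bounded linear map of the factors: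
`a₁ ⊗ ⋯ ⊗ aₖ ↦ j a₁ ⊗ ⋯ ⊗ j aₖ`. -/
def mapPT (j : B →L[ℂ] C) (k : ℕ) : PT B k →L[ℂ] PT C k :=
  extPT ((tens C k).compContinuousLinearMap fun _ => j)

end Tensor

/-! ### Operators on tensors over a *-subalgebra -/

section Sub

variable {A : Type*} [NormedRing A] [NormedAlgebra ℂ A] [StarRing A] [StarModule ℂ A]

/-- The inclusion of a *-subalgebra, as a bounded linear map. -/
def incl (S : StarSubalgebra ℂ A) : S →L[ℂ] A :=
  LinearMap.mkContinuous S.subtype.toAlgHom.toLinearMap 1 (by intro x; simp)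

/-- The inclusion between two nested *-subalgebras, as a bounded linear map. -/
def inclLE {S S' : StarSubalgebra ℂ A} (h : S ≤ S') : S →L[ℂ] S' :=
  LinearMap.mkContinuous (StarSubalgebra.inclusion h).toAlgHom.toLinearMap 1
    (by intro x; rw [one_mul]; exact le_rfl)

variable [CStarRing A] [CompleteSpace A] {S : StarSubalgebra ℂ A}

/-- The adjoint `L*` of a bounded operator on `S ⊗ S`, namely `L*[U] = L[U*]*` where
`(a ⊗ b)* = b* ⊗ a*`; it is the bounded linear map with `L*[a ⊗ b] = L[b* ⊗ a*]*`. -/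
def adjOp (L : PT S 2 →L[ℂ] A) : PT S 2 →L[ℂ] A :=
  extPT (mk₂ (fun a b : S => star (L (tens₂ (star b) (star a)))) ‖L‖
    (by intros; simp [tens₂_add_right]) (by intros; simp [tens₂_smul_right])
    (by intros; simp [tens₂_add_left]) (by intros; simp [tens₂_smul_left])
    (by intro a b
        calc ‖star (L (tens₂ (star b) (star a)))‖ = ‖L (tens₂ (star b) (star a))‖ := norm_star _
          _ ≤ ‖L‖ * ‖tens₂ (star b) (star a)‖ := L.le_opNorm _
          _ ≤ ‖L‖ * (‖star b‖ * ‖star a‖) := by gcongr; exact norm_tens₂_le _ _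
          _ = ‖L‖ * (‖a‖ * ‖b‖) := by rw [norm_star, norm_star]; ring))

/-- The operator `L × Id` on `S ⊗ S ⊗ S`: `(L × Id)(a ⊗ b ⊗ c) = L[a ⊗ b] c`. -/
def timesId (L : PT S 2 →L[ℂ] A) : PT S 3 →L[ℂ] A :=
  extPT (mk₃ (fun a b c : S => L (tens₂ a b) * (c : A)) ‖L‖
    (by intros; simp [add_mul, tens₂_add_left]) (by intros; simp [tens₂_smul_left])
    (by intros; simp [add_mul, tens₂_add_right]) (by intros; simp [tens₂_smul_right])
    (by intros; simp [mul_add]) (by intros; simp)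
    (by intro a b c
        calc ‖L (tens₂ a b) * (c : A)‖ ≤ ‖L (tens₂ a b)‖ * ‖(c : A)‖ := norm_mul_le _ _
          _ ≤ ‖L‖ * (‖a‖ * ‖b‖) * ‖c‖ := by
            gcongr
            · exact (L.le_opNorm _).trans (by gcongr; exact norm_tens₂_le _ _)
            · exact le_rfl
          _ = ‖L‖ * (‖a‖ * ‖b‖ * ‖c‖) := by ring))

/-- The operator `Id × L` on `S ⊗ S ⊗ S`: `(Id × L)(a ⊗ b ⊗ c) = a L[b ⊗ c]`. -/
def idTimes (L : PT S 2 →L[ℂ] A) : PT S 3 →L[ℂ] A :=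
  extPT (mk₃ (fun a b c : S => (a : A) * L (tens₂ b c)) ‖L‖
    (by intros; simp [add_mul]) (by intros; simp)
    (by intros; simp [mul_add, tens₂_add_left]) (by intros; simp [tens₂_smul_left])
    (by intros; simp [mul_add, tens₂_add_right]) (by intros; simp [tens₂_smul_right])
    (by intro a b c
        calc ‖(a : A) * L (tens₂ b c)‖ ≤ ‖(a : A)‖ * ‖L (tens₂ b c)‖ := norm_mul_le _ _
          _ ≤ ‖a‖ * (‖L‖ * (‖b‖ * ‖c‖)) := by
            gcongr
            · exact le_rfl
            · exact (L.le_opNorm _).trans (by gcongr; exact norm_tens₂_le _ _)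
          _ = ‖L‖ * (‖a‖ * ‖b‖ * ‖c‖) := by ring))

end Sub

/-! ### Increments, Hölder spaces, sewing map -/

section Holder

variable {V : Type*} [NormedAddCommGroup V]

/-- `(δ f)_{st} = f_t - f_s`. -/
def incr (f : ℝ → V) (s t : ℝ) : V := f t - f s

/-- `(δ h)_{sut} = h_{st} - h_{su} - h_{ut}`. -/
def cobd (h : ℝ → ℝ → V) (s r t : ℝ) : V := h s t - h s r - h r t

/-- `sup_{s < t ∈ I} n_{st} / |t - s|^α`, with values in `[0, ∞]`. -/
def holderSup (α : ℝ) (I : Set ℝ) (n : ℝ → ℝ → ℝ) : ℝ≥0∞ :=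
  ⨆ (s ∈ I) (t ∈ I) (_ : s < t), ENNReal.ofReal (n s t / (t - s) ^ α)

/-- The seminorm of `C_1^α(I; V)` for `α > 0`. -/
def N1 (α : ℝ) (I : Set ℝ) (f : ℝ → V) : ℝ≥0∞ := holderSup α I fun s t => ‖incr f s t‖

/-- The supremum norm on `I`, that is the norm of `C_1^0(I; V)`. -/
def N0 (I : Set ℝ) (f : ℝ → V) : ℝ≥0∞ := ⨆ t ∈ I, ENNReal.ofReal ‖f t‖

/-- The norm of `C_2^α(I; V)`. -/
def N2 (α : ℝ) (I : Set ℝ) (h : ℝ → ℝ → V) : ℝ≥0∞ := holderSup α I fun s t => ‖h s t‖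

/-- The norm of `C_3^{(α, β)}(I; V)`. -/
def N3 (α β : ℝ) (I : Set ℝ) (h : ℝ → ℝ → ℝ → V) : ℝ≥0∞ :=
  ⨆ (s ∈ I) (r ∈ I) (t ∈ I) (_ : s < r) (_ : r < t),
    ENNReal.ofReal (‖h s r t‖ / ((t - r) ^ α * (r - s) ^ β))

/-- `f ∈ C_1^α(I; V)`. -/
structure MemC1 (α : ℝ) (I : Set ℝ) (f : ℝ → V) : Prop where
  cont : ContinuousOn f I
  finite : N1 α I f ≠ ∞

/-- `h ∈ C_2^α(I; V)`: continuous on the simplex, zero on the diagonal, finite norm. -/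
structure MemC2 (α : ℝ) (I : Set ℝ) (h : ℝ → ℝ → V) : Prop where
  cont : ContinuousOn (fun p : ℝ × ℝ => h p.1 p.2) {p | p.1 ∈ I ∧ p.2 ∈ I ∧ p.1 ≤ p.2}
  diag : ∀ t ∈ I, h t t = 0
  finite : N2 α I h ≠ ∞

/-- `h ∈ C_3^{(α, β)}(I; V)`: continuous on the simplex, zero on the diagonals, finite norm. -/
structure MemC3' (α β : ℝ) (I : Set ℝ) (h : ℝ → ℝ → ℝ → V) : Prop where
  cont : ContinuousOn (fun p : ℝ × ℝ × ℝ => h p.1 p.2.1 p.2.2)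
    {p | p.1 ∈ I ∧ p.2.1 ∈ I ∧ p.2.2 ∈ I ∧ p.1 ≤ p.2.1 ∧ p.2.1 ≤ p.2.2}
  diag_left : ∀ s ∈ I, ∀ t ∈ I, s ≤ t → h s s t = 0
  diag_right : ∀ s ∈ I, ∀ t ∈ I, s ≤ t → h s t t = 0
  finite : N3 α β I h ≠ ∞

/-- `h ∈ C_3^μ(I; V)`, the sum of the spaces `C_3^{(α, μ - α)}(I; V)` over `0 ≤ α ≤ μ`: on the
simplex `h` is a finite sum of elements of these spaces. -/
def MemC3 (μ : ℝ) (I : Set ℝ) (h : ℝ → ℝ → ℝ → V) : Prop :=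
  ∃ (n : ℕ) (α : Fin n → ℝ) (g : Fin n → ℝ → ℝ → ℝ → V),
    (∀ i, 0 ≤ α i ∧ α i ≤ μ ∧ MemC3' (α i) (μ - α i) I (g i)) ∧
    ∀ s ∈ I, ∀ r ∈ I, ∀ t ∈ I, s ≤ r → r ≤ t → h s r t = ∑ i, g i s r t

/-- `N` is an element of `C_2^μ([0, T]; V)` with `δ N = h`. -/
def IsSewing (μ T : ℝ) (h : ℝ → ℝ → ℝ → V) (N : ℝ → ℝ → V) : Prop :=
  MemC2 μ (Set.Icc 0 T) N ∧
    ∀ s r t, 0 ≤ s → s ≤ r → r ≤ t → t ≤ T → cobd N s r t = h s r t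

/-- The sewing map `Λ`: an element `Λ h` of `C_2^μ([0, T]; V)` with `δ (Λ h) = h` (it is
meaningful when there is such an element and it is unique on the simplex). -/
def sewing (μ T : ℝ) (h : ℝ → ℝ → ℝ → V) : ℝ → ℝ → V :=
  open Classical in if hN : ∃ N, IsSewing μ T h N then hN.choose else 0

end Holder

/-! ### Non-commutative probability spaces and filtrations -/

section Prob

variable {H : Type*} [NormedAddCommGroup H] [InnerProductSpace ℂ H] [CompleteSpace H]

instance (A : VonNeumannAlgebra H) : CompleteSpace A.toStarSubalgebra := by
  have h : IsClosed (A.toStarSubalgebra : Set (H →L[ℂ] H)) := by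
    rw [VonNeumannAlgebra.coe_toStarSubalgebra, ← A.centralizer_centralizer]
    exact Set.isClosed_centralizer _
  exact h.completeSpace_coe

/-- `φ` is a unital, positive, faithful, tracial and weakly continuous linear functional on `A`
(continuity for the weak operator topology is asked on the unit ball only). -/
structure IsTrace (A : VonNeumannAlgebra H) (φ : A.toStarSubalgebra →ₗ[ℂ] ℂ) : Prop where
  map_one : φ 1 = 1
  nonneg : ∀ a, 0 ≤ (φ (a * star a)).re ∧ (φ (a * star a)).im = 0
  faithful : ∀ a, φ (a * star a) = 0 → a = 0
  tracial : ∀ a b, φ (a * b) = φ (b * a)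
  weak_cont : @Continuous {a : A.toStarSubalgebra // ‖a‖ ≤ 1} ℂ
    (TopologicalSpace.induced
      (fun a => (ContinuousLinearMapWOT.ofCLM (a.1 : H →L[ℂ] H) : H →WOT[ℂ] H)) inferInstance)
    inferInstance (fun a => φ a.1)

/-- An increasing family of *-subalgebras indexed by time. -/
structure Filtr (A : Type*) [NormedRing A] [NormedAlgebra ℂ A] [StarRing A] [StarModule ℂ A] where
  alg : ℝ → StarSubalgebra ℂ A
  mono : ∀ {s t}, s ≤ t → alg s ≤ alg t

/-- The filtration generated by the path `X`: at time `t`, the von Neumann subalgebra of `A`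
generated by `X_s`, `0 ≤ s ≤ t` (the double commutant of these operators). -/
def genFiltr (A : VonNeumannAlgebra H) (X : ℝ → A.toStarSubalgebra) : Filtr A.toStarSubalgebra where
  alg t := (StarSubalgebra.centralizer ℂ (StarSubalgebra.centralizer ℂ
    {x : H →L[ℂ] H | ∃ s, 0 ≤ s ∧ s ≤ t ∧ x = X s} : Set (H →L[ℂ] H))).comap
      A.toStarSubalgebra.subtype
  mono {s t} hst := by
    apply StarSubalgebra.comap_mono
    apply StarSubalgebra.centralizer_le
    apply StarSubalgebra.centralizer_le
    rintro x ⟨r, h0, hr, rfl⟩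
    exact ⟨r, h0, hr.trans hst, rfl⟩

end Prob

/-! ### Product Lévy area, controlled processes and biprocesses, integral -/

section Rough

variable {A : Type*} [NormedRing A] [NormedAlgebra ℂ A] [StarRing A] [StarModule ℂ A]
  [CStarRing A] [CompleteSpace A]

/-- The path in `A ⊗ ⋯ ⊗ A` underlying an adapted path with values in `A_t ⊗ ⋯ ⊗ A_t`. -/
def emb (F : Filtr A) {k : ℕ} (U : ∀ t, PT (F.alg t) k) (t : ℝ) : PT A k :=
  mapPT (incl (F.alg t)) k (U t)

/-- The norm of `C_2^λ(L(A_→))` on `[0, T]`: the supremum over `s < t` of the operator norms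
divided by `|t - s|^λ`. -/
def areaNorm (F : Filtr A) (lam T : ℝ) (XX : ∀ s : ℝ, ℝ → (PT (F.alg s) 2 →L[ℂ] A)) : ℝ≥0∞ :=
  holderSup lam (Set.Icc 0 T) fun s t => ‖XX s t‖

/-- `XX` is a product Lévy area above `X`. Only the operators `XX_{st}` with `s < t` matter; by
convention `XX_{tt} = 0`. -/
structure IsProductLevyArea (F : Filtr A) (γ T : ℝ) (X : ℝ → A)
    (XX : ∀ s : ℝ, ℝ → (PT (F.alg s) 2 →L[ℂ] A)) : Prop where
  diag : ∀ t, XX t t = 0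
  adapted : ∀ s t, 0 ≤ s → s < t → t ≤ T → ∀ U, XX s t U ∈ F.alg t
  holder : areaNorm F (2 * γ) T XX ≠ ∞
  chen : ∀ s r t (hsr : s < r), 0 ≤ s → r < t → t ≤ T → ∀ U : PT (F.alg s) 2,
    XX s t U - XX s r U - XX r t (mapPT (inclLE (F.mono hsr.le)) 2 U) =
      sharp (mapPT (incl (F.alg s)) 2 U) (incr X s r) * incr X r t

/-- The remainder `Y^♭` of a process `Y` with derivative `Y'`. -/
def rem (F : Filtr A) (X Y : ℝ → A) (Y' : ∀ t, PT (F.alg t) 2) (s t : ℝ) : A :=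
  incr Y s t - sharp (emb F Y' s) (incr X s t)

/-- `Y ∈ Q(X)`, with `Y^X = Y'` in its decomposition. -/
structure IsControlled (F : Filtr A) (γ T : ℝ) (X Y : ℝ → A) (Y' : ∀ t, PT (F.alg t) 2) :
    Prop where
  adapted : ∀ t ∈ Set.Icc 0 T, Y t ∈ F.alg t
  holder : MemC1 γ (Set.Icc 0 T) Y
  holder_deriv : MemC1 γ (Set.Icc 0 T) (emb F Y')
  rem_mem : MemC2 (2 * γ) (Set.Icc 0 T) (rem F X Y Y')

/-- The seminorm `N[Y; Q(I; X)]` for the decomposition with `Y^X = Y'`. -/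
def normQ (F : Filtr A) (γ : ℝ) (I : Set ℝ) (X Y : ℝ → A) (Y' : ∀ t, PT (F.alg t) 2) : ℝ≥0∞ :=
  N1 γ I Y + N0 I (emb F Y') + N1 γ I (emb F Y') + N2 (2 * γ) I (rem F X Y Y')

/-- The remainder `U^♭` of a biprocess `U` with derivatives `U1, U2`. -/
def birem (F : Filtr A) (X : ℝ → A) (U : ∀ t, PT (F.alg t) 2) (U1 U2 : ∀ t, PT (F.alg t) 3)
    (s t : ℝ) : PT A 2 :=
  incr (emb F U) s t - sharpL (incr X s t) (emb F U1 s) - sharpR (emb F U2 s) (incr X s t)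

/-- `U ∈ 𝐐(X)`, with the derivatives `U1, U2` in its decomposition. -/
structure IsBicontrolled (F : Filtr A) (γ T : ℝ) (X : ℝ → A) (U : ∀ t, PT (F.alg t) 2)
    (U1 U2 : ∀ t, PT (F.alg t) 3) : Prop where
  holder : MemC1 γ (Set.Icc 0 T) (emb F U)
  holder_deriv1 : MemC1 γ (Set.Icc 0 T) (emb F U1)
  holder_deriv2 : MemC1 γ (Set.Icc 0 T) (emb F U2)
  rem_mem : MemC2 (2 * γ) (Set.Icc 0 T) (birem F X U U1 U2)

/-- The seminorm `N[U; 𝐐(I; X)]` for the decomposition with derivatives `U1, U2`. -/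
def normBQ (F : Filtr A) (γ : ℝ) (I : Set ℝ) (X : ℝ → A) (U : ∀ t, PT (F.alg t) 2)
    (U1 U2 : ∀ t, PT (F.alg t) 3) : ℝ≥0∞ :=
  N1 γ I (emb F U) + ((N0 I (emb F U1) + N1 γ I (emb F U1)) + (N0 I (emb F U2) + N1 γ I (emb F U2)))
    + N2 (2 * γ) I (birem F X U U1 U2)

/-- `M_{st} = U_s ♯ (δX)_{st} + [XX_{st} × Id](U1_s) + [Id × XX*_{st}](U2_s)`. -/
def expansion (F : Filtr A) (X : ℝ → A) (XX : ∀ s : ℝ, ℝ → (PT (F.alg s) 2 →L[ℂ] A))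
    (U : ∀ t, PT (F.alg t) 2) (U1 U2 : ∀ t, PT (F.alg t) 3) (s t : ℝ) : A :=
  sharp (emb F U s) (incr X s t) + timesId (XX s t) (U1 s) + idTimes (adjOp (XX s t)) (U2 s)

/-- The integral `J(U ♯ dX) = (Id - Λ δ)(M)`. -/
def roughInt (F : Filtr A) (γ T : ℝ) (X : ℝ → A) (XX : ∀ s : ℝ, ℝ → (PT (F.alg s) 2 →L[ℂ] A))
    (U : ∀ t, PT (F.alg t) 2) (U1 U2 : ∀ t, PT (F.alg t) 3) (s t : ℝ) : A :=
  expansion F X XX U U1 U2 s t - sewing (3 * γ) T (cobd (expansion F X XX U U1 U2)) s t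

end Rough

end ProductArea

end

/-! The area terms in `M` are chosen so that, by Chen's relation, they cancel the first-order part
of `δU` in `δM`. What is left is a sum of products: the area on `[u,t]` applied to the increments of
the derivatives on `[s,u]`, and `U^♭_{su} ♯ (δX)_{ut}`. Both have total order `3γ > 1`, so the
sewing lemma applies: there is an additive `J` with `J - M = O(|t-s|^{3γ})`, and `Λ δM = M - J`.
Everything else is read off from this closeness.

One obstacle is hidden in the norms. The area `𝐗_{ut}` is bounded for the projective norm over
`A_u`, whereas the Hölder hypotheses measure tensors over `A`, and the projective norm may drop when
the factors are enlarged. It does not drop here, because a trace-preserving conditional expectation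
`E : A → A_u` is a contraction, so its tensor power is a contractive left inverse of the inclusion
(`norm_mapPT_of_leftInverse`). The map `E` is built by duality: for `‖a‖ ≤ 1` the functional `φ(a
·)` on `A_u` is some `φ(x ·)` with `x` in the unit ball of `A_u`. Otherwise Hahn–Banach separates
it, at some `b`, from the weakly closed convex set of such functionals. This contradicts the fact
that `Re φ(ab)` is at most the supremum of `Re φ(xb)` over that ball, which follows from a
regularized polar decomposition of `b`. Faithfulness makes `x` unique, hence `E` linear.

For differentiable `X`, the Lebesgue integral differs from `M` by `∫ U^♭_{sr} ♯ X'_r dr`, so it is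
the limit of the same Riemann sums of `M` as `J`. These sums also show that `J_{st}` lies in the
closed algebra `A_t`, whence adaptedness. The bound on `Z` follows by splitting `Z^♭` as `(J - M) +
(M - U ♯ δX)`, with the sewing estimate localized to `I`. The carrying lemmas are `cobd_expansion`,
`exists_additive`, `norm_le_of_cobd_le`, `IsTrace.exists_retraction` and `AdditiveOn.tendsto_sum`.
-/

set_option linter.unusedSectionVars false

noncomputable section

namespace ProductArea

/-! ### Projective tensor powers: density of elementary tensors, norms, functoriality. -/

section TensorLemmas

variable {B C D G : Type*}
  [NormedRing B] [NormedAlgebra ℂ B] [NormedRing C] [NormedAlgebra ℂ C]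
  [NormedRing D] [NormedAlgebra ℂ D]
  [NormedAddCommGroup G] [NormedSpace ℂ G]

theorem tens_eq (k : ℕ) (v : Fin k → B) :
    tens B k v = toPT B k (PiTensorProduct.tprod ℂ v) := rfl

/-- Induction on a projective tensor power: a closed property that is stable under sums and holds
for the multiples of elementary tensors holds everywhere. -/
theorem PT.induction_on {k : ℕ} {p : PT B k → Prop} (hp : IsClosed {w | p w})
    (htens : ∀ (c : ℂ) v, p (c • tens B k v)) (hadd : ∀ w w', p w → p w' → p (w + w'))
    (w : PT B k) : p w := by
  refine UniformSpace.Completion.induction_on (α := ⨂[ℂ] _ : Fin k, B) (p := p) w hp fun x => ?_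
  change p (toPT B k x)
  induction x using PiTensorProduct.induction_on with
  | smul_tprod c v => simpa [tens_eq] using htens c v
  | add x y hx hy => simpa using hadd _ _ hx hy

theorem PT.hom_ext {k : ℕ} {f g : PT B k →L[ℂ] G} (h : ∀ v, f (tens B k v) = g (tens B k v)) :
    f = g := by
  ext w
  refine PT.induction_on (p := fun w => f w = g w) (isClosed_eq f.continuous g.continuous)
    (fun c v => by simp [h]) (fun w w' hw hw' => by simp [hw, hw']) w

/-- This reduces adaptedness to elementary tensors: closedness of the subspace carries membership
over to the completion. -/
theorem PT.map_mem {k : ℕ} (f : PT B k →L[ℂ] G) {S : Submodule ℂ G} (hS : IsClosed (S : Set G))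
    (h : ∀ v, f (tens B k v) ∈ S) (w : PT B k) : f w ∈ S := by
  refine PT.induction_on (p := fun w => f w ∈ S) (hS.preimage f.continuous)
    (fun c v => ?_) (fun w w' hw hw' => ?_) w
  · rw [map_smul]; exact S.smul_mem _ (h v)
  · rw [map_add]; exact S.add_mem hw hw'

theorem norm_extPT_le [CompleteSpace G] {k : ℕ}
    (f : ContinuousMultilinearMap ℂ (fun _ : Fin k => B) G) : ‖extPT f‖ ≤ ‖f‖ := by
  refine ContinuousLinearMap.opNorm_le_bound _ (norm_nonneg f) fun w => ?_
  refine UniformSpace.Completion.induction_on (α := ⨂[ℂ] _ : Fin k, B)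
    (p := fun w : PT B k => ‖extPT f w‖ ≤ ‖f‖ * ‖w‖) w
    (isClosed_le (extPT f).continuous.norm (continuous_const.mul continuous_norm)) fun x => ?_
  have h1 : extPT f (toPT B k x) = PiTensorProduct.liftIsometry ℂ (fun _ : Fin k => B) G f x := by
    rw [extPT_toPT, PiTensorProduct.liftIsometry_apply_apply]
  have h2 : ‖toPT B k x‖ = ‖x‖ := UniformSpace.Completion.norm_coe _
  change ‖extPT f (toPT B k x)‖ ≤ ‖f‖ * ‖toPT B k x‖
  rw [h1, h2]
  refine (ContinuousLinearMap.le_opNorm _ _).trans ?_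
  rw [LinearIsometryEquiv.norm_map]

theorem norm_extPT_apply_le [CompleteSpace G] {k : ℕ}
    (f : ContinuousMultilinearMap ℂ (fun _ : Fin k => B) G) {c : ℝ} (hf : ‖f‖ ≤ c) (w : PT B k) :
    ‖extPT f w‖ ≤ c * ‖w‖ :=
  (extPT f).le_of_opNorm_le ((norm_extPT_le f).trans hf) w

theorem norm_mk₂_le {f : B → B → G} {K : ℝ} {hal hsl har hsr hC} (hK : 0 ≤ K) :
    ‖mk₂ (B := B) f K hal hsl har hsr hC‖ ≤ K :=
  MultilinearMap.mkContinuous_norm_le _ hK _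

theorem norm_mk₃_le {f : B → B → B → G} {K : ℝ} {h1 s1 h2 s2 h3 s3 hC} (hK : 0 ≤ K) :
    ‖mk₃ (B := B) f K h1 s1 h2 s2 h3 s3 hC‖ ≤ K :=
  MultilinearMap.mkContinuous_norm_le _ hK _

theorem tens_two (v : Fin 2 → B) : tens B 2 v = tens₂ (v 0) (v 1) := by
  rw [tens₂]; congr 1; ext i; fin_cases i <;> rfl

theorem sharp_tens [CompleteSpace B] (v : Fin 2 → B) (x : B) :
    sharp (tens B 2 v) x = v 0 * x * v 1 := by
  rw [sharp, extPT_tens]; rfl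

theorem sharp_tens₂ [CompleteSpace B] (a b x : B) : sharp (tens₂ a b) x = a * x * b :=
  sharp_tens _ _

theorem sharpL_tens (x : B) (v : Fin 3 → B) :
    sharpL x (tens B 3 v) = tens₂ (v 0 * x * v 1) (v 2) := by
  rw [sharpL, extPT_tens]; rfl

theorem sharpR_tens (v : Fin 3 → B) (x : B) :
    sharpR (tens B 3 v) x = tens₂ (v 0) (v 1 * x * v 2) := by
  rw [sharpR, extPT_tens]; rfl

theorem norm_sharp_le [CompleteSpace B] (U : PT B 2) (x : B) : ‖sharp U x‖ ≤ ‖x‖ * ‖U‖ :=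
  norm_extPT_apply_le _ (norm_mk₂_le (norm_nonneg _)) _

theorem norm_sharpL_le (x : B) (W : PT B 3) : ‖sharpL x W‖ ≤ ‖x‖ * ‖W‖ :=
  norm_extPT_apply_le _ (norm_mk₃_le (norm_nonneg _)) _

theorem norm_sharpR_le (W : PT B 3) (x : B) : ‖sharpR W x‖ ≤ ‖x‖ * ‖W‖ :=
  norm_extPT_apply_le _ (norm_mk₃_le (norm_nonneg _)) _

/-- `(x, U) ↦ U ♯ x` as a bounded bilinear map. -/
def sharpCLM (B : Type*) [NormedRing B] [NormedAlgebra ℂ B] [CompleteSpace B] :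
    B →L[ℂ] PT B 2 →L[ℂ] B :=
  LinearMap.mkContinuous₂ (LinearMap.mk₂ ℂ (fun x U => sharp U x)
    (fun x y U => PT.induction_on (p := fun U => sharp U (x + y) = sharp U x + sharp U y)
      (isClosed_eq (extPT _).continuous ((extPT _).continuous.add (extPT _).continuous))
      (fun c v => by
        have h : ∀ z, sharp (c • tens B 2 v) z = c • sharp (tens B 2 v) z := fun z => map_smul _ _ _
        simp only [h, sharp_tens, mul_add, add_mul, smul_add])
      (fun w w' hw hw' => by
        have h : ∀ z, sharp (w + w') z = sharp w z + sharp w' z := fun z => map_add _ _ _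
        rw [h, h, h, hw, hw']; abel) U)
    (fun c x U => PT.induction_on (p := fun U => sharp U (c • x) = c • sharp U x)
      (isClosed_eq (extPT _).continuous ((extPT _).continuous.const_smul c))
      (fun d v => by
        have h : ∀ z, sharp (d • tens B 2 v) z = d • sharp (tens B 2 v) z := fun z => map_smul _ _ _
        simp only [h, sharp_tens, mul_smul_comm, smul_mul_assoc, smul_comm c d])
      (fun w w' hw hw' => by
        have h : ∀ z, sharp (w + w') z = sharp w z + sharp w' z := fun z => map_add _ _ _
        rw [h, h, hw, hw', smul_add]) U)
    (fun x U V => map_add _ _ _) (fun c x U => map_smul _ _ _)) 1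
    (fun x U => by rw [one_mul]; exact norm_sharp_le U x)

/-- `(x, W) ↦ x ♯ W` as a bounded bilinear map. -/
def sharpLCLM (B : Type*) [NormedRing B] [NormedAlgebra ℂ B] :
    B →L[ℂ] PT B 3 →L[ℂ] PT B 2 :=
  LinearMap.mkContinuous₂ (LinearMap.mk₂ ℂ (fun x U => sharpL x U)
    (fun x y U => PT.induction_on (p := fun U => sharpL (x + y) U = sharpL x U + sharpL y U)
      (isClosed_eq (extPT _).continuous ((extPT _).continuous.add (extPT _).continuous))
      (fun c v => by
        have h : ∀ z, sharpL z (c • tens B 3 v) = c • sharpL z (tens B 3 v) :=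
          fun z => map_smul _ _ _
        simp only [h, sharpL_tens, mul_add, add_mul, smul_add, tens₂_add_left])
      (fun w w' hw hw' => by
        have h : ∀ z, sharpL z (w + w') = sharpL z w + sharpL z w' := fun z => map_add _ _ _
        rw [h, h, h, hw, hw']; abel) U)
    (fun c x U => PT.induction_on (p := fun U => sharpL (c • x) U = c • sharpL x U)
      (isClosed_eq (extPT _).continuous ((extPT _).continuous.const_smul c))
      (fun d v => by
        have h : ∀ z, sharpL z (d • tens B 3 v) = d • sharpL z (tens B 3 v) :=
          fun z => map_smul _ _ _
        simp only [h, sharpL_tens, mul_smul_comm, smul_mul_assoc, tens₂_smul_left, smul_comm c d])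
      (fun w w' hw hw' => by
        have h : ∀ z, sharpL z (w + w') = sharpL z w + sharpL z w' := fun z => map_add _ _ _
        rw [h, h, hw, hw', smul_add]) U)
    (fun x U V => map_add _ _ _) (fun c x U => map_smul _ _ _)) 1
    (fun x U => by rw [one_mul]; exact norm_sharpL_le x U)

/-- `(x, W) ↦ W ♯ x` on triple tensors as a bounded bilinear map. -/
def sharpRCLM (B : Type*) [NormedRing B] [NormedAlgebra ℂ B] :
    B →L[ℂ] PT B 3 →L[ℂ] PT B 2 :=
  LinearMap.mkContinuous₂ (LinearMap.mk₂ ℂ (fun x U => sharpR U x)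
    (fun x y U => PT.induction_on (p := fun U => sharpR U (x + y) = sharpR U x + sharpR U y)
      (isClosed_eq (extPT _).continuous ((extPT _).continuous.add (extPT _).continuous))
      (fun c v => by
        have h : ∀ z, sharpR (c • tens B 3 v) z = c • sharpR (tens B 3 v) z :=
          fun z => map_smul _ _ _
        simp only [h, sharpR_tens, mul_add, add_mul, smul_add, tens₂_add_right])
      (fun w w' hw hw' => by
        have h : ∀ z, sharpR (w + w') z = sharpR w z + sharpR w' z := fun z => map_add _ _ _
        rw [h, h, h, hw, hw']; abel) U)
    (fun c x U => PT.induction_on (p := fun U => sharpR U (c • x) = c • sharpR U x)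
      (isClosed_eq (extPT _).continuous ((extPT _).continuous.const_smul c))
      (fun d v => by
        have h : ∀ z, sharpR (d • tens B 3 v) z = d • sharpR (tens B 3 v) z :=
          fun z => map_smul _ _ _
        simp only [h, sharpR_tens, mul_smul_comm, smul_mul_assoc, tens₂_smul_right, smul_comm c d])
      (fun w w' hw hw' => by
        have h : ∀ z, sharpR (w + w') z = sharpR w z + sharpR w' z := fun z => map_add _ _ _
        rw [h, h, hw, hw', smul_add]) U)
    (fun x U V => map_add _ _ _) (fun c x U => map_smul _ _ _)) 1
    (fun x U => by rw [one_mul]; exact norm_sharpR_le U x)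

theorem sharpCLM_apply [CompleteSpace B] (x : B) (U : PT B 2) : sharpCLM B x U = sharp U x := rfl

theorem sharpLCLM_apply (x : B) (W : PT B 3) : sharpLCLM B x W = sharpL x W := rfl

theorem sharpRCLM_apply (x : B) (W : PT B 3) : sharpRCLM B x W = sharpR W x := rfl

theorem mapPT_tens (j : B →L[ℂ] C) {k : ℕ} (v : Fin k → B) :
    mapPT j k (tens B k v) = tens C k fun i => j (v i) := by
  rw [mapPT, extPT_tens]; rfl

theorem mapPT_tens₂ (j : B →L[ℂ] C) (a b : B) :
    mapPT j 2 (tens₂ a b) = tens₂ (j a) (j b) := by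
  rw [tens₂, mapPT_tens, tens_two]; rfl

/-- Projective norms are functorial for contractions; no such bound from below holds in general. -/
theorem norm_mapPT_le {j : B →L[ℂ] C} (hj : ‖j‖ ≤ 1) {k : ℕ} (w : PT B k) :
    ‖mapPT j k w‖ ≤ ‖w‖ := by
  refine (norm_extPT_apply_le _ (c := 1) ?_ w).trans_eq (one_mul _)
  refine ContinuousMultilinearMap.opNorm_le_bound zero_le_one fun v => ?_
  refine (norm_tens_le _).trans ?_
  rw [one_mul]
  refine Finset.prod_le_prod (fun _ _ => norm_nonneg _) fun i _ => ?_
  exact (j.le_of_opNorm_le hj _).trans_eq (one_mul _)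

theorem mapPT_mapPT (j : B →L[ℂ] C) (l : C →L[ℂ] D) {k : ℕ} (w : PT B k) :
    mapPT l k (mapPT j k w) = mapPT (l.comp j) k w := by
  have : (mapPT l k).comp (mapPT j k) = mapPT (l.comp j) k :=
    PT.hom_ext fun v => by simp [mapPT_tens]
  exact congrArg (fun f => f w) this

theorem mapPT_id {k : ℕ} (w : PT B k) : mapPT (ContinuousLinearMap.id ℂ B) k w = w := by
  have : mapPT (ContinuousLinearMap.id ℂ B) k = ContinuousLinearMap.id ℂ (PT B k) :=
    PT.hom_ext fun v => by simp [mapPT_tens]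
  rw [this]; rfl

/-- The projective tensor power of a contraction that has a contractive left inverse is
isometric. -/
theorem norm_mapPT_of_leftInverse {j : B →L[ℂ] C} {e : C →L[ℂ] B} (hj : ‖j‖ ≤ 1) (he : ‖e‖ ≤ 1)
    (h : ∀ b, e (j b) = b) {k : ℕ} (w : PT B k) : ‖mapPT j k w‖ = ‖w‖ := by
  refine le_antisymm (norm_mapPT_le hj w) ?_
  have h1 : mapPT e k (mapPT j k w) = w := by
    rw [mapPT_mapPT, show e.comp j = ContinuousLinearMap.id ℂ B from
      ContinuousLinearMap.ext h, mapPT_id]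
  calc ‖w‖ = ‖mapPT e k (mapPT j k w)‖ := by rw [h1]
    _ ≤ _ := norm_mapPT_le he _

end TensorLemmas

/-! ### Chen's relation on triple tensors. -/

section SubLemmas

variable {A : Type*} [NormedRing A] [NormedAlgebra ℂ A] [StarRing A] [StarModule ℂ A]

theorem incl_apply (S : StarSubalgebra ℂ A) (x : S) : incl S x = x := rfl

theorem norm_incl_le (S : StarSubalgebra ℂ A) : ‖incl S‖ ≤ 1 :=
  LinearMap.mkContinuous_norm_le _ zero_le_one _

theorem coe_inclLE {S S' : StarSubalgebra ℂ A} (h : S ≤ S') (x : S) :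
    ((inclLE h x : S') : A) = x := rfl

theorem mapPT_incl_inclLE {S S' : StarSubalgebra ℂ A} (h : S ≤ S') {k : ℕ} (w : PT S k) :
    mapPT (incl S') k (mapPT (inclLE h) k w) = mapPT (incl S) k w :=
  mapPT_mapPT _ _ _

variable [CompleteSpace A] {S S' : StarSubalgebra ℂ A}

theorem timesId_tens (L : PT S 2 →L[ℂ] A) (v : Fin 3 → S) :
    timesId L (tens S 3 v) = L (tens₂ (v 0) (v 1)) * (v 2 : A) := by
  rw [timesId, extPT_tens]; rfl

theorem idTimes_tens (L : PT S 2 →L[ℂ] A) (v : Fin 3 → S) :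
    idTimes L (tens S 3 v) = (v 0 : A) * L (tens₂ (v 1) (v 2)) := by
  rw [idTimes, extPT_tens]; rfl

theorem norm_timesId_le (L : PT S 2 →L[ℂ] A) (w : PT S 3) : ‖timesId L w‖ ≤ ‖L‖ * ‖w‖ :=
  norm_extPT_apply_le _ (norm_mk₃_le (norm_nonneg _)) _

/-- Both sides are bounded and linear in the tensor, so `a ⊗ b ⊗ c` suffices, where this is the
relation for `a ⊗ b` multiplied on the right by `c`. -/
theorem timesId_chen (h : S ≤ S') {L₁ L₂ : PT S 2 →L[ℂ] A} {L₃ : PT S' 2 →L[ℂ] A} {x y : A}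
    (hL : ∀ w, L₁ w - L₂ w - L₃ (mapPT (inclLE h) 2 w) = sharp (mapPT (incl S) 2 w) x * y)
    (w : PT S 3) :
    timesId L₁ w - timesId L₂ w - timesId L₃ (mapPT (inclLE h) 3 w) =
      sharp (sharpL x (mapPT (incl S) 3 w)) y := by
  have : timesId L₁ - timesId L₂ - (timesId L₃).comp (mapPT (inclLE h) 3) =
      (sharpCLM A y).comp ((sharpLCLM A x).comp (mapPT (incl S) 3)) := by
    refine PT.hom_ext fun v => ?_
    have h1 := hL (tens₂ (v 0) (v 1))
    rw [mapPT_tens₂, mapPT_tens₂, sharp_tens₂] at h1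
    simp only [sub_apply, ContinuousLinearMap.comp_apply, mapPT_tens,
      timesId_tens, sharpLCLM_apply, sharpCLM_apply, sharpL_tens, sharp_tens₂, coe_inclLE,
      ← sub_mul, h1, incl_apply]
  exact congrArg (fun f => f w) this

variable [CStarRing A]

theorem adjOp_tens₂ (L : PT S 2 →L[ℂ] A) (a b : S) :
    adjOp L (tens₂ a b) = star (L (tens₂ (star b) (star a))) := by
  rw [adjOp, tens₂, extPT_tens]; rfl

theorem norm_adjOp_le (L : PT S 2 →L[ℂ] A) : ‖adjOp L‖ ≤ ‖L‖ :=
  (norm_extPT_le _).trans (norm_mk₂_le (norm_nonneg _))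

theorem norm_idTimes_adjOp_le (L : PT S 2 →L[ℂ] A) (w : PT S 3) :
    ‖idTimes (adjOp L) w‖ ≤ ‖L‖ * ‖w‖ :=
  norm_extPT_apply_le _ ((norm_mk₃_le (norm_nonneg _)).trans (norm_adjOp_le L)) _

/-- On `a ⊗ b ⊗ c` the relation is applied to `c* ⊗ b*` and its adjoint is taken. As `x` and `y` are
self-adjoint, `c* x b* y` becomes `y b x c`, and multiplying by `a` on the left gives `a y (b x c)`.
-/
theorem idTimes_adjOp_chen (h : S ≤ S') {L₁ L₂ : PT S 2 →L[ℂ] A} {L₃ : PT S' 2 →L[ℂ] A} {x y : A}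
    (hx : IsSelfAdjoint x) (hy : IsSelfAdjoint y)
    (hL : ∀ w, L₁ w - L₂ w - L₃ (mapPT (inclLE h) 2 w) = sharp (mapPT (incl S) 2 w) x * y)
    (w : PT S 3) :
    idTimes (adjOp L₁) w - idTimes (adjOp L₂) w - idTimes (adjOp L₃) (mapPT (inclLE h) 3 w) =
      sharp (sharpR (mapPT (incl S) 3 w) x) y := by
  have : idTimes (adjOp L₁) - idTimes (adjOp L₂) - (idTimes (adjOp L₃)).comp (mapPT (inclLE h) 3) =
      (sharpCLM A y).comp ((sharpRCLM A x).comp (mapPT (incl S) 3)) := by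
    refine PT.hom_ext fun v => ?_
    have h1 := congrArg star (hL (tens₂ (star (v 2)) (star (v 1))))
    rw [mapPT_tens₂, mapPT_tens₂, sharp_tens₂] at h1
    simp only [star_sub, star_mul, incl_apply, hx.star_eq, hy.star_eq, StarMemClass.coe_star,
      star_star] at h1
    simp only [sub_apply, ContinuousLinearMap.comp_apply, mapPT_tens,
      idTimes_tens, sharpRCLM_apply, sharpCLM_apply, sharpR_tens, sharp_tens₂, coe_inclLE,
      ← mul_sub, adjOp_tens₂, incl_apply]
    have h2 : ∀ a : S, inclLE h (star a) = star (inclLE h a) := fun _ => rfl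
    rw [h2, h2] at h1
    rw [h1]
    simp only [mul_assoc]
  exact congrArg (fun f => f w) this

end SubLemmas

/-! ### The sewing lemma: partition sums, additive functions, uniqueness, continuity. -/

section SewingLemma

open Filter Topology

variable {V : Type*} [NormedAddCommGroup V]

/-- The sum of `M` over the consecutive points of the chain `s, l₁, …, lₙ, t`. -/
def chainSum (M : ℝ → ℝ → V) : ℝ → List ℝ → ℝ → V
  | s, [], t => M s t
  | s, x :: l, t => M s x + chainSum M x l t

theorem chainSum_append (M : ℝ → ℝ → V) (l l' : List ℝ) (s r t : ℝ) :
    chainSum M s (l ++ r :: l') t = chainSum M s l r + chainSum M r l' t := by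
  induction l generalizing s with
  | nil => rfl
  | cons x l ih => simp only [List.cons_append, chainSum, ih, add_assoc]

/-- The points of `D` strictly between `s` and `t`. -/
def innerPts (D : Finset ℝ) (s t : ℝ) : Finset ℝ := D.filter fun x => s < x ∧ x < t

theorem mem_innerPts {D : Finset ℝ} {s t x : ℝ} : x ∈ innerPts D s t ↔ x ∈ D ∧ s < x ∧ x < t :=
  Finset.mem_filter

/-- The sum of `M` over the partition of `[s, t]` by the points of `D`. -/
def partSum (M : ℝ → ℝ → V) (D : Finset ℝ) (s t : ℝ) : V :=
  chainSum M s ((innerPts D s t).sort (· ≤ ·)) t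

theorem partSum_of_empty (M : ℝ → ℝ → V) {D : Finset ℝ} {s t : ℝ} (h : innerPts D s t = ∅) :
    partSum M D s t = M s t := by
  rw [partSum, h, Finset.sort_empty, chainSum]

theorem innerPts_self (D : Finset ℝ) (s : ℝ) : innerPts D s s = ∅ := by
  ext x
  simp only [mem_innerPts, Finset.notMem_empty, iff_false]
  rintro ⟨-, h, h'⟩
  exact lt_asymm h h'

/-- A sorted list without repetition is determined by its members, so the right-hand side only has
to be checked for these three properties. -/
theorem sort_innerPts {D : Finset ℝ} {s r t : ℝ} (hr : r ∈ D) (hs : s < r) (ht : r < t) :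
    (innerPts D s t).sort (· ≤ ·) =
      (innerPts D s r).sort (· ≤ ·) ++ r :: (innerPts D r t).sort (· ≤ ·) := by
  have hL : ∀ l : List ℝ, l.Nodup → l.Pairwise (· ≤ ·) → (∀ x, x ∈ l ↔ x ∈ innerPts D s t) →
      (innerPts D s t).sort (· ≤ ·) = l := by
    intro l h1 h2 h3
    refine List.Perm.eq_of_pairwise (le := (· ≤ ·)) (fun a b _ _ => le_antisymm)
      (Finset.pairwise_sort _ _) h2 ?_
    refine (List.perm_ext_iff_of_nodup (Finset.sort_nodup _ _) h1).2 fun x => ?_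
    rw [Finset.mem_sort, h3]
  refine hL _ ?_ ?_ fun x => ?_
  · rw [List.nodup_append]
    refine ⟨Finset.sort_nodup _ _, ?_, ?_⟩
    · rw [List.nodup_cons]
      refine ⟨fun h => ?_, Finset.sort_nodup _ _⟩
      rw [Finset.mem_sort, mem_innerPts] at h
      exact lt_irrefl _ h.2.1
    · rintro a ha b hb rfl
      rw [Finset.mem_sort, mem_innerPts] at ha
      rcases List.mem_cons.1 hb with rfl | hb
      · exact lt_irrefl _ ha.2.2
      · rw [Finset.mem_sort, mem_innerPts] at hb
        exact lt_asymm ha.2.2 hb.2.1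
  · rw [List.pairwise_append]
    refine ⟨Finset.pairwise_sort _ _, ?_, ?_⟩
    · rw [List.pairwise_cons]
      refine ⟨fun a ha => ?_, Finset.pairwise_sort _ _⟩
      rw [Finset.mem_sort, mem_innerPts] at ha
      exact ha.2.1.le
    · intro a ha b hb
      rw [Finset.mem_sort, mem_innerPts] at ha
      rcases List.mem_cons.1 hb with rfl | hb
      · exact ha.2.2.le
      · rw [Finset.mem_sort, mem_innerPts] at hb
        exact (ha.2.2.trans hb.2.1).le
  · rw [List.mem_append, List.mem_cons, Finset.mem_sort, Finset.mem_sort]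
    simp only [mem_innerPts]
    constructor
    · rintro (h | rfl | h)
      · exact ⟨h.1, h.2.1, h.2.2.trans ht⟩
      · exact ⟨hr, hs, ht⟩
      · exact ⟨h.1, hs.trans h.2.1, h.2.2⟩
    · rintro ⟨h, h', h''⟩
      rcases lt_trichotomy x r with hx | hx | hx
      · exact Or.inl ⟨h, h', hx⟩
      · exact Or.inr (Or.inl hx)
      · exact Or.inr (Or.inr ⟨h, hx, h''⟩)

/-- The degenerate cases `r = s` and `r = t` are admitted because `M` vanishes on the diagonal; the
bisection below may produce them. -/
theorem partSum_add {M : ℝ → ℝ → V} (hM : ∀ t, M t t = 0) {D : Finset ℝ} {s r t : ℝ}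
    (hr : r ∈ D ∨ r = s ∨ r = t) (hs : s ≤ r) (ht : r ≤ t) :
    partSum M D s t = partSum M D s r + partSum M D r t := by
  have h0 : ∀ x, partSum M D x x = 0 := fun x => by rw [partSum_of_empty M (innerPts_self D x), hM]
  rcases hs.eq_or_lt with rfl | hs
  · rw [h0, zero_add]
  rcases ht.eq_or_lt with rfl | ht
  · rw [h0, add_zero]
  have hr : r ∈ D := by
    rcases hr with hr | rfl | rfl
    · exact hr
    · exact absurd hs (lt_irrefl _)
    · exact absurd ht (lt_irrefl _)
  rw [partSum, sort_innerPts hr hs ht, chainSum_append]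
  rfl

theorem two_rpow_one_sub_lt_one {μ : ℝ} (hμ : 1 < μ) : (2 : ℝ) ^ (1 - μ) < 1 :=
  Real.rpow_lt_one_of_one_lt_of_neg one_lt_two (by linarith)

/-- The constant of the sewing lemma. -/
def sewC (μ : ℝ) : ℝ := 2 / (1 - 2 ^ (1 - μ))

theorem sewC_pos {μ : ℝ} (hμ : 1 < μ) : 0 < sewC μ :=
  div_pos two_pos (sub_pos.2 (two_rpow_one_sub_lt_one hμ))

/-- The identity that closes the bisection arguments: the two halves contribute `sewC μ * 2 ^ (1 -
μ)` and two coboundaries contribute `2`. -/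
theorem sewC_eq {μ : ℝ} (hμ : 1 < μ) : sewC μ * 2 ^ (1 - μ) + 2 = sewC μ := by
  have := (sub_pos.2 (two_rpow_one_sub_lt_one hμ)).ne'
  rw [sewC]; field_simp; ring

theorem two_mul_half_rpow {μ x : ℝ} (hx : 0 ≤ x) : 2 * (x / 2) ^ μ = 2 ^ (1 - μ) * x ^ μ := by
  rw [Real.div_rpow hx zero_le_two, Real.rpow_sub two_pos, Real.rpow_one]
  ring

/-- The interval is cut near its midpoint `m`, at the two consecutive points `u ≤ m ≤ v` of the
partition. The outer pieces are at most half as long and contain fewer points, the middle piece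
contains none, and reassembling costs two coboundaries. The bound is therefore uniform in the
partition. -/
theorem norm_partSum_sub_le {M : ℝ → ℝ → V} (hM0 : ∀ t, M t t = 0) {a b C μ : ℝ} (hμ : 1 < μ)
    (hC : 0 ≤ C)
    (hM : ∀ s r t, a ≤ s → s ≤ r → r ≤ t → t ≤ b → ‖cobd M s r t‖ ≤ C * (t - s) ^ μ)
    (D : Finset ℝ) {s t : ℝ} (has : a ≤ s) (hst : s ≤ t) (htb : t ≤ b) :
    ‖partSum M D s t - M s t‖ ≤ sewC μ * C * (t - s) ^ μ := by
  have hK := (sewC_pos hμ).le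
  induction hn : (innerPts D s t).card using Nat.strong_induction_on generalizing s t with
  | _ n ih =>
  rcases (innerPts D s t).eq_empty_or_nonempty with hF | hF
  · rw [partSum_of_empty M hF, sub_self, norm_zero]
    have := sub_nonneg.2 hst
    positivity
  set m := (s + t) / 2 with hm
  -- `u` is the last partition point up to `m`, or `s` if there is none; in both cases strictly
  -- fewer points remain in `]s, u[`.
  obtain ⟨u, hsu, hum, huD, huc, hux⟩ : ∃ u, s ≤ u ∧ u ≤ m ∧ (u ∈ D ∨ u = s) ∧
      (innerPts D s u).card < n ∧ ∀ x ∈ innerPts D s t, x ≤ m → x ≤ u := by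
    rcases ((innerPts D s t).filter (· ≤ m)).eq_empty_or_nonempty with hL | hL
    · refine ⟨s, le_rfl, by linarith, Or.inr rfl, ?_, fun x hx hxm => ?_⟩
      · rw [innerPts_self, Finset.card_empty, ← hn]; exact hF.card_pos
      · exact absurd (Finset.mem_filter.2 ⟨hx, hxm⟩) (by rw [hL]; exact Finset.notMem_empty _)
    · have h1 := Finset.mem_filter.1 (Finset.max'_mem _ hL)
      have h2 := mem_innerPts.1 h1.1
      refine ⟨_, h2.2.1.le, h1.2, Or.inl h2.1, ?_, fun x hx hxm =>
        Finset.le_max' _ _ (Finset.mem_filter.2 ⟨hx, hxm⟩)⟩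
      rw [← hn]
      refine Finset.card_lt_card ⟨fun x hx => ?_, fun h => ?_⟩
      · have := mem_innerPts.1 hx
        exact mem_innerPts.2 ⟨this.1, this.2.1, this.2.2.trans h2.2.2⟩
      · exact lt_irrefl _ (mem_innerPts.1 (h h1.1)).2.2
  -- Symmetrically, `v` is the first partition point after `m`, or `t`.
  obtain ⟨v, hvt, hmv, hvD, hvc, hvx⟩ : ∃ v, v ≤ t ∧ m ≤ v ∧ (v ∈ D ∨ v = t) ∧
      (innerPts D v t).card < n ∧ ∀ x ∈ innerPts D s t, m < x → v ≤ x := by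
    rcases ((innerPts D s t).filter (m < ·)).eq_empty_or_nonempty with hL | hL
    · refine ⟨t, le_rfl, by linarith, Or.inr rfl, ?_, fun x hx hxm => ?_⟩
      · rw [innerPts_self, Finset.card_empty, ← hn]; exact hF.card_pos
      · exact absurd (Finset.mem_filter.2 ⟨hx, hxm⟩) (by rw [hL]; exact Finset.notMem_empty _)
    · have h1 := Finset.mem_filter.1 (Finset.min'_mem _ hL)
      have h2 := mem_innerPts.1 h1.1
      refine ⟨_, h2.2.2.le, h1.2.le, Or.inl h2.1, ?_, fun x hx hxm =>
        Finset.min'_le _ _ (Finset.mem_filter.2 ⟨hx, hxm⟩)⟩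
      rw [← hn]
      refine Finset.card_lt_card ⟨fun x hx => ?_, fun h => ?_⟩
      · have := mem_innerPts.1 hx
        exact mem_innerPts.2 ⟨this.1, h2.2.1.trans this.2.1, this.2.2⟩
      · exact lt_irrefl _ (mem_innerPts.1 (h h1.1)).2.1
  have huv : innerPts D u v = ∅ := by
    refine Finset.eq_empty_of_forall_notMem fun x hx => ?_
    have hx := mem_innerPts.1 hx
    have hx' : x ∈ innerPts D s t :=
      mem_innerPts.2 ⟨hx.1, hsu.trans_lt hx.2.1, hx.2.2.trans_le hvt⟩
    rcases le_or_gt x m with h | h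
    · exact absurd (hux x hx' h) (not_le.2 hx.2.1)
    · exact absurd (hvx x hx' h) (not_le.2 hx.2.2)
  have hut : u ≤ t := hum.trans (hmv.trans hvt)
  have hsv : s ≤ v := hsu.trans (hum.trans hmv)
  have e1 : partSum M D s t = partSum M D s u + M u v + partSum M D v t := by
    rw [partSum_add hM0 (r := v) (by tauto) hsv hvt,
      partSum_add hM0 (r := u) (by tauto) hsu (hum.trans hmv), partSum_of_empty M huv]
  have e2 : partSum M D s t - M s t = (partSum M D s u - M s u) + (partSum M D v t - M v t)
      - cobd M s u v - cobd M s v t := by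
    rw [e1, cobd, cobd]; abel
  have b1 := ih _ huc has hsu (hut.trans htb) rfl
  have b2 := ih _ hvc (has.trans hsv) hvt htb rfl
  have b3 := hM s u v has hsu (hum.trans hmv) (hvt.trans htb)
  have b4 := hM s v t has hsv hvt htb
  have p1 : (u - s) ^ μ ≤ ((t - s) / 2) ^ μ :=
    Real.rpow_le_rpow (by linarith) (by linarith) (by linarith)
  have p2 : (t - v) ^ μ ≤ ((t - s) / 2) ^ μ :=
    Real.rpow_le_rpow (by linarith) (by linarith) (by linarith)
  have p3 : (v - s) ^ μ ≤ (t - s) ^ μ :=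
    Real.rpow_le_rpow (by linarith) (by linarith) (by linarith)
  have p4 := two_mul_half_rpow (μ := μ) (sub_nonneg.2 hst)
  calc ‖partSum M D s t - M s t‖
      ≤ ‖partSum M D s u - M s u‖ + ‖partSum M D v t - M v t‖ + ‖cobd M s u v‖
        + ‖cobd M s v t‖ := by
        rw [e2]
        exact (norm_sub_le _ _).trans (add_le_add_left ((norm_sub_le _ _).trans
          (add_le_add_left (norm_add_le _ _) _)) _)
    _ ≤ sewC μ * C * ((t - s) / 2) ^ μ + sewC μ * C * ((t - s) / 2) ^ μ + C * (t - s) ^ μ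
        + C * (t - s) ^ μ := by
        refine add_le_add (add_le_add (add_le_add (b1.trans ?_) (b2.trans ?_)) (b3.trans ?_)) b4
        all_goals gcongr
    _ = C * (sewC μ * (2 * ((t - s) / 2) ^ μ) + 2 * (t - s) ^ μ) := by ring
    _ = C * ((sewC μ * 2 ^ (1 - μ) + 2) * (t - s) ^ μ) := by rw [p4]; ring
    _ = sewC μ * C * (t - s) ^ μ := by rw [sewC_eq hμ]; ring

/-- The points of the partition of `[s, t]` into `n` intervals of equal length. -/
def gridPt (s t : ℝ) (n i : ℕ) : ℝ := s + i * ((t - s) / n)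

theorem gridPt_zero (s t : ℝ) (n : ℕ) : gridPt s t n 0 = s := by simp [gridPt]

theorem gridPt_self (s t : ℝ) {n : ℕ} (hn : 0 < n) : gridPt s t n n = t := by
  have : (n : ℝ) ≠ 0 := by positivity
  rw [gridPt]; field_simp; ring

theorem gridPt_succ_sub (s t : ℝ) (n i : ℕ) :
    gridPt s t n (i + 1) - gridPt s t n i = (t - s) / n := by
  simp only [gridPt]; push_cast; ring

theorem gridPt_mono {s t : ℝ} (hst : s ≤ t) (n : ℕ) : Monotone (gridPt s t n) := by
  intro i j hij
  have : 0 ≤ t - s := sub_nonneg.2 hst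
  have : (i : ℝ) ≤ j := by exact_mod_cast hij
  simp only [gridPt]; gcongr

theorem le_gridPt {s t : ℝ} (hst : s ≤ t) (n i : ℕ) : s ≤ gridPt s t n i := by
  have := gridPt_mono hst n (Nat.zero_le i)
  rwa [gridPt_zero] at this

theorem gridPt_le {s t : ℝ} (hst : s ≤ t) {n i : ℕ} (hn : 0 < n) (hi : i ≤ n) :
    gridPt s t n i ≤ t := by
  have := gridPt_mono hst n hi
  rwa [gridPt_self s t hn] at this

theorem eq_sum_grid {J : ℝ → ℝ → V} {s t : ℝ} {n : ℕ} (hn : 0 < n)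
    (h0 : J s s = 0) (h : ∀ i < n, J s (gridPt s t n (i + 1)) =
      J s (gridPt s t n i) + J (gridPt s t n i) (gridPt s t n (i + 1))) :
    J s t = ∑ i ∈ Finset.range n, J (gridPt s t n i) (gridPt s t n (i + 1)) := by
  have key : ∀ k ≤ n, J s (gridPt s t n k) =
      ∑ i ∈ Finset.range k, J (gridPt s t n i) (gridPt s t n (i + 1)) := by
    intro k
    induction k with
    | zero => intro _; rw [gridPt_zero, h0, Finset.sum_range_zero]
    | succ k ih => intro hk; rw [h k hk, Finset.sum_range_succ, ih (by omega)]
  have := key n le_rfl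
  rwa [gridPt_self s t hn] at this

/-- `J` is additive on `[a, b]`. -/
def AdditiveOn (a b : ℝ) (J : ℝ → ℝ → V) : Prop :=
  ∀ s r t, a ≤ s → s ≤ r → r ≤ t → t ≤ b → J s t = J s r + J r t

theorem AdditiveOn.diag {a b : ℝ} {J : ℝ → ℝ → V} (h : AdditiveOn a b J) {s : ℝ} (h1 : a ≤ s)
    (h2 : s ≤ b) : J s s = 0 := by
  simpa using h s s s h1 le_rfl le_rfl h2

theorem AdditiveOn.eq_sum {a b : ℝ} {J : ℝ → ℝ → V} (h : AdditiveOn a b J) {s t : ℝ} (h1 : a ≤ s)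
    (hst : s ≤ t) (h2 : t ≤ b) {n : ℕ} (hn : 0 < n) :
    J s t = ∑ i ∈ Finset.range n, J (gridPt s t n i) (gridPt s t n (i + 1)) :=
  eq_sum_grid hn (h.diag h1 (hst.trans h2)) fun i hi =>
    h _ _ _ h1 (le_gridPt hst n i) (gridPt_mono hst n i.le_succ) ((gridPt_le hst hn hi).trans h2)

/-- An additive function is the limit of the Riemann sums of any function close to it. -/
theorem AdditiveOn.tendsto_sum {a b : ℝ} {J M : ℝ → ℝ → V} (hJ : AdditiveOn a b J)
    {ω : ℝ → ℝ → ℝ} (hω : AdditiveOn a b ω) {ψ : ℝ → ℝ} (hψ : Tendsto ψ (𝓝[≥] 0) (𝓝 0))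
    (h : ∀ s t, a ≤ s → s ≤ t → t ≤ b → ‖J s t - M s t‖ ≤ ψ (t - s) * ω s t)
    {s t : ℝ} (has : a ≤ s) (hst : s ≤ t) (htb : t ≤ b) :
    Tendsto (fun n : ℕ => ∑ i ∈ Finset.range n, M (gridPt s t n i) (gridPt s t n (i + 1))) atTop
      (𝓝 (J s t)) := by
  rw [tendsto_iff_norm_sub_tendsto_zero]
  have hlim : Tendsto (fun n : ℕ => ψ ((t - s) / n) * ω s t) atTop (𝓝 0) := by
    have h1 : Tendsto (fun n : ℕ => (t - s) / (n : ℝ)) atTop (𝓝[≥] 0) := by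
      refine tendsto_nhdsWithin_iff.2 ⟨tendsto_const_div_atTop_nhds_zero_nat _, ?_⟩
      exact Eventually.of_forall fun n => div_nonneg (sub_nonneg.2 hst) n.cast_nonneg
    simpa using (hψ.comp h1).mul_const (ω s t)
  refine squeeze_zero' (Eventually.of_forall fun n => norm_nonneg _) ?_ hlim
  filter_upwards [eventually_gt_atTop 0] with n hn
  rw [norm_sub_rev, hJ.eq_sum has hst htb hn, hω.eq_sum has hst htb hn, ← Finset.sum_sub_distrib,
    Finset.mul_sum]
  refine norm_sum_le_of_le _ fun i hi => ?_
  have := h (gridPt s t n i) (gridPt s t n (i + 1)) (has.trans (le_gridPt hst n i))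
    (gridPt_mono hst n i.le_succ) ((gridPt_le hst hn (Finset.mem_range.1 hi)).trans htb)
  rwa [gridPt_succ_sub] at this

theorem tendsto_const_mul_rpow_zero {c α : ℝ} (hα : 0 < α) :
    Tendsto (fun x : ℝ => c * x ^ α) (𝓝[≥] 0) (𝓝 0) := by
  have h : Tendsto (fun x : ℝ => c * x ^ α) (𝓝 0) (𝓝 (c * 0 ^ α)) :=
    ((Real.continuousAt_rpow_const 0 α (Or.inr hα.le)).tendsto).const_mul c
  rw [Real.zero_rpow hα.ne', mul_zero] at h
  exact h.mono_left nhdsWithin_le_nhds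

theorem rpow_eq_rpow_sub_one_mul {x μ : ℝ} (hx : 0 ≤ x) (hμ : 1 < μ) :
    x ^ μ = x ^ (μ - 1) * x := by
  nth_rewrite 3 [← Real.rpow_one x]
  rw [← Real.rpow_add_of_nonneg hx (by linarith) zero_le_one]
  congr 1; ring

/-- One power of the length serves as the additive control, and the surplus `μ - 1 > 0` makes the
factor in front of it vanish with the mesh. -/
theorem AdditiveOn.tendsto_sum_of_rpow {a b : ℝ} {J M : ℝ → ℝ → V} (hJ : AdditiveOn a b J)
    {c μ : ℝ} (hμ : 1 < μ)
    (h : ∀ s t, a ≤ s → s ≤ t → t ≤ b → ‖J s t - M s t‖ ≤ c * (t - s) ^ μ)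
    {s t : ℝ} (has : a ≤ s) (hst : s ≤ t) (htb : t ≤ b) :
    Tendsto (fun n : ℕ => ∑ i ∈ Finset.range n, M (gridPt s t n i) (gridPt s t n (i + 1))) atTop
      (𝓝 (J s t)) := by
  refine hJ.tendsto_sum (ω := fun s t => t - s) (fun s r t _ _ _ _ => by ring)
    (tendsto_const_mul_rpow_zero (c := c) (sub_pos.2 hμ)) (fun s t h1 h2 h3 => ?_) has hst htb
  refine (h s t h1 h2 h3).trans_eq ?_
  rw [rpow_eq_rpow_sub_one_mul (sub_nonneg.2 h2) hμ, mul_assoc]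

/-- The sewing lemma: an almost additive function is close to an additive one. -/
theorem exists_additive [CompleteSpace V] {M : ℝ → ℝ → V} (hM0 : ∀ t, M t t = 0) {a b C μ : ℝ}
    (hμ : 1 < μ) (hC : 0 ≤ C)
    (hM : ∀ s r t, a ≤ s → s ≤ r → r ≤ t → t ≤ b → ‖cobd M s r t‖ ≤ C * (t - s) ^ μ) :
    ∃ J : ℝ → ℝ → V, AdditiveOn a b J ∧
      ∀ s t, a ≤ s → s ≤ t → t ≤ b → ‖J s t - M s t‖ ≤ sewC μ * C * (t - s) ^ μ := by
  -- The limit is taken along all finite sets of reals directed by inclusion, so that any given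
  -- point eventually belongs to the partition.
  have hlim : ∀ s t, a ≤ s → s ≤ t → t ≤ b →
      ∃ x, Tendsto (fun D => partSum M D s t) atTop (𝓝 x) := by
    intro s t has hst htb
    refine cauchySeq_tendsto_of_complete (Metric.cauchySeq_iff'.2 fun ε hε => ?_)
    have h1 : Tendsto (fun n : ℕ => 2 * (sewC μ * C) * ((t - s) / (n : ℝ)) ^ (μ - 1) * (t - s))
        atTop (𝓝 0) := by
      have h2 : Tendsto (fun n : ℕ => (t - s) / (n : ℝ)) atTop (𝓝[≥] 0) := by
        refine tendsto_nhdsWithin_iff.2 ⟨tendsto_const_div_atTop_nhds_zero_nat _, ?_⟩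
        exact Eventually.of_forall fun n => div_nonneg (sub_nonneg.2 hst) n.cast_nonneg
      simpa using ((tendsto_const_mul_rpow_zero (c := 2 * (sewC μ * C))
        (sub_pos.2 hμ)).comp h2).mul_const (t - s)
    obtain ⟨n, hn, hn0⟩ := ((h1.eventually (gt_mem_nhds hε)).and (eventually_gt_atTop 0)).exists
    -- Once `D` contains a fine uniform grid, the sum splits over the cells. In each cell two
    -- partition sums differ by at most twice the uniform bound, and the total is of order (mesh)`^
    -- (μ - 1)`.
    have hsum : ∀ D : Finset ℝ, (Finset.range (n + 1)).image (gridPt s t n) ⊆ D →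
        partSum M D s t =
          ∑ i ∈ Finset.range n, partSum M D (gridPt s t n i) (gridPt s t n (i + 1)) := by
      intro D hD
      refine eq_sum_grid hn0 (by rw [partSum_of_empty M (innerPts_self D s), hM0]) fun i hi => ?_
      refine partSum_add hM0 (Or.inl (hD (Finset.mem_image_of_mem _ ?_)))
        (le_gridPt hst n i) (gridPt_mono hst n i.le_succ)
      exact Finset.mem_range.2 (by omega)
    refine ⟨(Finset.range (n + 1)).image (gridPt s t n), fun D hD => lt_of_le_of_lt ?_ hn⟩
    rw [dist_eq_norm, hsum D hD, hsum _ subset_rfl, ← Finset.sum_sub_distrib]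
    have h3 : ∀ i ∈ Finset.range n, ‖partSum M D (gridPt s t n i) (gridPt s t n (i + 1)) -
        partSum M ((Finset.range (n + 1)).image (gridPt s t n)) (gridPt s t n i)
          (gridPt s t n (i + 1))‖ ≤ 2 * (sewC μ * C) * ((t - s) / (n : ℝ)) ^ μ := by
      intro i hi
      have hb := fun D' : Finset ℝ => norm_partSum_sub_le hM0 hμ hC hM D'
        (has.trans (le_gridPt hst n i)) (gridPt_mono hst n i.le_succ)
        ((gridPt_le hst hn0 (Finset.mem_range.1 hi)).trans htb)
      rw [← sub_sub_sub_cancel_right _ _ (M (gridPt s t n i) (gridPt s t n (i + 1)))]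
      refine (norm_sub_le _ _).trans ((add_le_add (hb _) (hb _)).trans_eq ?_)
      rw [gridPt_succ_sub]; ring
    refine (norm_sum_le_of_le _ h3).trans_eq ?_
    have hn' : (n : ℝ) ≠ 0 := by positivity
    rw [Finset.sum_const, Finset.card_range, nsmul_eq_mul, rpow_eq_rpow_sub_one_mul
      (div_nonneg (sub_nonneg.2 hst) n.cast_nonneg) hμ]
    field_simp
  refine ⟨fun s t => limUnder atTop fun D => partSum M D s t, fun s r t h1 h2 h3 h4 => ?_,
    fun s t h1 h2 h3 => ?_⟩
  · have l1 := tendsto_nhds_limUnder (hlim s t h1 (h2.trans h3) h4)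
    have l2 := tendsto_nhds_limUnder (hlim s r h1 h2 (h3.trans h4))
    have l3 := tendsto_nhds_limUnder (hlim r t (h1.trans h2) h3 h4)
    refine tendsto_nhds_unique l1 ((l2.add l3).congr' ?_)
    -- Additivity is exact as soon as `r ∈ D`.
    filter_upwards [eventually_ge_atTop {r}] with D hD
    exact (partSum_add hM0 (Or.inl (hD (Finset.mem_singleton_self r))) h2 h3).symm
  · have l1 := (tendsto_nhds_limUnder (hlim s t h1 h2 h3)).sub_const (M s t)
    exact le_of_tendsto l1.norm
      (Eventually.of_forall fun D => norm_partSum_sub_le hM0 hμ hC hM D h1 h2 h3)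

/-- The quantitative uniqueness in the sewing lemma. -/
theorem norm_le_of_cobd_le {R : ℝ → ℝ → V} {a b C L μ : ℝ} (hμ : 1 < μ) (hC : 0 ≤ C)
    (hR : ∀ s t, a ≤ s → s ≤ t → t ≤ b → ‖R s t‖ ≤ L * (t - s) ^ μ)
    (hδ : ∀ s r t, a ≤ s → s ≤ r → r ≤ t → t ≤ b → ‖cobd R s r t‖ ≤ C * (t - s) ^ μ)
    {s t : ℝ} (has : a ≤ s) (hst : s ≤ t) (htb : t ≤ b) :
    ‖R s t‖ ≤ sewC μ * C * (t - s) ^ μ := by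
  set q : ℝ := 2 ^ (1 - μ) with hq
  have hq0 : 0 ≤ q := by positivity
  -- Each bisection multiplies the a priori constant `L` by `q = 2 ^ (1 - μ) < 1`, so `L` disappears
  -- in the limit and only the coboundary bound remains.
  have key : ∀ n : ℕ, ∀ s t, a ≤ s → s ≤ t → t ≤ b →
      ‖R s t‖ ≤ (sewC μ * C + q ^ n * |L|) * (t - s) ^ μ := by
    intro n
    induction n with
    | zero =>
      intro s t h1 h2 h3
      refine (hR s t h1 h2 h3).trans ?_
      have := sub_nonneg.2 h2
      have := (sewC_pos hμ).le
      gcongr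
      rw [pow_zero, one_mul]
      exact (le_abs_self L).trans (le_add_of_nonneg_left (by positivity))
    | succ n ih =>
      intro s t h1 h2 h3
      have b1 := ih s ((s + t) / 2) h1 (by linarith) (by linarith)
      have b2 := ih ((s + t) / 2) t (by linarith) (by linarith) h3
      have b3 := hδ s ((s + t) / 2) t h1 (by linarith) (by linarith) h3
      rw [show (s + t) / 2 - s = (t - s) / 2 by ring] at b1
      rw [show t - (s + t) / 2 = (t - s) / 2 by ring] at b2
      have e : R s t = R s ((s + t) / 2) + R ((s + t) / 2) t + cobd R s ((s + t) / 2) t := by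
        rw [cobd]; abel
      have p := two_mul_half_rpow (μ := μ) (sub_nonneg.2 h2)
      have h0 : 0 ≤ C * (t - s) ^ μ := by have := sub_nonneg.2 h2; positivity
      calc ‖R s t‖ ≤ ‖R s ((s + t) / 2)‖ + ‖R ((s + t) / 2) t‖ + ‖cobd R s ((s + t) / 2) t‖ := by
            rw [e]; exact norm_add₃_le
        -- Only one coboundary occurs here; it is counted twice so that `sewC_eq` applies.
        _ ≤ (sewC μ * C + q ^ n * |L|) * (2 * ((t - s) / 2) ^ μ) + 2 * (C * (t - s) ^ μ) := by
            linarith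
        _ = ((sewC μ * q + 2) * C + q ^ (n + 1) * |L|) * (t - s) ^ μ := by
            rw [p]; ring
        _ = _ := by rw [hq, sewC_eq hμ]
  have hlim : Tendsto (fun n : ℕ => (sewC μ * C + q ^ n * |L|) * (t - s) ^ μ) atTop
      (𝓝 ((sewC μ * C + 0 * |L|) * (t - s) ^ μ)) :=
    (((tendsto_pow_atTop_nhds_zero_of_lt_one hq0 (two_rpow_one_sub_lt_one hμ)).mul_const
      _).const_add _).mul_const _
  rw [zero_mul, add_zero] at hlim
  exact ge_of_tendsto' hlim fun n => key n s t has hst htb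

/-- Continuity on the simplex of a function that is small near the diagonal and whose coboundary
is small when two consecutive times are close. -/
theorem continuousOn_simplex {M : ℝ → ℝ → V} {T c γ : ℝ} (hγ : 0 < γ)
    (hM : ∀ s t, 0 ≤ s → s ≤ t → t ≤ T → ‖M s t‖ ≤ c * (t - s) ^ γ)
    (hl : ∀ s r t, 0 ≤ s → s ≤ r → r ≤ t → t ≤ T → ‖cobd M s r t‖ ≤ c * (r - s) ^ γ)
    (hr : ∀ s r t, 0 ≤ s → s ≤ r → r ≤ t → t ≤ T → ‖cobd M s r t‖ ≤ c * (t - r) ^ γ) :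
    ContinuousOn (fun p : ℝ × ℝ => M p.1 p.2)
      {p | p.1 ∈ Set.Icc 0 T ∧ p.2 ∈ Set.Icc 0 T ∧ p.1 ≤ p.2} := by
  -- First the case of nested intervals `[s, t] ⊆ [s', t']`.
  have key : ∀ s' s t t', 0 ≤ s' → s' ≤ s → s ≤ t → t ≤ t' → t' ≤ T →
      ‖M s' t' - M s t‖ ≤ 2 * c * (s - s') ^ γ + 2 * c * (t' - t) ^ γ := by
    intro s' s t t' h1 h2 h3 h4 h5
    have e : M s' t' - M s t = M s' s + cobd M s' s t' + M t t' + cobd M s t t' := by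
      rw [cobd, cobd]; abel
    rw [e]
    refine (norm_add_le _ _).trans ?_
    have := norm_add₃_le (a := M s' s) (b := cobd M s' s t') (c := M t t')
    have := hM s' s h1 h2 (by linarith)
    have := hM t t' (by linarith) h4 h5
    have := hl s' s t' h1 h2 (by linarith) h5
    have := hr s t t' (by linarith) h3 h4 h5
    linarith
  rintro ⟨s, t⟩ ⟨hs, ht, hst⟩
  rw [ContinuousWithinAt, tendsto_iff_norm_sub_tendsto_zero]
  have hlim : Tendsto (fun p : ℝ × ℝ => 2 * (2 * |c| * |p.1 - s| ^ γ + 2 * |c| * |p.2 - t| ^ γ))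
      (𝓝[{p | p.1 ∈ Set.Icc 0 T ∧ p.2 ∈ Set.Icc 0 T ∧ p.1 ≤ p.2}] (s, t)) (𝓝 0) := by
    have h1 : Continuous fun p : ℝ × ℝ =>
        2 * (2 * |c| * |p.1 - s| ^ γ + 2 * |c| * |p.2 - t| ^ γ) := by
      have := fun f : ℝ × ℝ → ℝ => fun hf : Continuous f =>
        hf.rpow_const (p := γ) fun _ => Or.inr hγ.le
      have h2 := this (fun p => |p.1 - s|) (by fun_prop)
      have h3 := this (fun p => |p.2 - t|) (by fun_prop)
      fun_prop
    have h2 := (h1.tendsto (s, t)).mono_left (nhdsWithin_le_nhds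
      (s := {p | p.1 ∈ Set.Icc 0 T ∧ p.2 ∈ Set.Icc 0 T ∧ p.1 ≤ p.2}))
    simpa [Real.zero_rpow hγ.ne'] using h2
  refine squeeze_zero' (Eventually.of_forall fun n => norm_nonneg _) ?_ hlim
  filter_upwards [self_mem_nhdsWithin] with p hp
  obtain ⟨s', t'⟩ := p
  obtain ⟨hs', ht', hst'⟩ := hp
  simp only at hs' ht' hst' hs ht hst ⊢
  -- Two arbitrary intervals are both compared with the interval from `min s s'` to `max t t'`,
  -- which contains them.
  have hbd : ∀ x y x₁ y₁, 0 ≤ x₁ → x₁ ≤ |s' - s| → 0 ≤ y₁ → y₁ ≤ |t' - t| →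
      ‖M (min s s') (max t t') - M x y‖ ≤ 2 * c * x₁ ^ γ + 2 * c * y₁ ^ γ →
      ‖M (min s s') (max t t') - M x y‖ ≤ 2 * |c| * |s' - s| ^ γ + 2 * |c| * |t' - t| ^ γ := by
    intro x y x₁ y₁ h1 h2 h3 h4 h5
    refine h5.trans ?_
    have := le_abs_self c
    gcongr
  have hm0 : 0 ≤ min s s' := le_min hs.1 hs'.1
  have hmT : max t t' ≤ T := max_le ht.2 ht'.2
  have a1 := hbd s t (s - min s s') (max t t' - t) (by linarith [min_le_left s s'])
    (by rcases min_choice s s' with h | h <;> rw [h]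
        · simp
        · exact (le_abs_self _).trans_eq (abs_sub_comm _ _))
    (by linarith [le_max_left t t'])
    (by rcases max_choice t t' with h | h <;> rw [h]
        · simp
        · exact le_abs_self _)
    (key _ _ _ _ hm0 (min_le_left _ _) hst (le_max_left _ _) hmT)
  have a2 := hbd s' t' (s' - min s s') (max t t' - t') (by linarith [min_le_right s s'])
    (by rcases min_choice s s' with h | h <;> rw [h]
        · exact le_abs_self _
        · simp)
    (by linarith [le_max_right t t'])
    (by rcases max_choice t t' with h | h <;> rw [h]
        · exact (le_abs_self _).trans_eq (abs_sub_comm _ _)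
        · simp)
    (key _ _ _ _ hm0 (min_le_right _ _) hst' (le_max_right _ _) hmT)
  rw [← sub_sub_sub_cancel_left _ _ (M (min s s') (max t t'))]
  exact (norm_sub_le _ _).trans (by linarith)

end SewingLemma

/-! ### Trace inequalities, regularized polar decomposition and weak limits of operators. -/

section Expectation

open Filter Topology

/-- Since `a a* ≤ r²`, the difference is positive. It is factored as `y y*` because positivity of
the trace is available only for elements of this form. -/
theorem exists_one_sub_mul_star_eq {B : Type*} [CStarAlgebra B] {a : B} {r : ℝ} (ha : ‖a‖ ≤ r) :
    ∃ y : B, ((r ^ 2 : ℝ) : ℂ) • (1 : B) - a * star a = y * star y := by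
  let _ : PartialOrder B := CStarAlgebra.spectralOrder B
  let _ : StarOrderedRing B := CStarAlgebra.spectralOrderedRing B
  have h1 : a * star a ≤ algebraMap ℝ B (‖a‖ ^ 2) := CStarAlgebra.mul_star_le_algebraMap_norm_sq
  have h2 : algebraMap ℝ B (‖a‖ ^ 2) ≤ algebraMap ℝ B (r ^ 2) :=
    algebraMap_mono B (by gcongr)
  obtain ⟨y, hy⟩ := CStarAlgebra.nonneg_iff_eq_star_mul_self.1 (sub_nonneg.2 (h1.trans h2))
  refine ⟨star y, ?_⟩
  rw [star_star, ← hy, Algebra.algebraMap_eq_smul_one]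
  congr 1

/-- A regularized polar decomposition: `c` and `d = c⁻¹` stand for the square root of
`(b* b + ε) ^ (1 / 2)` and for its inverse. -/
theorem exists_regularized_polar {B : Type*} [CStarAlgebra B] (b : B) {ε : ℝ} (hε : 0 < ε) :
    ∃ c d : B, star c = c ∧ star d = d ∧ c * d = 1 ∧ d * c = 1 ∧
      c * c - d * (star b * b) * d = ((ε : ℝ) : ℂ) • (d * d) ∧ ‖d‖ ^ 4 ≤ 1 / ε ∧
      ‖d * d * star b‖ ≤ 1 := by
  set u := star b * b with hu
  have hsa : IsSelfAdjoint u := IsSelfAdjoint.star_mul_self b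
  have hsp : ∀ x ∈ spectrum ℝ u, 0 ≤ x := spectrum_star_mul_self_nonneg
  -- `f` is the fourth root of `t + ε`. The truncation `max t 0` is invisible on the spectrum of `b*
  -- b` and keeps `f` positive on `ℝ`, so that `1 / f` is continuous.
  set f : ℝ → ℝ := fun t => √(√(max t 0 + ε)) with hf
  set g : ℝ → ℝ := fun t => (f t)⁻¹ with hg
  have hpos : ∀ t, 0 < max t 0 + ε := fun t => by positivity
  have hfpos : ∀ t, 0 < f t := fun t => Real.sqrt_pos.2 (Real.sqrt_pos.2 (hpos t))
  have hfc : Continuous f := by fun_prop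
  have hgc : Continuous g := hfc.inv₀ fun t => (hfpos t).ne'
  have hf4 : ∀ t, f t * f t * (f t * f t) = max t 0 + ε := fun t => by
    rw [hf]
    simp only
    rw [Real.mul_self_sqrt (Real.sqrt_nonneg _), Real.mul_self_sqrt (hpos t).le]
  have hfco := hfc.continuousOn (s := spectrum ℝ u)
  have hgco := hgc.continuousOn (s := spectrum ℝ u)
  have hid : cfc (fun t : ℝ => t) u = u := cfc_id' ℝ u
  have hcd : cfc f u * cfc g u = 1 := by
    rw [← cfc_mul f g u, ← cfc_one ℝ u]
    exact cfc_congr fun t _ => mul_inv_cancel₀ (hfpos t).ne'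
  have hdc : cfc g u * cfc f u = 1 := by
    rw [← cfc_mul g f u, ← cfc_one ℝ u]
    exact cfc_congr fun t _ => inv_mul_cancel₀ (hfpos t).ne'
  have hdu : cfc g u * u = cfc (fun t => g t * t) u := by
    nth_rewrite 2 [← hid]; rw [← cfc_mul g _ u]
  have hdd : cfc g u * cfc g u = cfc (fun t => g t * g t) u := (cfc_mul g g u).symm
  have hdud : cfc g u * u * cfc g u = cfc (fun t => g t * t * g t) u := by
    rw [hdu, ← cfc_mul _ g u]
  refine ⟨cfc f u, cfc g u, (cfc_predicate f u : IsSelfAdjoint _).star_eq,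
    (cfc_predicate g u : IsSelfAdjoint _).star_eq, hcd, hdc, ?_, ?_, ?_⟩
  · rw [hdud, ← cfc_mul f f u, hdd, ← cfc_sub _ _ u]
    have : ((ε : ℝ) : ℂ) • cfc (fun t => g t * g t) u = cfc (fun t => ε • (g t * g t)) u := by
      rw [cfc_smul ε (fun t => g t * g t) u]; rfl
    rw [this]
    refine cfc_congr fun t ht => ?_
    have h1 := hf4 t
    rw [max_eq_left (hsp t ht)] at h1
    have h2 := (hfpos t).ne'
    simp only [hg, smul_eq_mul]
    field_simp
    linarith [h1, show f t ^ 4 = f t * f t * (f t * f t) by ring]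
  · have h1 : ‖cfc g u‖ ≤ (√(√ε))⁻¹ := by
      refine norm_cfc_le (by positivity) fun t _ => ?_
      rw [Real.norm_of_nonneg (inv_nonneg.2 (hfpos t).le)]
      refine inv_anti₀ (by positivity) (Real.sqrt_le_sqrt (Real.sqrt_le_sqrt ?_))
      linarith [le_max_right t 0]
    calc ‖cfc g u‖ ^ 4 ≤ ((√(√ε))⁻¹) ^ 4 := by gcongr
      _ = 1 / ε := by
        rw [inv_pow, show (√(√ε)) ^ 4 = ((√(√ε)) ^ 2) ^ 2 by ring,
          Real.sq_sqrt (Real.sqrt_nonneg _), Real.sq_sqrt hε.le, one_div]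
  · have h1 : (cfc g u * cfc g u * star b) * star (cfc g u * cfc g u * star b) =
        cfc (fun t => g t * g t * t * (g t * g t)) u := by
      have hs : star (cfc g u) = cfc g u := (cfc_predicate g u : IsSelfAdjoint _).star_eq
      rw [star_mul, star_star, star_mul, hs]
      calc cfc g u * cfc g u * star b * (b * (cfc g u * cfc g u))
          = cfc g u * cfc g u * u * (cfc g u * cfc g u) := by rw [hu]; noncomm_ring
        _ = _ := by
          nth_rewrite 3 [← hid]
          rw [hdd, ← cfc_mul _ _ u, ← cfc_mul _ _ u]
    -- By the C⋆-identity the squared norm is that of the function `t / (t + ε)` of `b* b`, which is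
    -- at most `1`.
    have h2 : ‖(cfc g u * cfc g u * star b) * star (cfc g u * cfc g u * star b)‖ ≤ 1 := by
      rw [h1]
      refine norm_cfc_le zero_le_one fun t ht => ?_
      have h3 := hsp t ht
      have h4 := hf4 t
      rw [max_eq_left h3] at h4
      have h5 := (hfpos t).ne'
      have h6 : g t * g t * t * (g t * g t) = t / (t + ε) := by
        rw [← h4]; simp only [hg]; field_simp
      rw [h6, Real.norm_of_nonneg (by positivity), div_le_one (by positivity)]
      linarith
    rw [CStarRing.norm_self_mul_star] at h2
    nlinarith [norm_nonneg (cfc g u * cfc g u * star b)]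

section TracialFunctional

variable {B : Type*} [CStarAlgebra B] {φ : B →ₗ[ℂ] ℂ}

/-- The imaginary part of `φ((1 + iz)(1 + iz)*)` vanishes, and so do those of its terms `φ(1)` and
`φ(z z*)`. -/
theorem re_map_star (hφ : ∀ a, 0 ≤ (φ (a * star a)).re ∧ (φ (a * star a)).im = 0) (z : B) :
    (φ (star z)).re = (φ z).re := by
  have h1 := (hφ (1 + Complex.I • z)).2
  have h2 := (hφ z).2
  have h3 := (hφ 1).2
  have e : (1 + Complex.I • z) * star (1 + Complex.I • z) =
      1 * star 1 + Complex.I • z - Complex.I • star z + z * star z := by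
    simp only [star_add, star_one, star_smul, Complex.star_def, Complex.conj_I, mul_add, add_mul,
      mul_one, one_mul, smul_mul_smul_comm]
    simp [sub_eq_add_neg]; abel
  rw [e] at h1
  simp only [map_add, map_sub, map_smul, Complex.add_im, Complex.sub_im, h2, h3, smul_eq_mul,
    Complex.mul_im, Complex.I_re, Complex.I_im] at h1
  linarith

/-- The Cauchy–Schwarz inequality in additive form, from `φ((x - y*)(x - y*)*) ≥ 0`. -/
theorem two_re_map_mul_le (hφ : ∀ a, 0 ≤ (φ (a * star a)).re ∧ (φ (a * star a)).im = 0)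
    (x y : B) :
    2 * (φ (x * y)).re ≤ (φ (x * star x)).re + (φ (star y * y)).re := by
  have h1 := (hφ (x - star y)).1
  have h2 := re_map_star hφ (x * y)
  have e : (x - star y) * star (x - star y) =
      x * star x - x * y - star (x * y) + star y * y := by
    simp only [star_sub, star_star, star_mul]; noncomm_ring
  rw [e] at h1
  simp only [map_add, map_sub, Complex.add_re, Complex.sub_re, h2] at h1
  linarith

/-- With `r² - a a* = y y*`, the difference of the two sides is `φ((c y)(c y)*)`. -/
theorem re_map_conj_le (hφ : ∀ a, 0 ≤ (φ (a * star a)).re ∧ (φ (a * star a)).im = 0)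
    {a c : B} {r : ℝ} (ha : ‖a‖ ≤ r) :
    (φ (c * a * star (c * a))).re ≤ r ^ 2 * (φ (c * star c)).re := by
  obtain ⟨y, hy⟩ := exists_one_sub_mul_star_eq ha
  have h1 := (hφ (c * y)).1
  have e : c * y * star (c * y) = ((r ^ 2 : ℝ) : ℂ) • (c * star c) - c * a * star (c * a) := by
    calc c * y * star (c * y) = c * (y * star y) * star c := by rw [star_mul]; noncomm_ring
      _ = _ := by rw [← hy, star_mul, mul_sub, sub_mul, mul_smul_comm, smul_mul_assoc, mul_one]
                  noncomm_ring
  rw [e, map_sub, map_smul, Complex.sub_re, smul_eq_mul, Complex.re_ofReal_mul] at h1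
  linarith

/-- Traciality and `d c = 1` give `φ(ab) = φ((c a)(b d))`, and Cauchy–Schwarz bounds twice its real
part by `φ(c²) + φ(d b* b d)`. The two terms differ by `ε φ(d²)`, which is at most `√ε φ(1)` because
`‖d‖² ≤ ε ^ (-1/2)`. -/
theorem re_map_mul_le_of_polar (hφ : ∀ a, 0 ≤ (φ (a * star a)).re ∧ (φ (a * star a)).im = 0)
    (hτ : ∀ a b, φ (a * b) = φ (b * a)) {a b c d : B} {ε : ℝ} (hε : 0 < ε) (ha : ‖a‖ ≤ 1)
    (hc : star c = c) (hd : star d = d) (hdc : d * c = 1)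
    (h : c * c - d * (star b * b) * d = ((ε : ℝ) : ℂ) • (d * d)) (hdn : ‖d‖ ^ 4 ≤ 1 / ε) :
    (φ (a * b)).re ≤ (φ (d * d * star b * b)).re + √ε * (φ 1).re := by
  have h1 : φ (a * b) = φ (c * a * (b * d)) := by
    calc φ (a * b) = φ (a * b * d * c) := by rw [mul_assoc _ d c, hdc, mul_one]
      _ = φ (c * (a * b * d)) := hτ _ _
      _ = _ := by simp only [mul_assoc]
  have h2 := two_re_map_mul_le hφ (c * a) (b * d)
  have h3 := re_map_conj_le hφ (c := c) ha
  have h4 : star (b * d) * (b * d) = d * (star b * b) * d := by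
    rw [star_mul, hd]; noncomm_ring
  have h5 : φ (d * d * star b * b) = φ (d * (star b * b) * d) := by
    rw [hτ (d * (star b * b)) d]; congr 1; noncomm_ring
  have h6 := congrArg (fun x => (φ x).re) h
  have h7 := (hφ d).1
  have h8 := re_map_conj_le hφ (c := 1) (le_refl ‖d‖)
  have h9 := (hφ 1).1
  rw [hd] at h7
  rw [hc] at h3
  simp only [map_sub, Complex.sub_re, map_smul, smul_eq_mul, Complex.re_ofReal_mul] at h6
  rw [h4] at h2
  simp only [one_mul, star_one, mul_one, hd] at h8 h9
  have h10 : ε * ‖d‖ ^ 2 ≤ √ε := by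
    refine Real.le_sqrt_of_sq_le ?_
    calc (ε * ‖d‖ ^ 2) ^ 2 = ε ^ 2 * ‖d‖ ^ 4 := by ring
      _ ≤ ε ^ 2 * (1 / ε) := by gcongr
      _ = ε := by field_simp
  have h11 : ε * (φ (d * d)).re ≤ √ε * (φ 1).re := by
    calc ε * (φ (d * d)).re ≤ ε * (‖d‖ ^ 2 * (φ 1).re) := by gcongr
      _ = (ε * ‖d‖ ^ 2) * (φ 1).re := by ring
      _ ≤ _ := by gcongr
  have h12 : 0 ≤ ε * (φ (d * d)).re := by positivity
  rw [h1, h5]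
  linarith

end TracialFunctional

section WeakLimits

variable {H : Type*} [NormedAddCommGroup H] [InnerProductSpace ℂ H] [CompleteSpace H]

/-- A bounded family of operators converges weakly along every ultrafilter. -/
theorem exists_weak_limit {ι : Type*} (F : Ultrafilter ι) {y : ι → H →L[ℂ] H} {r : ℝ}
    (hr : 0 ≤ r) (hy : ∀ i, ‖y i‖ ≤ r) :
    ∃ x : H →L[ℂ] H, ‖x‖ ≤ r ∧
      ∀ h k, Tendsto (fun i => inner ℂ k (y i h)) F (𝓝 (inner ℂ k (x h))) := by
  have hb : ∀ h k i, ‖inner ℂ (y i h) k‖ ≤ r * ‖h‖ * ‖k‖ := fun h k i =>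
    (norm_inner_le_norm _ _).trans (by gcongr; exact (y i).le_of_opNorm_le (hy i) h)
  -- Each matrix coefficient stays in a compact disc, so it converges along the ultrafilter.
  have hlim : ∀ h k, ∃ z, Tendsto (fun i => inner ℂ (y i h) k) F (𝓝 z) := fun h k => by
    obtain ⟨z, -, hz⟩ := (isCompact_closedBall (0 : ℂ) (r * ‖h‖ * ‖k‖)).ultrafilter_le_nhds
      (F.map fun i => inner ℂ (y i h) k)
      (by rw [Ultrafilter.coe_map, le_principal_iff, mem_map]
          exact Eventually.of_forall fun i => by simpa using hb h k i)
    exact ⟨z, hz⟩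
  choose β hβ using hlim
  have hβn : ∀ h k, ‖β h k‖ ≤ r * ‖h‖ * ‖k‖ := fun h k =>
    le_of_tendsto (hβ h k).norm (Eventually.of_forall (hb h k))
  -- The limits form a bounded sesquilinear form, which is represented by an operator.
  let L : H →L⋆[ℂ] H →L[ℂ] ℂ := LinearMap.mkContinuous₂
    (LinearMap.mk₂'ₛₗ (starRingEnd ℂ) (RingHom.id ℂ) β
      (fun h h' k => tendsto_nhds_unique (hβ _ _)
        (((hβ h k).add (hβ h' k)).congr fun i => by rw [map_add, inner_add_left]))
      (fun c h k => tendsto_nhds_unique (hβ _ _)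
        (((hβ h k).const_mul (starRingEnd ℂ c)).congr fun i => by rw [map_smul, inner_smul_left]))
      (fun h k k' => tendsto_nhds_unique (hβ _ _)
        (((hβ h k).add (hβ h k')).congr fun i => by rw [inner_add_right]))
      (fun c h k => tendsto_nhds_unique (hβ _ _)
        (((hβ h k).const_mul c).congr fun i => by rw [inner_smul_right]))) r hβn
  have hL : ∀ h k, inner ℂ (InnerProductSpace.continuousLinearMapOfBilin L h) k = β h k :=
    fun h k => InnerProductSpace.continuousLinearMapOfBilin_apply L h k
  refine ⟨InnerProductSpace.continuousLinearMapOfBilin L, ?_, fun h k => ?_⟩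
  · refine ContinuousLinearMap.opNorm_le_bound _ hr fun h => ?_
    set w := InnerProductSpace.continuousLinearMapOfBilin L h with hw
    have h1 := hβn h w
    rw [← hL, ← hw, inner_self_eq_norm_sq_to_K] at h1
    rcases eq_or_lt_of_le (norm_nonneg w) with h0 | h0
    · rw [← h0]; positivity
    · have h2 : ‖w‖ * ‖w‖ ≤ r * ‖h‖ * ‖w‖ := by
        simpa [sq] using h1
      exact le_of_mul_le_mul_right h2 h0
  · have h1 := (continuous_star.tendsto _).comp (hβ h k)
    rw [← hL] at h1
    have e : ∀ z : H, star (inner ℂ z k) = inner ℂ k z := fun z => inner_conj_symm _ _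
    rw [e] at h1
    exact h1.congr fun i => e _

/-- This keeps weak limits inside a commutant: in a matrix coefficient `q` moves to the other vector
as its adjoint. -/
theorem commute_of_weak_limit {ι : Type*} {F : Filter ι} [F.NeBot] {y : ι → H →L[ℂ] H}
    {x q : H →L[ℂ] H}
    (hx : ∀ h k, Tendsto (fun i => inner ℂ k (y i h)) F (𝓝 (inner ℂ k (x h))))
    (hq : ∀ i, q * y i = y i * q) : q * x = x * q := by
  ext h
  refine ext_inner_left ℂ fun k => ?_
  have h1 := hx h (ContinuousLinearMap.adjoint q k)
  have h2 := hx (q h) k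
  simp only [ContinuousLinearMap.adjoint_inner_left] at h1
  refine tendsto_nhds_unique h1 (h2.congr fun i => ?_)
  have := congrArg (fun z : H →L[ℂ] H => z h) (hq i)
  simp only [mul_apply_eq_comp] at this
  rw [this]

end WeakLimits

end Expectation

/-! ### The trace-preserving conditional expectation, by duality. -/

section Expectation

open Filter Topology

variable {H : Type*} [NormedAddCommGroup H] [InnerProductSpace ℂ H] [CompleteSpace H]

/-- The C⋆-algebra structure of a von Neumann algebra. -/
abbrev vonNeumannCStar (A : VonNeumannAlgebra H) : CStarAlgebra A.toStarSubalgebra where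
  toCompleteSpace := inferInstance
  norm_mul_self_le x := CStarRing.norm_star_mul_self (x := (x : H →L[ℂ] H)) |>.symm.le

/-- `N` consists of the elements of `A` that commute with `Q`, and `Q` contains enough operators to
force membership in `A`. -/
structure IsCommutantOf (A : VonNeumannAlgebra H) (N : StarSubalgebra ℂ A.toStarSubalgebra)
    (Q : Set (H →L[ℂ] H)) : Prop where
  mem_iff : ∀ x : A.toStarSubalgebra, x ∈ N ↔ (x : H →L[ℂ] H) ∈ Q.centralizer
  mem_of_mem : ∀ x ∈ Q.centralizer, x ∈ A.toStarSubalgebra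

variable {A : VonNeumannAlgebra H} {N : StarSubalgebra ℂ A.toStarSubalgebra}
  {Q : Set (H →L[ℂ] H)} {φ : A.toStarSubalgebra →ₗ[ℂ] ℂ}

theorem IsCommutantOf.isClosed (hN : IsCommutantOf A N Q) :
    IsClosed (N : Set A.toStarSubalgebra) := by
  have : (N : Set A.toStarSubalgebra) = Subtype.val ⁻¹' Q.centralizer := Set.ext hN.mem_iff
  rw [this]
  exact (Set.isClosed_centralizer _).preimage continuous_subtype_val

/-- Along a bounded family that converges weakly, a trace converges after multiplication by a
fixed element. -/
theorem IsTrace.tendsto_mul (hφ : IsTrace A φ) {ι : Type*} {F : Filter ι}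
    {y : ι → A.toStarSubalgebra} {x : A.toStarSubalgebra} (hy : ∀ i, ‖y i‖ ≤ 1) (hx : ‖x‖ ≤ 1)
    (h : ∀ h k, Tendsto (fun i => inner ℂ k ((y i : H →L[ℂ] H) h)) F
      (𝓝 (inner ℂ k ((x : H →L[ℂ] H) h)))) (b : A.toStarSubalgebra) :
    Tendsto (fun i => φ (y i * b)) F (𝓝 (φ (x * b))) := by
  -- Weak continuity of `φ` is given on the unit ball only, so `b` is scaled into it; the `+ 1`
  -- avoids dividing by zero.
  set τ : ℂ := ((‖b‖ + 1 : ℝ) : ℂ)⁻¹ with hτ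
  have hpos : 0 < ‖b‖ + 1 := by positivity
  have hτ0 : τ ≠ 0 := inv_ne_zero (by exact_mod_cast hpos.ne')
  have hτb : ‖τ • b‖ ≤ 1 := by
    rw [norm_smul, hτ, norm_inv, Complex.norm_real, Real.norm_of_nonneg hpos.le,
      inv_mul_le_one₀ hpos]
    linarith
  have hball : ∀ z : A.toStarSubalgebra, ‖z‖ ≤ 1 → ‖z * (τ • b)‖ ≤ 1 := fun z hz =>
    (norm_mul_le _ _).trans (mul_le_one₀ hz (norm_nonneg _) hτb)
  have h1 : Tendsto (fun i => φ (y i * (τ • b))) F (𝓝 (φ (x * (τ • b)))) := by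
    have h2 := @Continuous.tendsto _ _ (TopologicalSpace.induced
      (fun a : {a : A.toStarSubalgebra // ‖a‖ ≤ 1} =>
        (ContinuousLinearMapWOT.ofCLM (a.1 : H →L[ℂ] H) : H →WOT[ℂ] H)) inferInstance) _ _
      hφ.weak_cont ⟨x * (τ • b), hball x hx⟩
    refine h2.comp (f := fun i => ⟨y i * (τ • b), hball _ (hy i)⟩) ?_
    rw [nhds_induced, tendsto_comap_iff]
    rw [ContinuousLinearMapWOT.tendsto_iff_forall_inner_apply_tendsto]
    intro u v
    exact h (((τ • b : A.toStarSubalgebra) : H →L[ℂ] H) u) v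
  have h2 := h1.const_mul τ⁻¹
  have e : ∀ z : A.toStarSubalgebra, τ⁻¹ * φ (z * (τ • b)) = φ (z * b) := fun z => by
    rw [mul_smul_comm, map_smul, smul_eq_mul, inv_mul_cancel_left₀ hτ0]
  simpa only [e] using h2

/-- The witness `d² b* = (b* b + ε²)^{-1/2} b*` approximates the phase in the polar decomposition of
`b`. Closedness of `N` makes it a C⋆-algebra, so the functional calculus stays inside `N`. -/
theorem IsTrace.exists_re_map_mul_le (hφ : IsTrace A φ) (hN : IsCommutantOf A N Q) {b : N} {ε : ℝ}
    (hε : 0 < ε) {a : A.toStarSubalgebra} (ha : ‖a‖ ≤ 1) :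
    ∃ x : N, ‖x‖ ≤ 1 ∧ (φ (a * b)).re ≤ (φ (x * b)).re + ε := by
  let _ : CStarAlgebra A.toStarSubalgebra := vonNeumannCStar A
  have _ : IsClosed (N : Set A.toStarSubalgebra) := hN.isClosed
  let _ : CStarAlgebra N := StarSubalgebra.cstarAlgebra N
  -- The parameter is `ε²` because the polar estimate loses a square root.
  obtain ⟨c, d, hc, hd, -, hdc, h, hdn, hx⟩ := exists_regularized_polar b (pow_pos hε 2)
  refine ⟨d * d * star b, hx, ?_⟩
  have := re_map_mul_le_of_polar (φ := φ) hφ.nonneg hφ.tracial (a := a) (b := b) (c := c) (d := d)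
    (pow_pos hε 2) ha (congrArg Subtype.val hc) (congrArg Subtype.val hd)
    (congrArg Subtype.val hdc) (congrArg Subtype.val h) hdn
  rw [Real.sqrt_sq hε.le, hφ.map_one, Complex.one_re, mul_one] at this
  exact this

/-- `φ(x ·)` as a functional on `N`. -/
def tracePairing (φ : A.toStarSubalgebra →ₗ[ℂ] ℂ) (N : StarSubalgebra ℂ A.toStarSubalgebra) :
    A.toStarSubalgebra →ₗ[ℂ] N →ₗ[ℂ] ℂ :=
  LinearMap.mk₂ ℂ (fun x b => φ (x * b)) (fun x y b => by rw [add_mul, map_add])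
    (fun c x b => by rw [smul_mul_assoc, map_smul])
    (fun x b b' => by rw [← map_add, ← mul_add]; rfl)
    (fun c x b => by rw [← map_smul, ← mul_smul_comm]; rfl)

theorem convex_image_unitBall {E F : Type*} [NormedAddCommGroup E] [NormedSpace ℂ E]
    [AddCommGroup F] [Module ℂ F] [Module ℝ F] [IsScalarTower ℝ ℂ F] (L : E →ₗ[ℂ] F) :
    Convex ℝ {k | ∃ x, ‖x‖ ≤ 1 ∧ k = L x} := by
  rintro _ ⟨x, hx, rfl⟩ _ ⟨y, hy, rfl⟩ p q hp hq hpq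
  refine ⟨(p : ℂ) • x + (q : ℂ) • y, ?_, ?_⟩
  · refine (norm_add_le _ _).trans ?_
    rw [norm_smul, norm_smul, Complex.norm_real, Complex.norm_real, Real.norm_of_nonneg hp,
      Real.norm_of_nonneg hq]
    nlinarith
  · rw [map_add, map_smul, map_smul, RCLike.real_smul_eq_coe_smul (K := ℂ) p,
      RCLike.real_smul_eq_coe_smul (K := ℂ) q]
    rfl

/-- Hahn–Banach in the algebraic dual of `N` with pointwise convergence: the functionals `φ(x ·)`,
`x` in the unit ball of `N`, form a closed convex set `K`, and a point separating `φ(a ·)` from `K`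
would violate `IsTrace.exists_re_map_mul_le`. -/
theorem IsTrace.exists_expectation_of_norm_le_one (hφ : IsTrace A φ) (hN : IsCommutantOf A N Q)
    {a : A.toStarSubalgebra} (ha : ‖a‖ ≤ 1) :
    ∃ x : N, ‖x‖ ≤ 1 ∧ ∀ b : N, φ (x * b) = φ (a * b) := by
  let Bil : (N →ₗ[ℂ] ℂ) →ₗ[ℂ] N →ₗ[ℂ] ℂ := LinearMap.id
  let K : Set (WeakBilin Bil) :=
    {k | ∃ x : N, ‖x‖ ≤ 1 ∧ k = tracePairing φ N (x : A.toStarSubalgebra)}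
  have hKconv : Convex ℝ K := convex_image_unitBall
    ((tracePairing φ N).comp (incl N).toLinearMap : N →ₗ[ℂ] WeakBilin Bil)
  have hKcl : IsClosed K := by
    rw [isClosed_iff_ultrafilter]
    intro ψ F hF hKF
    -- A representative is chosen for every functional, with the value `0` off `K`, so that the
    -- family is bounded everywhere and has a weak limit along the ultrafilter.
    have hg : ∀ k : WeakBilin Bil, ∃ x : N, ‖x‖ ≤ 1 ∧
        (k ∈ K → k = tracePairing φ N (x : A.toStarSubalgebra)) := fun k => by
      by_cases hk : k ∈ K
      · obtain ⟨x, hx, h⟩ := hk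
        exact ⟨x, hx, fun _ => h⟩
      · exact ⟨0, by simp, fun h => absurd h hk⟩
    choose g hg1 hgK using hg
    obtain ⟨x, hx1, hx⟩ := exists_weak_limit F (y := fun k => ((g k : A.toStarSubalgebra) :
      H →L[ℂ] H)) zero_le_one hg1
    -- The weak limit stays in `N` because `N` is described by commutation relations.
    have hxQ : x ∈ Q.centralizer := fun q hq => commute_of_weak_limit hx fun k =>
      (hN.mem_iff _).1 (g k).2 q hq
    refine ⟨⟨⟨x, hN.mem_of_mem x hxQ⟩, (hN.mem_iff _).2 hxQ⟩, hx1, ?_⟩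
    refine LinearMap.ext fun b => ?_
    have h1 : Tendsto (fun k : WeakBilin Bil => Bil k b) F (𝓝 (Bil ψ b)) :=
      ((WeakBilin.eval_continuous Bil b).tendsto ψ).mono_left hF
    have h2 := hφ.tendsto_mul (F := (F : Filter (WeakBilin Bil)))
      (y := fun k => (g k : A.toStarSubalgebra)) (x := ⟨x, hN.mem_of_mem x hxQ⟩) hg1 hx1 hx b
    refine tendsto_nhds_unique h1 (h2.congr' ?_)
    filter_upwards [hKF] with k hk
    have := congrArg (fun l : N →ₗ[ℂ] ℂ => l b) (hgK k hk)
    exact this.symm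
  by_contra hcon
  have hnot : (tracePairing φ N a : WeakBilin Bil) ∉ K := by
    rintro ⟨x, hx, h⟩
    exact hcon ⟨x, hx, fun b => (congrArg (fun l : N →ₗ[ℂ] ℂ => l b) h).symm⟩
  obtain ⟨f, u, hf1, hf2⟩ :=
    RCLike.geometric_hahn_banach_closed_point (𝕜 := ℂ) hKconv hKcl hnot
  -- A functional continuous for pointwise convergence is evaluation at some `b : N`.
  obtain ⟨b, rfl⟩ := LinearMap.dualEmbedding_surjective Bil f
  have hf2 : u < (φ (a * b)).re := hf2
  obtain ⟨x, hx, h⟩ := hφ.exists_re_map_mul_le hN (b := b) (sub_pos.2 hf2) ha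
  have h3 : (φ (x * b)).re < u := hf1 _ ⟨x, hx, rfl⟩
  linarith

theorem IsTrace.exists_expectation (hφ : IsTrace A φ) (hN : IsCommutantOf A N Q)
    (a : A.toStarSubalgebra) : ∃ x : N, ‖x‖ ≤ ‖a‖ ∧ ∀ b : N, φ (x * b) = φ (a * b) := by
  rcases eq_or_ne a 0 with rfl | ha
  · exact ⟨0, by simp, fun b => by simp⟩
  have ha' : ((‖a‖ : ℝ) : ℂ) ≠ 0 := by exact_mod_cast norm_ne_zero_iff.2 ha
  obtain ⟨x, hx, h⟩ := hφ.exists_expectation_of_norm_le_one hN (a := ((‖a‖ : ℝ) : ℂ)⁻¹ • a) (by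
    rw [norm_smul, norm_inv, Complex.norm_real, norm_norm, inv_mul_cancel₀ (norm_ne_zero_iff.2 ha)])
  refine ⟨((‖a‖ : ℝ) : ℂ) • x, ?_, fun b => ?_⟩
  · rw [norm_smul, Complex.norm_real, norm_norm]
    exact mul_le_of_le_one_right (norm_nonneg _) hx
  · have e : (((‖a‖ : ℝ) : ℂ) • x : N) = ((‖a‖ : ℝ) : ℂ) • (x : A.toStarSubalgebra) := rfl
    rw [e, smul_mul_assoc, map_smul, h b, ← map_smul, smul_mul_assoc, smul_inv_smul₀ ha']

/-- A contractive projection onto a von Neumann subalgebra (the trace-preserving conditional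
expectation). -/
theorem IsTrace.exists_retraction (hφ : IsTrace A φ) (hN : IsCommutantOf A N Q) :
    ∃ E : A.toStarSubalgebra →L[ℂ] N, ‖E‖ ≤ 1 ∧ ∀ x : N, E (incl N x) = x := by
  choose E hE1 hE2 using hφ.exists_expectation hN
  -- Testing against `b = (x - y)*` and using faithfulness; linearity of `E` and `E x = x` on `N`
  -- both follow from this uniqueness.
  have huniq : ∀ x y : N, (∀ b : N, φ (x * b) = φ (y * b)) → x = y := by
    intro x y h
    have h1 := h (star (x - y))
    rw [← sub_eq_zero, ← map_sub, ← sub_mul] at h1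
    exact sub_eq_zero.1 (Subtype.ext (hφ.faithful ((x - y : N) : A.toStarSubalgebra) h1))
  let L : A.toStarSubalgebra →ₗ[ℂ] N :=
    { toFun := E
      map_add' := fun x y => huniq _ _ fun b => by
        have e : ((E x + E y : N) : A.toStarSubalgebra) = E x + E y := rfl
        rw [e, add_mul, map_add, hE2, hE2, hE2, add_mul, map_add]
      map_smul' := fun c x => huniq _ _ fun b => by
        have e : ((c • E x : N) : A.toStarSubalgebra) = c • (E x : A.toStarSubalgebra) := rfl
        rw [RingHom.id_apply, e, smul_mul_assoc, map_smul, hE2, hE2, smul_mul_assoc, map_smul] }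
  refine ⟨L.mkContinuous 1 fun x => by rw [one_mul]; exact hE1 x,
    LinearMap.mkContinuous_norm_le _ zero_le_one _, fun x => huniq _ _ fun b => hE2 _ b⟩

/-- `Q` is the commutant of the generators together with the commutant of `A`. The second part
changes nothing for elements of `A`, and forces membership in `A` since `A` is its own double
commutant. -/
theorem genFiltr_isCommutantOf (A : VonNeumannAlgebra H) (X : ℝ → A.toStarSubalgebra) (t : ℝ) :
    ∃ Q, IsCommutantOf A ((genFiltr A X).alg t) Q := by
  set C : StarSubalgebra ℂ (H →L[ℂ] H) := StarSubalgebra.centralizer ℂ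
    {x : H →L[ℂ] H | ∃ s, 0 ≤ s ∧ s ≤ t ∧ x = X s} with hC
  refine ⟨(C : Set (H →L[ℂ] H)) ∪ (A : Set (H →L[ℂ] H)).centralizer, fun x => ?_, fun x hx => ?_⟩
  · have h1 : x ∈ (genFiltr A X).alg t ↔ (x : H →L[ℂ] H) ∈
      StarSubalgebra.centralizer ℂ (C : Set (H →L[ℂ] H)) := Iff.rfl
    rw [h1, StarSubalgebra.mem_centralizer_iff]
    constructor
    · rintro h q (hq | hq)
      · exact (h q hq).1
      · exact (hq _ x.2).symm
    · exact fun h q hq => ⟨h q (Or.inl hq), h _ (Or.inl (star_mem (s := C) hq))⟩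
  · have h1 : x ∈ (A : Set (H →L[ℂ] H)).centralizer.centralizer := fun q hq => hx q (Or.inr hq)
    rw [VonNeumannAlgebra.centralizer_centralizer] at h1
    exact h1

theorem mem_genFiltr (A : VonNeumannAlgebra H) (X : ℝ → A.toStarSubalgebra) {s t : ℝ} (hs : 0 ≤ s)
    (hst : s ≤ t) : X s ∈ (genFiltr A X).alg t := by
  change (X s : H →L[ℂ] H) ∈ StarSubalgebra.centralizer ℂ _
  rw [StarSubalgebra.mem_centralizer_iff]
  intro g hg
  have h1 : ∀ g ∈ StarSubalgebra.centralizer ℂ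
      {x : H →L[ℂ] H | ∃ s, 0 ≤ s ∧ s ≤ t ∧ x = X s}, g * X s = X s * g := fun g hg =>
    ((((StarSubalgebra.mem_centralizer_iff ℂ).1 hg) (X s) ⟨s, hs, hst, rfl⟩).1).symm
  exact ⟨h1 g hg, h1 _ (star_mem hg)⟩

end Expectation

/-! ### From suprema in `[0, ∞]` to pointwise Hölder bounds and back. -/

section HolderLemmas

variable {V : Type*} [NormedAddCommGroup V]

theorem holderSup_le {α c : ℝ} {I : Set ℝ} {n : ℝ → ℝ → ℝ}
    (h : ∀ s ∈ I, ∀ t ∈ I, s < t → n s t ≤ c * (t - s) ^ α) :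
    holderSup α I n ≤ ENNReal.ofReal c := by
  refine iSup₂_le fun s hs => iSup₂_le fun t ht => iSup_le fun hst => ?_
  refine ENNReal.ofReal_le_ofReal ?_
  rw [div_le_iff₀ (Real.rpow_pos_of_pos (sub_pos.2 hst) _)]
  exact h s hs t ht hst

theorem le_of_holderSup {α : ℝ} {I : Set ℝ} {n : ℝ → ℝ → ℝ} (hfin : holderSup α I n ≠ ∞)
    {s t : ℝ} (hs : s ∈ I) (ht : t ∈ I) (hst : s < t) :
    n s t ≤ (holderSup α I n).toReal * (t - s) ^ α := by
  rw [← div_le_iff₀ (Real.rpow_pos_of_pos (sub_pos.2 hst) _)]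
  refine (ENNReal.ofReal_le_iff_le_toReal hfin).1 ?_
  exact le_iSup₂_of_le s hs (le_iSup₂_of_le t ht (le_iSup_of_le hst le_rfl))

theorem holderSup_mono {α : ℝ} {I I' : Set ℝ} (h : I ⊆ I') (n : ℝ → ℝ → ℝ) :
    holderSup α I n ≤ holderSup α I' n := by
  refine iSup₂_le fun s hs => iSup₂_le fun t ht => iSup_le fun hst => ?_
  exact le_iSup₂_of_le s (h hs) (le_iSup₂_of_le t (h ht) (le_iSup_of_le hst le_rfl))

theorem incr_self (f : ℝ → V) (t : ℝ) : incr f t t = 0 := sub_self _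

theorem norm_incr_le {α : ℝ} (hα : 0 < α) {I : Set ℝ} {f : ℝ → V} (hfin : N1 α I f ≠ ∞) {s t : ℝ}
    (hs : s ∈ I) (ht : t ∈ I) (hst : s ≤ t) :
    ‖incr f s t‖ ≤ (N1 α I f).toReal * (t - s) ^ α := by
  rcases hst.eq_or_lt with rfl | hst
  · simp [incr_self, Real.zero_rpow hα.ne']
  · exact le_of_holderSup hfin hs ht hst

theorem norm_le_of_N2 {α : ℝ} (hα : 0 < α) {I : Set ℝ} {h : ℝ → ℝ → V} (hfin : N2 α I h ≠ ∞)
    {s t : ℝ} (hdiag : h t t = 0) (hs : s ∈ I) (ht : t ∈ I) (hst : s ≤ t) :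
    ‖h s t‖ ≤ (N2 α I h).toReal * (t - s) ^ α := by
  rcases hst.eq_or_lt with rfl | hst
  · simp [hdiag, Real.zero_rpow hα.ne']
  · exact le_of_holderSup hfin hs ht hst

theorem N0_le {I : Set ℝ} {f : ℝ → V} {c : ℝ} (h : ∀ t ∈ I, ‖f t‖ ≤ c) :
    N0 I f ≤ ENNReal.ofReal c :=
  iSup₂_le fun t ht => ENNReal.ofReal_le_ofReal (h t ht)

theorem norm_le_of_N0 {I : Set ℝ} {f : ℝ → V} (hfin : N0 I f ≠ ∞) {t : ℝ} (ht : t ∈ I) :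
    ‖f t‖ ≤ (N0 I f).toReal :=
  (ENNReal.ofReal_le_iff_le_toReal hfin).1
    (le_iSup₂_of_le (f := fun t (_ : t ∈ I) => ENNReal.ofReal ‖f t‖) t ht le_rfl)

theorem MemC1.exists_norm_le {α : ℝ} {T : ℝ} {f : ℝ → V} (hf : MemC1 α (Set.Icc 0 T) f) :
    ∃ c, 0 ≤ c ∧ ∀ t ∈ Set.Icc 0 T, ‖f t‖ ≤ c := by
  obtain ⟨c, hc⟩ := isCompact_Icc.exists_bound_of_continuousOn hf.cont
  exact ⟨|c|, abs_nonneg c, fun t ht => (hc t ht).trans (le_abs_self c)⟩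

theorem N3_le {α β c : ℝ} {I : Set ℝ} {h : ℝ → ℝ → ℝ → V}
    (hh : ∀ s ∈ I, ∀ r ∈ I, ∀ t ∈ I, s < r → r < t →
      ‖h s r t‖ ≤ c * ((t - r) ^ α * (r - s) ^ β)) :
    N3 α β I h ≤ ENNReal.ofReal c := by
  refine iSup₂_le fun s hs => iSup₂_le fun r hr => iSup₂_le fun t ht => iSup₂_le fun h1 h2 => ?_
  refine ENNReal.ofReal_le_ofReal ?_
  rw [div_le_iff₀ (mul_pos (Real.rpow_pos_of_pos (sub_pos.2 h2) _)
    (Real.rpow_pos_of_pos (sub_pos.2 h1) _))]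
  exact hh s hs r hr t ht h1 h2

end HolderLemmas

/-! ### The coboundary of the expansion and its estimates. -/

section Expansion

variable {A : Type*} [NormedRing A] [NormedAlgebra ℂ A] [StarRing A] [StarModule ℂ A]
  [CStarRing A] [CompleteSpace A]

/-- The standing assumptions on the filtration, the path, the area and the biprocess: the
subalgebras are closed and the inclusions of their tensor powers are isometric. -/
structure IsRoughData (F : Filtr A) (γ T : ℝ) (X : ℝ → A)
    (XX : ∀ s : ℝ, ℝ → (PT (F.alg s) 2 →L[ℂ] A)) (U : ∀ t, PT (F.alg t) 2)
    (U1 U2 : ∀ t, PT (F.alg t) 3) : Prop where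
  one_lt : 1 < 3 * γ
  pos : 0 < T
  closed : ∀ t, IsClosed (F.alg t : Set A)
  isom : ∀ t k (w : PT (F.alg t) k), ‖mapPT (incl (F.alg t)) k w‖ = ‖w‖
  mem : ∀ s t, 0 ≤ s → s ≤ t → X s ∈ F.alg t
  selfAdjoint : ∀ t ∈ Set.Icc 0 T, IsSelfAdjoint (X t)
  holder : MemC1 γ (Set.Icc 0 T) X
  area : IsProductLevyArea F γ T X XX
  bicontrolled : IsBicontrolled F γ T X U U1 U2

variable {F : Filtr A} {γ T : ℝ} {X : ℝ → A} {XX : ∀ s : ℝ, ℝ → (PT (F.alg s) 2 →L[ℂ] A)}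
  {U : ∀ t, PT (F.alg t) 2} {U1 U2 : ∀ t, PT (F.alg t) 3}

namespace IsRoughData

theorem γ_pos (h : IsRoughData F γ T X XX U U1 U2) : 0 < γ := by linarith [h.one_lt]

theorem norm_emb (h : IsRoughData F γ T X XX U U1 U2) {k : ℕ} (W : ∀ t, PT (F.alg t) k) (t : ℝ) :
    ‖W t‖ = ‖emb F W t‖ :=
  (h.isom t k (W t)).symm

/-- This is where the isometry enters: the area acts on the left-hand difference in the tensor power
of `A_t`, while the Hölder hypothesis controls its image over `A`. -/
theorem norm_incr_emb (h : IsRoughData F γ T X XX U U1 U2) {k : ℕ} (W : ∀ t, PT (F.alg t) k)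
    {s t : ℝ} (hst : s ≤ t) :
    ‖mapPT (inclLE (F.mono hst)) k (W s) - W t‖ = ‖incr (emb F W) s t‖ := by
  rw [← h.isom, map_sub, mapPT_incl_inclLE, norm_sub_rev]; rfl

/-- At `s = r` or `r = t` both sides vanish, so the relation extends to the closed simplex. -/
theorem chen (h : IsRoughData F γ T X XX U U1 U2) {s r t : ℝ} (hs : 0 ≤ s) (hsr : s ≤ r)
    (hrt : r ≤ t) (ht : t ≤ T) (w : PT (F.alg s) 2) :
    XX s t w - XX s r w - XX r t (mapPT (inclLE (F.mono hsr)) 2 w) =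
      sharp (mapPT (incl (F.alg s)) 2 w) (incr X s r) * incr X r t := by
  rcases hsr.eq_or_lt with rfl | hsr'
  · have h1 : mapPT (inclLE (F.mono hsr)) 2 w = w := mapPT_id w
    have h2 := map_zero ((sharpCLM A).flip (mapPT (incl (F.alg s)) 2 w))
    rw [ContinuousLinearMap.flip_apply, sharpCLM_apply] at h2
    rw [h1, h.area.diag, incr_self, h2]
    simp
  rcases hrt.eq_or_lt with rfl | hrt'
  · rw [h.area.diag, incr_self]
    simp
  · exact h.area.chen s r t hsr' hs hrt' ht w

theorem isSelfAdjoint_incr (h : IsRoughData F γ T X XX U U1 U2) {s t : ℝ}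
    (hs : s ∈ Set.Icc 0 T) (ht : t ∈ Set.Icc 0 T) : IsSelfAdjoint (incr X s t) :=
  (h.selfAdjoint t ht).sub (h.selfAdjoint s hs)

/-- Chen's relation on triple tensors produces exactly the terms `(δX ♯ U1) ♯ δX` and `(U2 ♯ δX) ♯
δX` that arise from the first-order part of `δU`; after cancellation only products of small
increments remain. -/
theorem cobd_expansion (h : IsRoughData F γ T X XX U U1 U2) {s r t : ℝ} (hs : 0 ≤ s) (hsr : s ≤ r)
    (hrt : r ≤ t) (ht : t ≤ T) :
    cobd (expansion F X XX U U1 U2) s r t =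
      timesId (XX r t) (mapPT (inclLE (F.mono hsr)) 3 (U1 s) - U1 r) +
      idTimes (adjOp (XX r t)) (mapPT (inclLE (F.mono hsr)) 3 (U2 s) - U2 r) -
      sharp (birem F X U U1 U2 s r) (incr X r t) := by
  have hsT : s ∈ Set.Icc 0 T := ⟨hs, hsr.trans (hrt.trans ht)⟩
  have hrT : r ∈ Set.Icc 0 T := ⟨hs.trans hsr, hrt.trans ht⟩
  have htT : t ∈ Set.Icc 0 T := ⟨hs.trans (hsr.trans hrt), ht⟩
  have e1 := timesId_chen (F.mono hsr) (fun w => h.chen hs hsr hrt ht w) (U1 s)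
  have e2 := idTimes_adjOp_chen (F.mono hsr) (h.isSelfAdjoint_incr hsT hrT)
    (h.isSelfAdjoint_incr hrT htT) (fun w => h.chen hs hsr hrt ht w) (U2 s)
  have e3 : incr X s t = incr X s r + incr X r t := by simp [incr]
  have e4 : emb F U r = birem F X U U1 U2 s r + emb F U s + sharpL (incr X s r) (emb F U1 s) +
      sharpR (emb F U2 s) (incr X s r) := by
    rw [birem, incr]; abel
  have e1' : timesId (XX s t) (U1 s) = timesId (XX s r) (U1 s) +
      timesId (XX r t) (mapPT (inclLE (F.mono hsr)) 3 (U1 s)) +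
      sharp (sharpL (incr X s r) (emb F U1 s)) (incr X r t) := by
    rw [emb, ← e1]; abel
  have e2' : idTimes (adjOp (XX s t)) (U2 s) = idTimes (adjOp (XX s r)) (U2 s) +
      idTimes (adjOp (XX r t)) (mapPT (inclLE (F.mono hsr)) 3 (U2 s)) +
      sharp (sharpR (emb F U2 s) (incr X s r)) (incr X r t) := by
    rw [emb, ← e2]; abel
  simp only [cobd, expansion]
  rw [e3, e1', e2', e4]
  simp only [← sharpCLM_apply, map_add, map_sub, add_apply]
  abel

theorem expansion_self (h : IsRoughData F γ T X XX U U1 U2) (t : ℝ) :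
    expansion F X XX U U1 U2 t t = 0 := by
  have h1 : timesId (XX t t) (U1 t) = 0 := by
    have := norm_timesId_le (XX t t) (U1 t)
    rw [h.area.diag, norm_zero, zero_mul] at this
    rw [h.area.diag]
    exact norm_le_zero_iff.1 this
  have h2 : idTimes (adjOp (XX t t)) (U2 t) = 0 := by
    have := norm_idTimes_adjOp_le (XX t t) (U2 t)
    rw [h.area.diag, norm_zero, zero_mul] at this
    rw [h.area.diag]
    exact norm_le_zero_iff.1 this
  rw [expansion, h1, h2, incr_self, ← sharpCLM_apply, map_zero]
  simp

end IsRoughData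

/-- Explicit Hölder bounds on the interval `[l₁, l₂]`. -/
structure HolderBounds (F : Filtr A) (γ : ℝ) (X : ℝ → A)
    (XX : ∀ s : ℝ, ℝ → (PT (F.alg s) 2 →L[ℂ] A)) (U : ∀ t, PT (F.alg t) 2)
    (U1 U2 : ∀ t, PT (F.alg t) 3) (l₁ l₂ x ξ v w₁ w₂ : ℝ) : Prop where
  x_nonneg : 0 ≤ x
  ξ_nonneg : 0 ≤ ξ
  v_nonneg : 0 ≤ v
  w₁_nonneg : 0 ≤ w₁
  w₂_nonneg : 0 ≤ w₂
  path : ∀ s t, l₁ ≤ s → s ≤ t → t ≤ l₂ → ‖incr X s t‖ ≤ x * (t - s) ^ γ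
  area : ∀ s t, l₁ ≤ s → s ≤ t → t ≤ l₂ → ‖XX s t‖ ≤ ξ * (t - s) ^ (2 * γ)
  birem : ∀ s t, l₁ ≤ s → s ≤ t → t ≤ l₂ → ‖birem F X U U1 U2 s t‖ ≤ v * (t - s) ^ (2 * γ)
  deriv₁ : ∀ s t, l₁ ≤ s → s ≤ t → t ≤ l₂ → ‖incr (emb F U1) s t‖ ≤ w₁ * (t - s) ^ γ
  deriv₂ : ∀ s t, l₁ ≤ s → s ≤ t → t ≤ l₂ → ‖incr (emb F U2) s t‖ ≤ w₂ * (t - s) ^ γ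

namespace IsRoughData

variable {l₁ l₂ x ξ v w₁ w₂ : ℝ}

/-- The two parts of the coboundary of the expansion. -/
theorem norm_sharp_birem_le (hb : HolderBounds F γ X XX U U1 U2 l₁ l₂ x ξ v w₁ w₂) {s r t : ℝ} (hs : l₁ ≤ s) (hsr : s ≤ r)
    (hrt : r ≤ t) (ht : t ≤ l₂) :
    ‖sharp (birem F X U U1 U2 s r) (incr X r t)‖ ≤
      x * v * ((t - r) ^ γ * (r - s) ^ (2 * γ)) := by
  have h1 := hb.path r t (hs.trans hsr) hrt ht
  have h2 := hb.birem s r hs hsr (hrt.trans ht)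
  calc _ ≤ ‖incr X r t‖ * ‖birem F X U U1 U2 s r‖ := norm_sharp_le _ _
    _ ≤ (x * (t - r) ^ γ) * (v * (r - s) ^ (2 * γ)) :=
      mul_le_mul h1 h2 (norm_nonneg _) ((norm_nonneg _).trans h1)
    _ = _ := by ring

/-- Adding `U^♭ ♯ δX` back leaves the area terms alone. The two parts stay separate because their
Hölder exponents are distributed differently over `[s, r]` and `[r, t]`. -/
theorem norm_cobd_add_le (h : IsRoughData F γ T X XX U U1 U2)
    (hb : HolderBounds F γ X XX U U1 U2 l₁ l₂ x ξ v w₁ w₂) (hl₁ : 0 ≤ l₁) (hl₂ : l₂ ≤ T)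
    {s r t : ℝ} (hs : l₁ ≤ s) (hsr : s ≤ r) (hrt : r ≤ t) (ht : t ≤ l₂) :
    ‖cobd (expansion F X XX U U1 U2) s r t + sharp (birem F X U U1 U2 s r) (incr X r t)‖ ≤
      ξ * (w₁ + w₂) * ((t - r) ^ (2 * γ) * (r - s) ^ γ) := by
  rw [h.cobd_expansion (hl₁.trans hs) hsr hrt (ht.trans hl₂), sub_add_cancel]
  have h0 := hb.area r t (hs.trans hsr) hrt ht
  have h1 := hb.deriv₁ s r hs hsr (hrt.trans ht)
  have h2 := hb.deriv₂ s r hs hsr (hrt.trans ht)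
  have k1 := norm_timesId_le (XX r t) (mapPT (inclLE (F.mono hsr)) 3 (U1 s) - U1 r)
  have k2 := norm_idTimes_adjOp_le (XX r t) (mapPT (inclLE (F.mono hsr)) 3 (U2 s) - U2 r)
  rw [h.norm_incr_emb U1 hsr] at k1
  rw [h.norm_incr_emb U2 hsr] at k2
  have hX := (norm_nonneg _).trans h0
  calc _ ≤ ‖XX r t‖ * ‖incr (emb F U1) s r‖ + ‖XX r t‖ * ‖incr (emb F U2) s r‖ :=
        (norm_add_le _ _).trans (add_le_add k1 k2)
    _ ≤ ξ * (t - r) ^ (2 * γ) * (w₁ * (r - s) ^ γ) + ξ * (t - r) ^ (2 * γ) * (w₂ * (r - s) ^ γ) := by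
        gcongr
    _ = _ := by ring

theorem norm_cobd_le (h : IsRoughData F γ T X XX U U1 U2)
    (hb : HolderBounds F γ X XX U U1 U2 l₁ l₂ x ξ v w₁ w₂) (hl₁ : 0 ≤ l₁) (hl₂ : l₂ ≤ T)
    {s r t : ℝ} (hs : l₁ ≤ s) (hsr : s ≤ r) (hrt : r ≤ t) (ht : t ≤ l₂) :
    ‖cobd (expansion F X XX U U1 U2) s r t‖ ≤ ξ * (w₁ + w₂) * ((t - r) ^ (2 * γ) * (r - s) ^ γ) +
      x * v * ((t - r) ^ γ * (r - s) ^ (2 * γ)) := by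
  have e : cobd (expansion F X XX U U1 U2) s r t = (cobd (expansion F X XX U U1 U2) s r t +
      sharp (birem F X U U1 U2 s r) (incr X r t)) - sharp (birem F X U U1 U2 s r) (incr X r t) := by
    abel
  rw [e]
  exact (norm_sub_le _ _).trans (add_le_add (h.norm_cobd_add_le hb hl₁ hl₂ hs hsr hrt ht)
    (norm_sharp_birem_le hb hs hsr hrt ht))

theorem norm_cobd_le_rpow (h : IsRoughData F γ T X XX U U1 U2)
    (hb : HolderBounds F γ X XX U U1 U2 l₁ l₂ x ξ v w₁ w₂) (hl₁ : 0 ≤ l₁) (hl₂ : l₂ ≤ T)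
    {s r t : ℝ} (hs : l₁ ≤ s) (hsr : s ≤ r) (hrt : r ≤ t) (ht : t ≤ l₂) :
    ‖cobd (expansion F X XX U U1 U2) s r t‖ ≤ (ξ * (w₁ + w₂) + x * v) * (t - s) ^ (3 * γ) := by
  have hγ := h.γ_pos
  have := hb.x_nonneg; have := hb.ξ_nonneg; have := hb.v_nonneg
  have := hb.w₁_nonneg; have := hb.w₂_nonneg
  have h1 : 0 ≤ t - r := sub_nonneg.2 hrt
  have h2 : 0 ≤ r - s := sub_nonneg.2 hsr
  have e : (t - s) ^ (3 * γ) = (t - s) ^ (2 * γ) * (t - s) ^ γ := by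
    rw [← Real.rpow_add_of_nonneg (by linarith) (by linarith) hγ.le]; ring_nf
  have e' : (t - s) ^ (3 * γ) = (t - s) ^ γ * (t - s) ^ (2 * γ) := by rw [e, mul_comm]
  refine (h.norm_cobd_le hb hl₁ hl₂ hs hsr hrt ht).trans ?_
  rw [add_mul]
  refine add_le_add ?_ ?_
  · rw [e]; gcongr
    exact Real.rpow_nonneg (by linarith) _
  · rw [e']; gcongr
    exact Real.rpow_nonneg (by linarith) _

theorem norm_expansion_sub_le (h : IsRoughData F γ T X XX U U1 U2)
    (hb : HolderBounds F γ X XX U U1 U2 l₁ l₂ x ξ v w₁ w₂) {s t : ℝ}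
    (hs : l₁ ≤ s) (hst : s ≤ t) (ht : t ≤ l₂) :
    ‖expansion F X XX U U1 U2 s t - sharp (emb F U s) (incr X s t)‖ ≤
      ξ * (‖emb F U1 s‖ + ‖emb F U2 s‖) * (t - s) ^ (2 * γ) := by
  have e : expansion F X XX U U1 U2 s t - sharp (emb F U s) (incr X s t) =
      timesId (XX s t) (U1 s) + idTimes (adjOp (XX s t)) (U2 s) := by rw [expansion]; abel
  have k1 := norm_timesId_le (XX s t) (U1 s)
  have k2 := norm_idTimes_adjOp_le (XX s t) (U2 s)
  have h0 := hb.area s t hs hst ht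
  rw [h.norm_emb] at k1 k2
  rw [e]
  calc _ ≤ ‖XX s t‖ * ‖emb F U1 s‖ + ‖XX s t‖ * ‖emb F U2 s‖ :=
        (norm_add_le _ _).trans (add_le_add k1 k2)
    _ ≤ ξ * (t - s) ^ (2 * γ) * ‖emb F U1 s‖ + ξ * (t - s) ^ (2 * γ) * ‖emb F U2 s‖ := by gcongr
    _ = _ := by ring

theorem norm_sharp_emb_le (hb : HolderBounds F γ X XX U U1 U2 l₁ l₂ x ξ v w₁ w₂) {s t : ℝ}
    (hs : l₁ ≤ s) (hst : s ≤ t) (ht : t ≤ l₂) :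
    ‖sharp (emb F U s) (incr X s t)‖ ≤ x * ‖emb F U s‖ * (t - s) ^ γ := by
  calc _ ≤ ‖incr X s t‖ * ‖emb F U s‖ := norm_sharp_le _ _
    _ ≤ (x * (t - s) ^ γ) * ‖emb F U s‖ := by gcongr; exact hb.path s t hs hst ht
    _ = _ := by ring

theorem norm_area_le (h : IsRoughData F γ T X XX U U1 U2) {s t : ℝ} (hs : 0 ≤ s) (hst : s ≤ t)
    (ht : t ≤ T) : ‖XX s t‖ ≤ (areaNorm F (2 * γ) T XX).toReal * (t - s) ^ (2 * γ) := by
  have hγ := h.γ_pos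
  rcases hst.eq_or_lt with rfl | hst
  · rw [h.area.diag, norm_zero, sub_self, Real.zero_rpow (by positivity), mul_zero]
  · exact le_of_holderSup h.area.holder ⟨hs, hst.le.trans ht⟩ ⟨hs.trans hst.le, ht⟩ hst

/-- The Hölder bounds by the seminorms on a subinterval. -/
theorem holderBounds (h : IsRoughData F γ T X XX U U1 U2) (hl₁ : 0 ≤ l₁) (hl₂ : l₂ ≤ T) :
    HolderBounds F γ X XX U U1 U2 l₁ l₂ (N1 γ (Set.Icc 0 T) X).toReal
      (areaNorm F (2 * γ) T XX).toReal
      (N2 (2 * γ) (Set.Icc l₁ l₂) (birem F X U U1 U2)).toReal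
      (N1 γ (Set.Icc l₁ l₂) (emb F U1)).toReal (N1 γ (Set.Icc l₁ l₂) (emb F U2)).toReal := by
  have hγ := h.γ_pos
  have hsub : Set.Icc l₁ l₂ ⊆ Set.Icc 0 T := Set.Icc_subset_Icc hl₁ hl₂
  have hfin : ∀ {n : ℝ → ℝ → ℝ} {α : ℝ}, holderSup α (Set.Icc 0 T) n ≠ ∞ →
      holderSup α (Set.Icc l₁ l₂) n ≠ ∞ := fun hn => ne_top_of_le_ne_top hn (holderSup_mono hsub _)
  refine ⟨ENNReal.toReal_nonneg, ENNReal.toReal_nonneg, ENNReal.toReal_nonneg,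
    ENNReal.toReal_nonneg, ENNReal.toReal_nonneg, ?_, ?_, ?_, ?_, ?_⟩ <;>
    intro s t hs hst ht <;>
    have hsI : s ∈ Set.Icc l₁ l₂ := ⟨hs, hst.trans ht⟩ <;>
    have htI : t ∈ Set.Icc l₁ l₂ := ⟨hs.trans hst, ht⟩
  · exact norm_incr_le hγ h.holder.finite (hsub hsI) (hsub htI) hst
  · exact h.norm_area_le (hl₁.trans hs) hst (ht.trans hl₂)
  · exact norm_le_of_N2 (by positivity) (hfin h.bicontrolled.rem_mem.finite)
      (h.bicontrolled.rem_mem.diag t (hsub htI)) hsI htI hst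
  · exact norm_incr_le hγ (hfin h.bicontrolled.holder_deriv1.finite) hsI htI hst
  · exact norm_incr_le hγ (hfin h.bicontrolled.holder_deriv2.finite) hsI htI hst

/-- The area is not assumed continuous in `(s, t)`. Continuity of the expansion is deduced from
these crude bounds through `continuousOn_simplex`; surplus powers are absorbed into powers of `T`.
-/
theorem exists_norm_expansion_le (h : IsRoughData F γ T X XX U U1 U2) :
    ∃ c, 0 ≤ c ∧ (∀ s t, 0 ≤ s → s ≤ t → t ≤ T →
        ‖expansion F X XX U U1 U2 s t‖ ≤ c * (t - s) ^ γ) ∧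
      (∀ s r t, 0 ≤ s → s ≤ r → r ≤ t → t ≤ T →
        ‖cobd (expansion F X XX U U1 U2) s r t‖ ≤ c * (r - s) ^ γ) ∧
      (∀ s r t, 0 ≤ s → s ≤ r → r ≤ t → t ≤ T →
        ‖cobd (expansion F X XX U U1 U2) s r t‖ ≤ c * (t - r) ^ γ) := by
  have hγ := h.γ_pos
  have hb := h.holderBounds le_rfl le_rfl
  obtain ⟨u0, hu0, hu0'⟩ := h.bicontrolled.holder.exists_norm_le
  obtain ⟨u1, hu1, hu1'⟩ := h.bicontrolled.holder_deriv1.exists_norm_le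
  obtain ⟨u2, hu2, hu2'⟩ := h.bicontrolled.holder_deriv2.exists_norm_le
  set x := (N1 γ (Set.Icc 0 T) X).toReal
  set ξ := (areaNorm F (2 * γ) T XX).toReal
  set v := (N2 (2 * γ) (Set.Icc 0 T) (ProductArea.birem F X U U1 U2)).toReal
  set w₁ := (N1 γ (Set.Icc 0 T) (emb F U1)).toReal
  set w₂ := (N1 γ (Set.Icc 0 T) (emb F U2)).toReal
  have := hb.x_nonneg; have := hb.ξ_nonneg; have := hb.v_nonneg
  have := hb.w₁_nonneg; have := hb.w₂_nonneg
  have hT := h.pos.le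
  have hpow : ∀ {a : ℝ}, 0 ≤ a → a ≤ T → a ^ (2 * γ) ≤ T ^ γ * a ^ γ := fun {a} ha haT => by
    rw [two_mul, Real.rpow_add_of_nonneg ha hγ.le hγ.le]
    gcongr
  have hpow' : ∀ {a : ℝ}, 0 ≤ a → a ≤ T → a ^ γ ≤ T ^ γ := fun ha haT =>
    Real.rpow_le_rpow ha haT hγ.le
  set c := x * u0 + ξ * (u1 + u2) * T ^ γ + (ξ * (w₁ + w₂) + x * v) * (T ^ γ * T ^ γ) with hc
  have hc1 : ξ * (w₁ + w₂) * (T ^ γ * T ^ γ) + x * v * (T ^ γ * T ^ γ) ≤ c := by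
    rw [hc, add_mul]
    exact le_add_of_nonneg_left (by positivity)
  refine ⟨c, by positivity, fun s t hs hst ht => ?_, fun s r t hs hsr hrt ht => ?_,
    fun s r t hs hsr hrt ht => ?_⟩
  · have h1 := h.norm_expansion_sub_le hb hs hst ht
    have h2 := norm_sharp_emb_le hb hs hst ht
    have hsT : s ∈ Set.Icc 0 T := ⟨hs, hst.trans ht⟩
    have h3 : 0 ≤ t - s := sub_nonneg.2 hst
    calc ‖expansion F X XX U U1 U2 s t‖
        ≤ ‖expansion F X XX U U1 U2 s t - sharp (emb F U s) (incr X s t)‖ +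
          ‖sharp (emb F U s) (incr X s t)‖ := norm_le_norm_sub_add _ _
      _ ≤ ξ * (u1 + u2) * (T ^ γ * (t - s) ^ γ) + x * u0 * (t - s) ^ γ := by
          refine add_le_add (h1.trans ?_) (h2.trans ?_)
          · gcongr
            exacts [hu1' s hsT, hu2' s hsT, hpow h3 (by linarith)]
          · gcongr
            exact hu0' s hsT
      _ = (x * u0 + ξ * (u1 + u2) * T ^ γ) * (t - s) ^ γ := by ring
      _ ≤ c * (t - s) ^ γ := by
          gcongr
          exact le_add_of_nonneg_right (by positivity)
  · have h1 : 0 ≤ t - r := sub_nonneg.2 hrt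
    have h2 : 0 ≤ r - s := sub_nonneg.2 hsr
    have h3 := hpow' h1 (by linarith)
    have h4 := hpow h2 (by linarith)
    have h5 : (t - r) ^ (2 * γ) ≤ T ^ γ * T ^ γ := (hpow h1 (by linarith)).trans (by gcongr)
    calc _ ≤ ξ * (w₁ + w₂) * ((t - r) ^ (2 * γ) * (r - s) ^ γ) +
          x * v * ((t - r) ^ γ * (r - s) ^ (2 * γ)) := h.norm_cobd_le hb le_rfl le_rfl hs hsr hrt ht
      _ ≤ ξ * (w₁ + w₂) * (T ^ γ * T ^ γ * (r - s) ^ γ) +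
          x * v * (T ^ γ * (T ^ γ * (r - s) ^ γ)) := by gcongr
      _ = (ξ * (w₁ + w₂) * (T ^ γ * T ^ γ) + x * v * (T ^ γ * T ^ γ)) * (r - s) ^ γ := by ring
      _ ≤ c * (r - s) ^ γ := by gcongr
  · have h1 : 0 ≤ t - r := sub_nonneg.2 hrt
    have h2 : 0 ≤ r - s := sub_nonneg.2 hsr
    have h3 := hpow' h2 (by linarith)
    have h4 := hpow h1 (by linarith)
    have h5 : (r - s) ^ (2 * γ) ≤ T ^ γ * T ^ γ := (hpow h2 (by linarith)).trans (by gcongr)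
    calc _ ≤ ξ * (w₁ + w₂) * ((t - r) ^ (2 * γ) * (r - s) ^ γ) +
          x * v * ((t - r) ^ γ * (r - s) ^ (2 * γ)) := h.norm_cobd_le hb le_rfl le_rfl hs hsr hrt ht
      _ ≤ ξ * (w₁ + w₂) * (T ^ γ * (t - r) ^ γ * T ^ γ) +
          x * v * ((t - r) ^ γ * (T ^ γ * T ^ γ)) := by gcongr
      _ = (ξ * (w₁ + w₂) * (T ^ γ * T ^ γ) + x * v * (T ^ γ * T ^ γ)) * (t - r) ^ γ := by ring
      _ ≤ c * (t - r) ^ γ := by gcongr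

end IsRoughData

end Expansion

/-! ### The sewing map applied to the expansion, and the rough integral. -/

section Integral

open Filter Topology

variable {A : Type*} [NormedRing A] [NormedAlgebra ℂ A] [StarRing A] [StarModule ℂ A]
  [CStarRing A] [CompleteSpace A]
  {F : Filtr A} {γ T : ℝ} {X : ℝ → A} {XX : ∀ s : ℝ, ℝ → (PT (F.alg s) 2 →L[ℂ] A)}
  {U : ∀ t, PT (F.alg t) 2} {U1 U2 : ∀ t, PT (F.alg t) 3}

/-- The difference has zero coboundary, so `norm_le_of_cobd_le` holds for it with `C = 0`. -/
theorem IsSewing.unique {V : Type*} [NormedAddCommGroup V] {μ T : ℝ} (hμ : 1 < μ)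
    {h : ℝ → ℝ → ℝ → V} {N N' : ℝ → ℝ → V} (hN : IsSewing μ T h N) (hN' : IsSewing μ T h N')
    {s t : ℝ} (hs : 0 ≤ s) (hst : s ≤ t) (ht : t ≤ T) : N' s t = N s t := by
  have hμ0 : 0 < μ := by linarith
  have hb : ∀ {N}, IsSewing μ T h N → ∀ s t, 0 ≤ s → s ≤ t → t ≤ T →
      ‖N s t‖ ≤ (N2 μ (Set.Icc 0 T) N).toReal * (t - s) ^ μ := fun hN s t hs hst ht =>
    norm_le_of_N2 hμ0 hN.1.finite (hN.1.diag t ⟨hs.trans hst, ht⟩) ⟨hs, hst.trans ht⟩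
      ⟨hs.trans hst, ht⟩ hst
  have key := norm_le_of_cobd_le (R := fun s t => N' s t - N s t) (a := 0) (b := T) (C := 0)
    (L := (N2 μ (Set.Icc 0 T) N').toReal + (N2 μ (Set.Icc 0 T) N).toReal) hμ le_rfl
    (fun s t hs hst ht => by
      rw [add_mul]
      exact (norm_sub_le _ _).trans (add_le_add (hb hN' s t hs hst ht) (hb hN s t hs hst ht)))
    (fun s r t hs hsr hrt ht => by
      have e : cobd (fun s t => N' s t - N s t) s r t = cobd N' s r t - cobd N s r t := by
        simp only [cobd]; abel
      rw [e, hN.2 s r t hs hsr hrt ht, hN'.2 s r t hs hsr hrt ht, sub_self, norm_zero, zero_mul])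
    hs hst ht
  rw [mul_zero, zero_mul] at key
  exact sub_eq_zero.1 (norm_le_zero_iff.1 key)

section

open MeasureTheory

theorem intervalIntegrable_bilin {E₁ E₂ E₃ : Type*} [NormedAddCommGroup E₁] [NormedSpace ℂ E₁]
    [NormedAddCommGroup E₂] [NormedSpace ℂ E₂] [NormedAddCommGroup E₃] [NormedSpace ℂ E₃]
    (L : E₁ →L[ℂ] E₂ →L[ℂ] E₃) {f : ℝ → E₁} {g : ℝ → E₂} {s t : ℝ} (hst : s ≤ t)
    (hf : ContinuousOn f (Set.Icc s t)) (hg : IntervalIntegrable g volume s t) :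
    IntervalIntegrable (fun r => L (f r) (g r)) volume s t := by
  rw [intervalIntegrable_iff_integrableOn_Icc_of_le hst] at hg ⊢
  obtain ⟨c, hc⟩ := isCompact_Icc.exists_bound_of_continuousOn hf
  refine L.integrable_of_bilin_of_bdd_left c
    (hf.aestronglyMeasurable measurableSet_Icc) ?_ hg
  exact (ae_restrict_iff' measurableSet_Icc).2 (Eventually.of_forall hc)

theorem integral_deriv_eq_incr {X' : ℝ → A} (hX : ContinuousOn X (Set.Icc 0 T))
    (hX' : ∀ t ∈ Set.Icc 0 T, HasDerivWithinAt X (X' t) (Set.Icc 0 T) t)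
    (hint : IntervalIntegrable X' volume 0 T) {s t : ℝ} (hs : 0 ≤ s) (hst : s ≤ t) (ht : t ≤ T) :
    ∫ r in s..t, X' r = incr X s t := by
  refine intervalIntegral.integral_eq_sub_of_hasDerivAt_of_le hst
    (hX.mono (Set.Icc_subset_Icc hs ht)) (fun r hr => ?_) (hint.mono_set ?_)
  · refine (hX' r ⟨hs.trans hr.1.le, hr.2.le.trans ht⟩).hasDerivAt ?_
    exact Icc_mem_nhds (hs.trans_lt hr.1) (hr.2.trans_le ht)
  · rw [Set.uIcc_of_le hst, Set.uIcc_of_le (hs.trans (hst.trans ht))]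
    exact Set.Icc_subset_Icc hs ht

end

namespace IsRoughData

theorem continuousOn_expansion (h : IsRoughData F γ T X XX U U1 U2) :
    ContinuousOn (fun p : ℝ × ℝ => expansion F X XX U U1 U2 p.1 p.2)
      {p | p.1 ∈ Set.Icc 0 T ∧ p.2 ∈ Set.Icc 0 T ∧ p.1 ≤ p.2} := by
  obtain ⟨c, -, h1, h2, h3⟩ := h.exists_norm_expansion_le
  exact continuousOn_simplex h.γ_pos h1 h2 h3

/-- The element is `M - J`, with `J` the additive function given by the sewing lemma. Continuity of
`J` also comes from `continuousOn_simplex`: its coboundary is zero and it is `γ`-Hölder near the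
diagonal. -/
theorem exists_isSewing (h : IsRoughData F γ T X XX U U1 U2) :
    ∃ N, IsSewing (3 * γ) T (cobd (expansion F X XX U U1 U2)) N := by
  have hγ := h.γ_pos
  have hb := h.holderBounds le_rfl le_rfl
  obtain ⟨c, hc, h1, -, -⟩ := h.exists_norm_expansion_le
  set C := (areaNorm F (2 * γ) T XX).toReal * ((N1 γ (Set.Icc 0 T) (emb F U1)).toReal +
    (N1 γ (Set.Icc 0 T) (emb F U2)).toReal) + (N1 γ (Set.Icc 0 T) X).toReal *
    (N2 (2 * γ) (Set.Icc 0 T) (birem F X U U1 U2)).toReal with hC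
  have hC0 : 0 ≤ C := by positivity
  obtain ⟨J, hJ, hJM⟩ := exists_additive h.expansion_self h.one_lt hC0
    fun s r t hs hsr hrt ht => h.norm_cobd_le_rpow hb le_rfl le_rfl hs hsr hrt ht
  set K := sewC (3 * γ) * C with hK
  have hK0 : 0 ≤ K := mul_nonneg (sewC_pos h.one_lt).le hC0
  have hJn : ∀ s t, 0 ≤ s → s ≤ t → t ≤ T → ‖J s t‖ ≤ (K * T ^ (2 * γ) + c) * (t - s) ^ γ := by
    intro s t hs hst ht
    have h0 : 0 ≤ t - s := sub_nonneg.2 hst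
    have e : (t - s) ^ (3 * γ) = (t - s) ^ (2 * γ) * (t - s) ^ γ := by
      rw [← Real.rpow_add_of_nonneg h0 (by linarith) hγ.le]; ring_nf
    calc ‖J s t‖ ≤ ‖J s t - expansion F X XX U U1 U2 s t‖ + ‖expansion F X XX U U1 U2 s t‖ :=
          norm_le_norm_sub_add _ _
      _ ≤ K * (t - s) ^ (3 * γ) + c * (t - s) ^ γ :=
          add_le_add (hJM s t hs hst ht) (h1 s t hs hst ht)
      _ ≤ K * (T ^ (2 * γ) * (t - s) ^ γ) + c * (t - s) ^ γ := by
          rw [e]; gcongr; linarith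
      _ = _ := by ring
  have hJδ : ∀ s r t, 0 ≤ s → s ≤ r → r ≤ t → t ≤ T → cobd J s r t = 0 := by
    intro s r t hs hsr hrt ht
    rw [cobd, hJ s r t hs hsr hrt ht]; abel
  have hT := h.pos.le
  have hJc := continuousOn_simplex (M := J) hγ hJn
    (fun s r t hs hsr hrt ht => by
      rw [hJδ s r t hs hsr hrt ht, norm_zero]
      have := sub_nonneg.2 hsr; positivity)
    (fun s r t hs hsr hrt ht => by
      rw [hJδ s r t hs hsr hrt ht, norm_zero]
      have := sub_nonneg.2 hrt; positivity)
  refine ⟨fun s t => expansion F X XX U U1 U2 s t - J s t,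
    ⟨h.continuousOn_expansion.sub hJc, fun t ht => ?_, ?_⟩, fun s r t hs hsr hrt ht => ?_⟩
  · rw [h.expansion_self, hJ.diag ht.1 ht.2, sub_zero]
  · refine ne_top_of_le_ne_top ENNReal.ofReal_ne_top (holderSup_le (c := K) ?_)
    intro s hs t ht hst
    rw [norm_sub_rev]
    exact hJM s t hs.1 hst.le ht.2
  · have e : cobd (fun s t => expansion F X XX U U1 U2 s t - J s t) s r t =
        cobd (expansion F X XX U U1 U2) s r t - cobd J s r t := by simp only [cobd]; abel
    rw [e, hJδ s r t hs hsr hrt ht, sub_zero]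

theorem isSewing_sewing (h : IsRoughData F γ T X XX U U1 U2) :
    IsSewing (3 * γ) T (cobd (expansion F X XX U U1 U2))
      (sewing (3 * γ) T (cobd (expansion F X XX U U1 U2))) := by
  rw [sewing, dif_pos h.exists_isSewing]
  exact h.exists_isSewing.choose_spec

theorem additiveOn_roughInt (h : IsRoughData F γ T X XX U U1 U2) :
    AdditiveOn 0 T (roughInt F γ T X XX U U1 U2) := by
  intro s r t hs hsr hrt ht
  have := h.isSewing_sewing.2 s r t hs hsr hrt ht
  simp only [roughInt]
  simp only [cobd] at this ⊢
  rw [← sub_eq_zero] at this ⊢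
  rw [← neg_eq_zero, ← this]
  abel

/-- The sewing map is defined on all of `[0, T]`, but only bounds on `[l₁, l₂]` may appear. Its
global norm serves merely as the a priori bound `L` in `norm_le_of_cobd_le`, whose conclusion does
not contain `L`. -/
theorem norm_roughInt_sub_expansion_le (h : IsRoughData F γ T X XX U U1 U2)
    {l₁ l₂ x ξ v w₁ w₂ : ℝ} (hb : HolderBounds F γ X XX U U1 U2 l₁ l₂ x ξ v w₁ w₂) (hl₁ : 0 ≤ l₁)
    (hl₂ : l₂ ≤ T) {s t : ℝ} (hs : l₁ ≤ s) (hst : s ≤ t) (ht : t ≤ l₂) :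
    ‖roughInt F γ T X XX U U1 U2 s t - expansion F X XX U U1 U2 s t‖ ≤
      sewC (3 * γ) * (ξ * (w₁ + w₂) + x * v) * (t - s) ^ (3 * γ) := by
  have hγ := h.γ_pos
  have := hb.x_nonneg; have := hb.ξ_nonneg; have := hb.v_nonneg
  have := hb.w₁_nonneg; have := hb.w₂_nonneg
  refine norm_le_of_cobd_le
    (R := fun s t => roughInt F γ T X XX U U1 U2 s t - expansion F X XX U U1 U2 s t)
    (L := (N2 (3 * γ) (Set.Icc 0 T) (sewing (3 * γ) T (cobd (expansion F X XX U U1 U2)))).toReal)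
    h.one_lt (by positivity) ?_ ?_ hs hst ht
  · intro s t hs hst ht
    have h0 : 0 ≤ s := hl₁.trans hs
    have hT : t ≤ T := ht.trans hl₂
    rw [roughInt, sub_right_comm, sub_self, zero_sub, norm_neg]
    exact norm_le_of_N2 (by positivity) h.isSewing_sewing.1.finite
      (h.isSewing_sewing.1.diag t ⟨h0.trans hst, hT⟩) ⟨h0, hst.trans hT⟩ ⟨h0.trans hst, hT⟩ hst
  · intro s r t hs hsr hrt ht
    have e : cobd (fun s t => roughInt F γ T X XX U U1 U2 s t - expansion F X XX U U1 U2 s t)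
        s r t = -cobd (expansion F X XX U U1 U2) s r t := by
      have := h.additiveOn_roughInt s r t (hl₁.trans hs) hsr hrt (ht.trans hl₂)
      simp only [cobd, this]; abel
    rw [e, norm_neg]
    exact h.norm_cobd_le_rpow hb hl₁ hl₂ hs hsr hrt ht

theorem exists_norm_roughInt_sub_le (h : IsRoughData F γ T X XX U U1 U2) :
    ∃ K, 0 ≤ K ∧ ∀ s t, 0 ≤ s → s ≤ t → t ≤ T →
      ‖roughInt F γ T X XX U U1 U2 s t - expansion F X XX U U1 U2 s t‖ ≤ K * (t - s) ^ (3 * γ) := by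
  have hs := (sewC_pos h.one_lt).le
  exact ⟨_, by positivity, fun s t hs hst ht =>
    h.norm_roughInt_sub_expansion_le (h.holderBounds le_rfl le_rfl) le_rfl le_rfl hs hst ht⟩

theorem memC2_roughInt (h : IsRoughData F γ T X XX U U1 U2) :
    MemC2 γ (Set.Icc 0 T) (roughInt F γ T X XX U U1 U2) := by
  have hγ := h.γ_pos
  refine ⟨h.continuousOn_expansion.sub h.isSewing_sewing.1.cont,
    fun t ht => h.additiveOn_roughInt.diag ht.1 ht.2, ?_⟩
  obtain ⟨K, hK, hJ⟩ := h.exists_norm_roughInt_sub_le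
  obtain ⟨c, hc, h1, -, -⟩ := h.exists_norm_expansion_le
  refine ne_top_of_le_ne_top ENNReal.ofReal_ne_top (holderSup_le (c := K * T ^ (2 * γ) + c) ?_)
  intro s hs t ht hst
  have h0 : 0 ≤ t - s := sub_nonneg.2 hst.le
  have e : (t - s) ^ (3 * γ) = (t - s) ^ (2 * γ) * (t - s) ^ γ := by
    rw [← Real.rpow_add_of_nonneg h0 (by linarith) hγ.le]; ring_nf
  calc _ ≤ ‖roughInt F γ T X XX U U1 U2 s t - expansion F X XX U U1 U2 s t‖ +
        ‖expansion F X XX U U1 U2 s t‖ := norm_le_norm_sub_add _ _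
    _ ≤ K * (t - s) ^ (3 * γ) + c * (t - s) ^ γ :=
        add_le_add (hJ s t hs.1 hst.le ht.2) (h1 s t hs.1 hst.le ht.2)
    _ ≤ K * (T ^ (2 * γ) * (t - s) ^ γ) + c * (t - s) ^ γ := by
        rw [e]; gcongr; linarith [hs.1, ht.2]
    _ = _ := by ring

theorem continuousOn_incr (h : IsRoughData F γ T X XX U U1 U2) :
    ContinuousOn (fun p : ℝ × ℝ => incr X p.1 p.2) (Set.Icc 0 T ×ˢ Set.Icc 0 T) :=
  (h.holder.cont.comp continuousOn_snd fun _ hp => hp.2).sub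
    (h.holder.cont.comp continuousOn_fst fun _ hp => hp.1)

theorem memC3_cobd_expansion (h : IsRoughData F γ T X XX U U1 U2) :
    MemC3 (3 * γ) (Set.Icc 0 T) (cobd (expansion F X XX U U1 U2)) := by
  have hγ := h.γ_pos
  have hb := h.holderBounds le_rfl le_rfl
  set g : ℝ → ℝ → ℝ → A := fun s r t => sharp (birem F X U U1 U2 s r) (incr X r t) with hg
  set S : Set (ℝ × ℝ × ℝ) := {p | p.1 ∈ Set.Icc 0 T ∧ p.2.1 ∈ Set.Icc 0 T ∧ p.2.2 ∈ Set.Icc 0 T ∧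
    p.1 ≤ p.2.1 ∧ p.2.1 ≤ p.2.2} with hS
  have hgc : ContinuousOn (fun p : ℝ × ℝ × ℝ => g p.1 p.2.1 p.2.2) S := by
    have c1 : ContinuousOn (fun p : ℝ × ℝ × ℝ => birem F X U U1 U2 p.1 p.2.1) S :=
      h.bicontrolled.rem_mem.cont.comp (f := fun p : ℝ × ℝ × ℝ => (p.1, p.2.1))
        (by fun_prop) fun p hp => ⟨hp.1, hp.2.1, hp.2.2.2.1⟩
    have c2 : ContinuousOn (fun p : ℝ × ℝ × ℝ => incr X p.2.1 p.2.2) S :=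
      h.continuousOn_incr.comp (f := fun p : ℝ × ℝ × ℝ => (p.2.1, p.2.2))
        (by fun_prop) fun p hp => ⟨hp.2.1, hp.2.2.1⟩
    exact ((sharpCLM A).continuous.comp_continuousOn c2).clm_apply c1
  have hMc : ContinuousOn (fun p : ℝ × ℝ × ℝ =>
      cobd (expansion F X XX U U1 U2) p.1 p.2.1 p.2.2) S := by
    have c := h.continuousOn_expansion
    have c1 := c.comp (f := fun p : ℝ × ℝ × ℝ => (p.1, p.2.2)) (s := S) (by fun_prop)
      fun p hp => ⟨hp.1, hp.2.2.1, hp.2.2.2.1.trans hp.2.2.2.2⟩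
    have c2 := c.comp (f := fun p : ℝ × ℝ × ℝ => (p.1, p.2.1)) (s := S) (by fun_prop)
      fun p hp => ⟨hp.1, hp.2.1, hp.2.2.2.1⟩
    have c3 := c.comp (f := fun p : ℝ × ℝ × ℝ => (p.2.1, p.2.2)) (s := S) (by fun_prop)
      fun p hp => ⟨hp.2.1, hp.2.2.1, hp.2.2.2.2⟩
    exact (c1.sub c2).sub c3
  have hgl : ∀ s ∈ Set.Icc 0 T, ∀ t, g s s t = 0 := fun s hs t => by
    rw [hg]; simp only
    rw [h.bicontrolled.rem_mem.diag s hs, ← sharpCLM_apply, map_zero]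
  have hgr : ∀ s t, g s t t = 0 := fun s t => by
    rw [hg]; simp only
    rw [incr_self, ← sharpCLM_apply, map_zero]; rfl
  have hMl : ∀ s t, cobd (expansion F X XX U U1 U2) s s t = 0 := fun s t => by
    rw [cobd, h.expansion_self]; abel
  have hMr : ∀ s t, cobd (expansion F X XX U U1 U2) s t t = 0 := fun s t => by
    rw [cobd, h.expansion_self]; abel
  -- `δM` is the sum of `-U^♭ ♯ δX`, with exponent `γ` on `[r, t]`, and of the area terms, with
  -- exponent `2γ` on `[r, t]`.
  refine ⟨2, ![γ, 2 * γ], ![fun s r t => -g s r t,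
    fun s r t => cobd (expansion F X XX U U1 U2) s r t + g s r t], ?_, ?_⟩
  · rw [Fin.forall_fin_two]
    refine ⟨⟨hγ.le, by simp only [Matrix.cons_val_zero]; linarith, ?_⟩,
      ⟨by simp only [Matrix.cons_val_one, Matrix.cons_val_fin_one]; positivity,
        by simp only [Matrix.cons_val_one, Matrix.cons_val_fin_one]; linarith, ?_⟩⟩
    · refine ⟨hgc.neg, fun s hs t _ _ => ?_, fun s _ t _ _ => ?_, ?_⟩
      · simp [hgl s hs t]
      · simp [hgr]
      · refine ne_top_of_le_ne_top ENNReal.ofReal_ne_top (N3_le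
          (c := (N1 γ (Set.Icc 0 T) X).toReal *
            (N2 (2 * γ) (Set.Icc 0 T) (birem F X U U1 U2)).toReal) ?_)
        intro s hs r hr t ht hsr hrt
        have := norm_sharp_birem_le hb hs.1 hsr.le hrt.le ht.2
        simp only [Matrix.cons_val_zero, norm_neg]
        rwa [show 3 * γ - γ = 2 * γ by ring]
    · refine ⟨hMc.add hgc, fun s hs t _ _ => ?_, fun s _ t _ _ => ?_, ?_⟩
      · simp [hgl s hs t, hMl]
      · simp [hgr, hMr]
      · refine ne_top_of_le_ne_top ENNReal.ofReal_ne_top (N3_le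
          (c := (areaNorm F (2 * γ) T XX).toReal * ((N1 γ (Set.Icc 0 T) (emb F U1)).toReal +
            (N1 γ (Set.Icc 0 T) (emb F U2)).toReal)) ?_)
        intro s hs r hr t ht hsr hrt
        have := h.norm_cobd_add_le hb le_rfl le_rfl hs.1 hsr.le hrt.le ht.2
        simp only [Matrix.cons_val_one, Matrix.cons_val_fin_one]
        rwa [show 3 * γ - 2 * γ = γ by ring]
  · intro s _ r _ t _ _ _
    simp [Fin.sum_univ_two]

variable {X' : ℝ → A}

/-- `X'` and its adjoint are both derivatives of `X = X*` within an interval of positive length. -/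
theorem isSelfAdjoint_deriv (h : IsRoughData F γ T X XX U U1 U2)
    (hX' : ∀ t ∈ Set.Icc 0 T, HasDerivWithinAt X (X' t) (Set.Icc 0 T) t) {t : ℝ}
    (ht : t ∈ Set.Icc 0 T) : IsSelfAdjoint (X' t) := by
  have h1 : HasDerivWithinAt X (star (X' t)) (Set.Icc 0 T) t :=
    (hX' t ht).star.congr (fun r hr => (h.selfAdjoint r hr).star_eq.symm)
      (h.selfAdjoint t ht).star_eq.symm
  exact (uniqueDiffOn_Icc h.pos t ht).eq_deriv _ h1 (hX' t ht)

end IsRoughData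

end Integral

/-! ### The differentiable case. -/

section SmoothCase

open Filter Topology MeasureTheory

variable {A : Type*} [NormedRing A] [NormedAlgebra ℂ A] [StarRing A] [StarModule ℂ A]
  [CStarRing A] [CompleteSpace A]
  {F : Filtr A} {γ T : ℝ} {X : ℝ → A} {XX : ∀ s : ℝ, ℝ → (PT (F.alg s) 2 →L[ℂ] A)}
  {U : ∀ t, PT (F.alg t) 2} {U1 U2 : ∀ t, PT (F.alg t) 3}

/-- The integral of `U ↦ (Φ(x_r) U) ♯ y_r` can be computed pointwise, and such an integral is
determined by its values on elementary tensors. -/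
theorem eq_integral_sharp {S : StarSubalgebra ℂ A} {x y : ℝ → A} {s t : ℝ} (hst : s ≤ t)
    (hx : ContinuousOn x (Set.Icc s t)) (hy : IntervalIntegrable y volume s t)
    (Φ : A →L[ℂ] PT A 3 →L[ℂ] PT A 2) (Ψ : PT S 3 →L[ℂ] A)
    (h : ∀ v, Ψ (tens S 3 v) =
      ∫ r in s..t, sharp (Φ (x r) (mapPT (incl S) 3 (tens S 3 v))) (y r)) (w : PT S 3) :
    Ψ w = ∫ r in s..t, sharp (Φ (x r) (mapPT (incl S) 3 w)) (y r) := by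
  -- The integrand is integrable as an operator-valued function, so its integral is a bounded
  -- operator and `PT.hom_ext` applies.
  have hint : IntervalIntegrable (fun r => (sharpCLM A (y r)).comp
      ((Φ (x r)).comp (mapPT (incl S) 3))) volume s t := by
    have hy' : IntervalIntegrable (fun r => sharpCLM A (y r)) volume s t :=
      ⟨(sharpCLM A).integrable_comp hy.1, (sharpCLM A).integrable_comp hy.2⟩
    exact intervalIntegrable_bilin (ContinuousLinearMap.compL ℂ (PT S 3) (PT A 2) A).flip hst
      (f := fun r => (Φ (x r)).comp (mapPT (incl S) 3))
      ((Φ.continuous.comp_continuousOn hx).clm_comp continuousOn_const) hy'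
  have hR : ∀ w, (∫ r in s..t, (sharpCLM A (y r)).comp ((Φ (x r)).comp (mapPT (incl S) 3))) w =
      ∫ r in s..t, sharp (Φ (x r) (mapPT (incl S) 3 w)) (y r) := fun w =>
    ContinuousLinearMap.intervalIntegral_apply hint w
  have hΨ : Ψ = ∫ r in s..t, (sharpCLM A (y r)).comp ((Φ (x r)).comp (mapPT (incl S) 3)) :=
    PT.hom_ext fun v => (h v).trans (hR _).symm
  rw [← hR, ← hΨ]

theorem timesId_eq_integral {S : StarSubalgebra ℂ A} {L : PT S 2 →L[ℂ] A} {x y : ℝ → A} {s t : ℝ}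
    (hst : s ≤ t) (hx : ContinuousOn x (Set.Icc s t)) (hy : IntervalIntegrable y volume s t)
    (hL : ∀ W, L W = ∫ r in s..t, sharp (mapPT (incl S) 2 W) (x r) * y r) (w : PT S 3) :
    timesId L w = ∫ r in s..t, sharp (sharpL (x r) (mapPT (incl S) 3 w)) (y r) := by
  refine eq_integral_sharp hst hx hy (sharpLCLM A) (timesId L) (fun v => ?_) w
  have hint : IntervalIntegrable (fun r => (v 0 : A) * x r * v 1 * y r) volume s t :=
    intervalIntegrable_bilin (ContinuousLinearMap.mul ℂ A) hst (f := fun r => (v 0 : A) * x r * v 1)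
      ((continuousOn_const.mul hx).mul continuousOn_const) hy
  rw [timesId_tens, hL, mapPT_tens₂]
  simp only [mapPT_tens, sharpLCLM_apply, sharpL_tens, sharp_tens₂, incl_apply]
  exact (((ContinuousLinearMap.mul ℂ A).flip (v 2 : A)).intervalIntegral_comp_comm hint).symm

/-- The adjoint passes under the integral; self-adjointness of both paths then restores `x` and `y`
in the reversed product. -/
theorem idTimes_adjOp_eq_integral {S : StarSubalgebra ℂ A} {L : PT S 2 →L[ℂ] A} {x y : ℝ → A}
    {s t : ℝ} (hst : s ≤ t) (hx : ContinuousOn x (Set.Icc s t))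
    (hy : IntervalIntegrable y volume s t) (hxs : ∀ r ∈ Set.Icc s t, IsSelfAdjoint (x r))
    (hys : ∀ r ∈ Set.Icc s t, IsSelfAdjoint (y r))
    (hL : ∀ W, L W = ∫ r in s..t, sharp (mapPT (incl S) 2 W) (x r) * y r) (w : PT S 3) :
    idTimes (adjOp L) w = ∫ r in s..t, sharp (sharpR (mapPT (incl S) 3 w) (x r)) (y r) := by
  refine eq_integral_sharp hst hx hy (sharpRCLM A) (idTimes (adjOp L)) (fun v => ?_) w
  have hint : IntervalIntegrable (fun r => star (v 2 : A) * x r * star (v 1 : A) * y r)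
      volume s t :=
    intervalIntegrable_bilin (ContinuousLinearMap.mul ℂ A) hst
      (f := fun r => star (v 2 : A) * x r * star (v 1 : A))
      ((continuousOn_const.mul hx).mul continuousOn_const) hy
  rw [idTimes_tens, adjOp_tens₂, hL, mapPT_tens₂]
  simp only [mapPT_tens, sharpRCLM_apply, sharpR_tens, sharp_tens₂, incl_apply,
    StarMemClass.coe_star]
  have h1 := ((starL' ℝ : A ≃L[ℝ] A) : A →L[ℝ] A).intervalIntegral_comp_comm hint
  have hint' : IntervalIntegrable (fun r => star (star (v 2 : A) * x r * star (v 1 : A) * y r))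
      volume s t :=
    ⟨((starL' ℝ : A ≃L[ℝ] A) : A →L[ℝ] A).integrable_comp hint.1,
      ((starL' ℝ : A ≃L[ℝ] A) : A →L[ℝ] A).integrable_comp hint.2⟩
  have h2 := ((ContinuousLinearMap.mul ℂ A) (v 0 : A)).intervalIntegral_comp_comm hint'
  have h3 : star (∫ r in s..t, star (v 2 : A) * x r * star (v 1 : A) * y r) =
      ∫ r in s..t, star (star (v 2 : A) * x r * star (v 1 : A) * y r) := h1.symm
  rw [h3]
  refine h2.symm.trans (intervalIntegral.integral_congr fun r hr => ?_)
  rw [Set.uIcc_of_le hst] at hr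
  simp only [ContinuousLinearMap.mul_apply', star_mul, star_star, (hxs r hr).star_eq,
    (hys r hr).star_eq, mul_assoc]

namespace IsRoughData

variable {X' : ℝ → A}

theorem intervalIntegrable_sharp (h : IsRoughData F γ T X XX U U1 U2)
    (hint : IntervalIntegrable X' volume 0 T) {s t : ℝ} (hs : 0 ≤ s) (hst : s ≤ t) (ht : t ≤ T) :
    IntervalIntegrable (fun r => sharp (emb F U r) (X' r)) volume s t := by
  refine intervalIntegrable_bilin (sharpCLM A).flip hst
    (h.bicontrolled.holder.cont.mono (Set.Icc_subset_Icc hs ht)) (hint.mono_set ?_)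
  rw [Set.uIcc_of_le hst, Set.uIcc_of_le (hs.trans (hst.trans ht))]
  exact Set.Icc_subset_Icc hs ht

/-- In the differentiable case the rough integral is the Lebesgue integral. -/
theorem roughInt_eq_integral (h : IsRoughData F γ T X XX U U1 U2)
    (hX' : ∀ t ∈ Set.Icc 0 T, HasDerivWithinAt X (X' t) (Set.Icc 0 T) t)
    (hint : IntervalIntegrable X' volume 0 T)
    (hXX : ∀ s t, 0 ≤ s → s ≤ t → t ≤ T → ∀ W : PT (F.alg s) 2,
      XX s t W = ∫ r in s..t, sharp (mapPT (incl (F.alg s)) 2 W) (incr X s r) * X' r)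
    {s t : ℝ} (hs : 0 ≤ s) (hst : s ≤ t) (ht : t ≤ T) :
    roughInt F γ T X XX U U1 U2 s t = ∫ r in s..t, sharp (emb F U r) (X' r) := by
  have hγ := h.γ_pos
  have hb := h.holderBounds le_rfl le_rfl
  have hsub : ∀ {s t}, 0 ≤ s → s ≤ t → t ≤ T → IntervalIntegrable X' volume s t :=
    fun {s t} hs hst ht => hint.mono_set (by
      rw [Set.uIcc_of_le hst, Set.uIcc_of_le (hs.trans (hst.trans ht))]
      exact Set.Icc_subset_Icc hs ht)
  have hadd : AdditiveOn 0 T fun s t => ∫ r in s..t, sharp (emb F U r) (X' r) :=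
    fun s r t hs hsr hrt ht => (intervalIntegral.integral_add_adjacent_intervals
      (h.intervalIntegrable_sharp hint hs hsr (hrt.trans ht))
      (h.intervalIntegrable_sharp hint (hs.trans hsr) hrt ht)).symm
  -- `X'` is only integrable, so the error is measured against the additive control `∫ ‖X'‖` instead
  -- of a power of `t - s`.
  have hω : AdditiveOn 0 T fun s t => ∫ r in s..t, ‖X' r‖ :=
    fun s r t hs hsr hrt ht => (intervalIntegral.integral_add_adjacent_intervals
      (hsub hs hsr (hrt.trans ht)).norm (hsub (hs.trans hsr) hrt ht).norm).symm
  -- All three terms of the expansion become integrals against `X'`, and the difference of the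
  -- integrands is `U^♭_{sr} ♯ X'_r`.
  have key : ∀ s t, 0 ≤ s → s ≤ t → t ≤ T →
      ‖(∫ r in s..t, sharp (emb F U r) (X' r)) - expansion F X XX U U1 U2 s t‖ ≤
        (N2 (2 * γ) (Set.Icc 0 T) (birem F X U U1 U2)).toReal * (t - s) ^ (2 * γ) *
          ∫ r in s..t, ‖X' r‖ := by
    intro s t hs hst ht
    have hIcc : Set.Icc s t ⊆ Set.Icc 0 T := Set.Icc_subset_Icc hs ht
    have hsT : s ∈ Set.Icc 0 T := hIcc (Set.left_mem_Icc.2 hst)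
    have hXc : ContinuousOn (fun r => incr X s r) (Set.Icc s t) :=
      (h.holder.cont.mono hIcc).sub continuousOn_const
    have hi := hsub hs hst ht
    have i1 := intervalIntegrable_bilin (sharpCLM A).flip hst
      (f := fun _ => emb F U s) continuousOn_const hi
    have i2 := intervalIntegrable_bilin (sharpCLM A).flip hst
      (f := fun r => sharpLCLM A (incr X s r) (emb F U1 s))
      (((sharpLCLM A).continuous.comp_continuousOn hXc).clm_apply continuousOn_const) hi
    have i3 := intervalIntegrable_bilin (sharpCLM A).flip hst
      (f := fun r => sharpRCLM A (incr X s r) (emb F U2 s))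
      (((sharpRCLM A).continuous.comp_continuousOn hXc).clm_apply continuousOn_const) hi
    have e1 : sharp (emb F U s) (incr X s t) = ∫ r in s..t, (sharpCLM A).flip (emb F U s) (X' r) := by
      rw [ContinuousLinearMap.intervalIntegral_comp_comm _ hi,
        integral_deriv_eq_incr h.holder.cont hX' hint hs hst ht]
      rfl
    have e2 : timesId (XX s t) (U1 s) = ∫ r in s..t, (sharpCLM A).flip
        (sharpLCLM A (incr X s r) (emb F U1 s)) (X' r) :=
      timesId_eq_integral hst hXc hi (hXX s t hs hst ht) (U1 s)
    have e3 : idTimes (adjOp (XX s t)) (U2 s) = ∫ r in s..t, (sharpCLM A).flip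
        (sharpRCLM A (incr X s r) (emb F U2 s)) (X' r) :=
      idTimes_adjOp_eq_integral hst hXc hi
        (fun r hr => h.isSelfAdjoint_incr hsT (hIcc hr))
        (fun r hr => h.isSelfAdjoint_deriv hX' (hIcc hr)) (hXX s t hs hst ht) (U2 s)
    rw [expansion, e1, e2, e3, ← intervalIntegral.integral_add i1 i2,
      ← intervalIntegral.integral_add (i1.add i2) i3,
      ← intervalIntegral.integral_sub (h.intervalIntegrable_sharp hint hs hst ht)
        ((i1.add i2).add i3), ← intervalIntegral.integral_const_mul]
    refine intervalIntegral.norm_integral_le_of_norm_le hst (Eventually.of_forall fun r hr => ?_)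
      (hi.norm.const_mul _)
    have e4 : sharp (emb F U r) (X' r) - ((sharpCLM A).flip (emb F U s) (X' r) +
        (sharpCLM A).flip (sharpLCLM A (incr X s r) (emb F U1 s)) (X' r) +
        (sharpCLM A).flip (sharpRCLM A (incr X s r) (emb F U2 s)) (X' r)) =
        sharp (birem F X U U1 U2 s r) (X' r) := by
      simp only [ContinuousLinearMap.flip_apply, ← sharpCLM_apply, ← map_add, ← map_sub, birem,
        incr, ← sharpLCLM_apply, ← sharpRCLM_apply]
      congr 1
      abel
    rw [e4]
    refine (norm_sharp_le _ _).trans ?_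
    rw [mul_comm]
    gcongr
    refine (hb.birem s r hs hr.1.le (hr.2.trans ht)).trans ?_
    have := hr.1
    have := hr.2
    gcongr
  obtain ⟨K, -, hJ⟩ := h.exists_norm_roughInt_sub_le
  -- Both sides are limits of the Riemann sums of the expansion over uniform grids.
  exact tendsto_nhds_unique
    (h.additiveOn_roughInt.tendsto_sum_of_rpow h.one_lt hJ hs hst ht)
    (hadd.tendsto_sum hω (tendsto_const_mul_rpow_zero (by positivity)) key hs hst ht)

end IsRoughData

end SmoothCase

/-! ### Adaptedness, the primitive as a controlled process, and its norm. -/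

section Primitive

open Filter Topology

variable {A : Type*} [NormedRing A] [NormedAlgebra ℂ A] [StarRing A] [StarModule ℂ A]
  [CStarRing A] [CompleteSpace A]
  {F : Filtr A} {γ T : ℝ} {X : ℝ → A} {XX : ∀ s : ℝ, ℝ → (PT (F.alg s) 2 →L[ℂ] A)}
  {U : ∀ t, PT (F.alg t) 2} {U1 U2 : ∀ t, PT (F.alg t) 3}

namespace IsRoughData

theorem area_mem (h : IsRoughData F γ T X XX U U1 U2) {s t : ℝ} (hs : 0 ≤ s) (hst : s ≤ t)
    (ht : t ≤ T) (W : PT (F.alg s) 2) : XX s t W ∈ F.alg t := by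
  rcases hst.eq_or_lt with rfl | hst
  · rw [h.area.diag]; exact zero_mem _
  · exact h.area.adapted s t hs hst ht W

theorem expansion_mem (h : IsRoughData F γ T X XX U U1 U2) {s t : ℝ} (hs : 0 ≤ s) (hst : s ≤ t)
    (ht : t ≤ T) : expansion F X XX U U1 U2 s t ∈ F.alg t := by
  have hcl : IsClosed ((Subalgebra.toSubmodule (F.alg t).toSubalgebra : Submodule ℂ A) : Set A) :=
    h.closed t
  have hX : incr X s t ∈ F.alg t :=
    sub_mem (h.mem t t (hs.trans hst) le_rfl) (h.mem s t hs hst)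
  have hle : ∀ x : F.alg s, (x : A) ∈ F.alg t := fun x => F.mono hst x.2
  refine add_mem (add_mem ?_ ?_) ?_
  · refine PT.map_mem ((sharpCLM A (incr X s t)).comp (mapPT (incl (F.alg s)) 2)) hcl (fun v => ?_)
      (U s)
    rw [ContinuousLinearMap.comp_apply, mapPT_tens, sharpCLM_apply, sharp_tens]
    change _ ∈ F.alg t
    exact mul_mem (mul_mem (hle _) hX) (hle _)
  · refine PT.map_mem (timesId (XX s t)) hcl (fun v => ?_) (U1 s)
    rw [timesId_tens]
    change _ ∈ F.alg t
    exact mul_mem (h.area_mem hs hst ht _) (hle _)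
  · refine PT.map_mem (idTimes (adjOp (XX s t))) hcl (fun v => ?_) (U2 s)
    rw [idTimes_tens, adjOp_tens₂]
    change _ ∈ F.alg t
    exact mul_mem (hle _) (star_mem (h.area_mem hs hst ht _))

/-- The sewing map carries no information on adaptedness; it is recovered from the Riemann sums,
whose terms lie in the closed algebra `F.alg t`. -/
theorem roughInt_mem (h : IsRoughData F γ T X XX U U1 U2) {s t : ℝ} (hs : 0 ≤ s) (hst : s ≤ t)
    (ht : t ≤ T) : roughInt F γ T X XX U U1 U2 s t ∈ F.alg t := by
  obtain ⟨K, -, hJ⟩ := h.exists_norm_roughInt_sub_le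
  refine (h.closed t).mem_of_tendsto
    (h.additiveOn_roughInt.tendsto_sum_of_rpow h.one_lt hJ hs hst ht) ?_
  filter_upwards [eventually_gt_atTop 0] with n hn
  refine sum_mem fun i hi => ?_
  have h1 := gridPt_le hst hn (Finset.mem_range.1 hi)
  exact F.mono h1 (h.expansion_mem (hs.trans (le_gridPt hst n i))
    (gridPt_mono hst n i.le_succ) (h1.trans ht))

variable {Z : ℝ → A}

/-- The remainder is `(J - M) + (M - U ♯ δX)`. The first part has order `3γ`, and its surplus `γ` is
converted into `(l₂ - l₁) ^ γ`. -/
theorem norm_rem_le (h : IsRoughData F γ T X XX U U1 U2)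
    (hZ : ∀ s t, 0 ≤ s → s ≤ t → t ≤ T → incr Z s t = roughInt F γ T X XX U U1 U2 s t)
    {l₁ l₂ x ξ v w₁ w₂ : ℝ} (hb : HolderBounds F γ X XX U U1 U2 l₁ l₂ x ξ v w₁ w₂) (hl₁ : 0 ≤ l₁)
    (hl₂ : l₂ ≤ T) {s t : ℝ} (hs : l₁ ≤ s) (hst : s ≤ t) (ht : t ≤ l₂) :
    ‖rem F X Z U s t‖ ≤ (sewC (3 * γ) * (ξ * (w₁ + w₂) + x * v) * (l₂ - l₁) ^ γ +
      ξ * (‖emb F U1 s‖ + ‖emb F U2 s‖)) * (t - s) ^ (2 * γ) := by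
  have hγ := h.γ_pos
  have := hb.x_nonneg; have := hb.ξ_nonneg; have := hb.v_nonneg
  have := hb.w₁_nonneg; have := hb.w₂_nonneg
  have := (sewC_pos h.one_lt).le
  have h0 : 0 ≤ t - s := sub_nonneg.2 hst
  have e : (t - s) ^ (3 * γ) = (t - s) ^ γ * (t - s) ^ (2 * γ) := by
    rw [← Real.rpow_add_of_nonneg h0 hγ.le (by linarith)]; ring_nf
  have h1 := h.norm_roughInt_sub_expansion_le hb hl₁ hl₂ hs hst ht
  have h2 := h.norm_expansion_sub_le hb hs hst ht
  rw [rem, hZ s t (hl₁.trans hs) hst (ht.trans hl₂)]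
  refine (norm_sub_le_norm_sub_add_norm_sub _ (expansion F X XX U U1 U2 s t) _).trans
    ((add_le_add h1 h2).trans ?_)
  rw [e, add_mul, ← mul_assoc]
  gcongr

theorem isControlled (h : IsRoughData F γ T X XX U U1 U2)
    (hZ : ∀ s t, 0 ≤ s → s ≤ t → t ≤ T → incr Z s t = roughInt F γ T X XX U U1 U2 s t)
    (had : ∀ t ∈ Set.Icc 0 T, Z t ∈ F.alg t) : IsControlled F γ T X Z U := by
  have hγ := h.γ_pos
  have hT := h.pos.le
  have hZc : ContinuousOn Z (Set.Icc 0 T) := by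
    have h1 : ContinuousOn (fun t => roughInt F γ T X XX U U1 U2 0 t + Z 0) (Set.Icc 0 T) :=
      (h.memC2_roughInt.cont.comp (f := fun t : ℝ => ((0 : ℝ), t)) (by fun_prop)
        fun t ht => ⟨⟨le_rfl, hT⟩, ht, ht.1⟩).add continuousOn_const
    refine h1.congr fun t ht => ?_
    simp only [← hZ 0 t le_rfl ht.1 ht.2, incr, sub_add_cancel]
  refine ⟨had, ⟨hZc, ?_⟩, h.bicontrolled.holder, ?_, fun t _ => ?_, ?_⟩
  · refine ne_top_of_le_ne_top ENNReal.ofReal_ne_top (holderSup_le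
      (c := (N2 γ (Set.Icc 0 T) (roughInt F γ T X XX U U1 U2)).toReal) ?_)
    intro s hs t ht hst
    rw [hZ s t hs.1 hst.le ht.2]
    exact le_of_holderSup h.memC2_roughInt.finite hs ht hst
  · set S : Set (ℝ × ℝ) := {p | p.1 ∈ Set.Icc 0 T ∧ p.2 ∈ Set.Icc 0 T ∧ p.1 ≤ p.2}
    have c1 : ContinuousOn (fun p : ℝ × ℝ => incr X p.1 p.2) S :=
      h.continuousOn_incr.mono fun p hp => ⟨hp.1, hp.2.1⟩
    have c2 : ContinuousOn (fun p : ℝ × ℝ => emb F U p.1) S :=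
      h.bicontrolled.holder.cont.comp continuousOn_fst fun p hp => hp.1
    have c3 : ContinuousOn (fun p : ℝ × ℝ => incr Z p.1 p.2) S :=
      (hZc.comp continuousOn_snd fun p hp => hp.2.1).sub
        (hZc.comp continuousOn_fst fun p hp => hp.1)
    exact c3.sub (((sharpCLM A).continuous.comp_continuousOn c1).clm_apply c2)
  · rw [rem, incr_self, incr_self, ← sharpCLM_apply, map_zero]; simp
  · obtain ⟨u1, hu1, hu1'⟩ := h.bicontrolled.holder_deriv1.exists_norm_le
    obtain ⟨u2, hu2, hu2'⟩ := h.bicontrolled.holder_deriv2.exists_norm_le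
    have hb := h.holderBounds le_rfl le_rfl
    have := hb.ξ_nonneg
    refine ne_top_of_le_ne_top ENNReal.ofReal_ne_top (holderSup_le
      (c := sewC (3 * γ) * ((areaNorm F (2 * γ) T XX).toReal *
        ((N1 γ (Set.Icc 0 T) (emb F U1)).toReal + (N1 γ (Set.Icc 0 T) (emb F U2)).toReal) +
        (N1 γ (Set.Icc 0 T) X).toReal *
          (N2 (2 * γ) (Set.Icc 0 T) (birem F X U U1 U2)).toReal) * (T - 0) ^ γ +
        (areaNorm F (2 * γ) T XX).toReal * (u1 + u2)) fun s hs t ht hst =>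
      (h.norm_rem_le hZ hb le_rfl le_rfl hs.1 hst.le ht.2).trans ?_)
    have := Real.rpow_nonneg (sub_nonneg.2 hst.le) (2 * γ)
    gcongr
    exacts [hu1' s hs, hu2' s hs]

/-- Value at the left endpoint plus oscillation: this trades a supremum over the interval for
`‖U^i_{ℓ₁}‖` and a term carrying `|I|^γ`. -/
theorem norm_deriv_le {k : ℕ} {W : ∀ t, PT (F.alg t) k} {l₁ l₂ w : ℝ} (hγ : 0 < γ) (hw : 0 ≤ w)
    (hW : ∀ s t, l₁ ≤ s → s ≤ t → t ≤ l₂ → ‖incr (emb F W) s t‖ ≤ w * (t - s) ^ γ) {s : ℝ}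
    (hs : s ∈ Set.Icc l₁ l₂) : ‖emb F W s‖ ≤ ‖emb F W l₁‖ + (l₂ - l₁) ^ γ * w := by
  have h1 := hW l₁ s le_rfl hs.1 hs.2
  have h2 : (s - l₁) ^ γ ≤ (l₂ - l₁) ^ γ :=
    Real.rpow_le_rpow (sub_nonneg.2 hs.1) (by linarith [hs.2]) hγ.le
  have h3 := norm_le_norm_add_norm_sub' (emb F W s) (emb F W l₁)
  have h4 := mul_le_mul_of_nonneg_left h2 hw
  rw [incr] at h1
  linarith

set_option maxHeartbeats 1000000 in
/-- The estimate of the primitive, with explicit constants. -/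
theorem normQ_le (h : IsRoughData F γ T X XX U U1 U2)
    (hZ : ∀ s t, 0 ≤ s → s ≤ t → t ≤ T → incr Z s t = roughInt F γ T X XX U U1 U2 s t)
    {l₁ l₂ : ℝ} (hl₁ : 0 ≤ l₁) (hl : l₁ ≤ l₂) (hl₂ : l₂ ≤ T) :
    normQ F γ (Set.Icc l₁ l₂) X Z U ≤
      (2 + ENNReal.ofReal (2 + sewC (3 * γ) * (1 + T ^ γ)) * N1 γ (Set.Icc 0 T) X +
        ENNReal.ofReal ((sewC (3 * γ) + 1) * (1 + T ^ γ)) * areaNorm F (2 * γ) T XX) *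
      (1 + N0 (Set.Icc l₁ l₂) (emb F U) + ENNReal.ofReal ‖emb F U1 l₁‖ +
        ENNReal.ofReal ‖emb F U2 l₁‖ +
        ENNReal.ofReal ((l₂ - l₁) ^ γ) * normBQ F γ (Set.Icc l₁ l₂) X U U1 U2) := by
  have hγ := h.γ_pos
  have hb := h.holderBounds hl₁ hl₂
  have hsub : Set.Icc l₁ l₂ ⊆ Set.Icc 0 T := Set.Icc_subset_Icc hl₁ hl₂
  have hfin : ∀ {n : ℝ → ℝ → ℝ} {α : ℝ}, holderSup α (Set.Icc 0 T) n ≠ ∞ →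
      holderSup α (Set.Icc l₁ l₂) n ≠ ∞ := fun hn => ne_top_of_le_ne_top hn (holderSup_mono hsub _)
  have hN0 : N0 (Set.Icc l₁ l₂) (emb F U) ≠ ∞ := by
    obtain ⟨c, -, hc⟩ := h.bicontrolled.holder.exists_norm_le
    exact ne_top_of_le_ne_top ENNReal.ofReal_ne_top (N0_le fun t ht => hc t (hsub ht))
  have hx := ENNReal.ofReal_toReal h.holder.finite
  have hξ := ENNReal.ofReal_toReal h.area.holder
  have hv := ENNReal.ofReal_toReal (hfin h.bicontrolled.rem_mem.finite)
  have hw₁ := ENNReal.ofReal_toReal (hfin h.bicontrolled.holder_deriv1.finite)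
  have hw₂ := ENNReal.ofReal_toReal (hfin h.bicontrolled.holder_deriv2.finite)
  have ha₀ := ENNReal.ofReal_toReal hN0
  have hU0 : ∀ s ∈ Set.Icc l₁ l₂, ‖emb F U s‖ ≤ _ := fun s hs => norm_le_of_N0 hN0 hs
  change ENNReal.ofReal (N1 γ (Set.Icc 0 T) X).toReal = N1 γ (Set.Icc 0 T) X at hx
  change ENNReal.ofReal (areaNorm F (2 * γ) T XX).toReal = areaNorm F (2 * γ) T XX at hξ
  change ENNReal.ofReal (N2 (2 * γ) (Set.Icc l₁ l₂) (birem F X U U1 U2)).toReal =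
    N2 (2 * γ) (Set.Icc l₁ l₂) (birem F X U U1 U2) at hv
  change ENNReal.ofReal (N1 γ (Set.Icc l₁ l₂) (emb F U1)).toReal =
    N1 γ (Set.Icc l₁ l₂) (emb F U1) at hw₁
  change ENNReal.ofReal (N1 γ (Set.Icc l₁ l₂) (emb F U2)).toReal =
    N1 γ (Set.Icc l₁ l₂) (emb F U2) at hw₂
  set x := (N1 γ (Set.Icc 0 T) X).toReal
  set ξ := (areaNorm F (2 * γ) T XX).toReal
  set v := (N2 (2 * γ) (Set.Icc l₁ l₂) (birem F X U U1 U2)).toReal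
  set w₁ := (N1 γ (Set.Icc l₁ l₂) (emb F U1)).toReal
  set w₂ := (N1 γ (Set.Icc l₁ l₂) (emb F U2)).toReal
  set a₀ := (N0 (Set.Icc l₁ l₂) (emb F U)).toReal with ha₀def
  have ha₀0 : 0 ≤ a₀ := ENNReal.toReal_nonneg
  have hx0 := hb.x_nonneg
  have hξ0 := hb.ξ_nonneg
  have hv0 := hb.v_nonneg
  have hw₁0 := hb.w₁_nonneg
  have hw₂0 := hb.w₂_nonneg
  set K := sewC (3 * γ) with hK
  have hK0 : 0 ≤ K := (sewC_pos h.one_lt).le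
  set D := (l₂ - l₁) ^ γ with hD
  have hD0 : 0 ≤ D := Real.rpow_nonneg (sub_nonneg.2 hl) _
  have hT0 : 0 ≤ T ^ γ := Real.rpow_nonneg h.pos.le _
  -- `B` is a real lower bound for the bracket in the claim: it keeps only the three seminorms in
  -- `normBQ` that are needed.
  set B := 1 + a₀ + ‖emb F U1 l₁‖ + ‖emb F U2 l₁‖ + D * (w₁ + w₂ + v) with hB
  have n1 := norm_nonneg (emb F U1 l₁)
  have n2 := norm_nonneg (emb F U2 l₁)
  have p1 : 0 ≤ D * w₁ := by positivity
  have p2 : 0 ≤ D * w₂ := by positivity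
  have p3 : 0 ≤ D * v := by positivity
  have hBe : B = 1 + a₀ + ‖emb F U1 l₁‖ + ‖emb F U2 l₁‖ + (D * w₁ + D * w₂ + D * v) := by
    rw [hB]; ring
  have hB0 : 0 ≤ B := by rw [hBe]; positivity
  have hm : ∀ s ∈ Set.Icc l₁ l₂, ‖emb F U1 s‖ + ‖emb F U2 s‖ ≤ B := fun s hs => by
    have h1 := norm_deriv_le hγ hw₁0 hb.deriv₁ hs
    have h2 := norm_deriv_le hγ hw₂0 hb.deriv₂ hs
    rw [← hD] at h1 h2
    linarith
  have hDpow : ∀ s ∈ Set.Icc l₁ l₂, ∀ t ∈ Set.Icc l₁ l₂, s < t →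
      (t - s) ^ (2 * γ) ≤ D * (t - s) ^ γ ∧ (t - s) ^ (2 * γ) ≤ T ^ γ * (t - s) ^ γ := by
    intro s hs t ht hst
    have h0 : 0 ≤ t - s := sub_nonneg.2 hst.le
    rw [two_mul, Real.rpow_add_of_nonneg h0 hγ.le hγ.le]
    have := Real.rpow_nonneg h0 γ
    exact ⟨mul_le_mul_of_nonneg_right
      (Real.rpow_le_rpow h0 (by linarith [hs.1, ht.2]) hγ.le) this,
      mul_le_mul_of_nonneg_right
      (Real.rpow_le_rpow h0 (by linarith [hs.1, ht.2]) hγ.le) this⟩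
  have hrem : ∀ s ∈ Set.Icc l₁ l₂, ∀ t ∈ Set.Icc l₁ l₂, s < t →
      ‖rem F X Z U s t‖ ≤ ((K + 1) * ξ + K * x) * B * (t - s) ^ (2 * γ) := by
    intro s hs t ht hst
    refine (h.norm_rem_le hZ hb hl₁ hl₂ hs.1 hst.le ht.2).trans
      (mul_le_mul_of_nonneg_right ?_ (Real.rpow_nonneg (sub_nonneg.2 hst.le) _))
    rw [← hD]
    calc K * (ξ * (w₁ + w₂) + x * v) * D + ξ * (‖emb F U1 s‖ + ‖emb F U2 s‖)
        = K * ξ * (D * w₁ + D * w₂) + K * x * (D * v) + ξ * (‖emb F U1 s‖ + ‖emb F U2 s‖) := by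
          ring
      _ ≤ K * ξ * B + K * x * B + ξ * B := by
          gcongr
          · linarith
          · linarith
          · exact hm s hs
      _ = _ := by ring
  have q1 : N1 γ (Set.Icc l₁ l₂) Z ≤
      ENNReal.ofReal ((((K + 1) * ξ + K * x) * T ^ γ + x) * B) := by
    refine holderSup_le fun s hs t ht hst => ?_
    have h1 := norm_sharp_emb_le hb hs.1 hst.le ht.2
    have e : incr Z s t = rem F X Z U s t + sharp (emb F U s) (incr X s t) := by
      rw [rem, sub_add_cancel]
    have h2 : ‖emb F U s‖ ≤ B := (hU0 s hs).trans (by rw [hBe]; linarith)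
    have := Real.rpow_nonneg (sub_nonneg.2 hst.le) γ
    calc ‖incr Z s t‖ ≤ ((K + 1) * ξ + K * x) * B * (t - s) ^ (2 * γ) +
          x * ‖emb F U s‖ * (t - s) ^ γ := by
          rw [e]; exact (norm_add_le _ _).trans (add_le_add (hrem s hs t ht hst) h1)
      _ ≤ ((K + 1) * ξ + K * x) * B * (T ^ γ * (t - s) ^ γ) + x * B * (t - s) ^ γ := by
          gcongr
          exact (hDpow s hs t ht hst).2
      _ = _ := by ring
  have q2 : N0 (Set.Icc l₁ l₂) (emb F U) ≤ ENNReal.ofReal B :=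
    N0_le fun s hs => (hU0 s hs).trans (by rw [hBe]; linarith)
  -- The seminorm of `U` inside `normBQ` carries the factor `|I|^γ`, so it cannot bound this term
  -- directly. The decomposition of `δU` is used instead, `U^♭` yielding the missing factor `D`.
  have q3 : N1 γ (Set.Icc l₁ l₂) (emb F U) ≤ ENNReal.ofReal ((1 + x) * B) := by
    refine holderSup_le fun s hs t ht hst => ?_
    have e : incr (emb F U) s t = birem F X U U1 U2 s t + (sharpL (incr X s t) (emb F U1 s) +
        sharpR (emb F U2 s) (incr X s t)) := by rw [birem]; abel
    have h1 := hb.birem s t hs.1 hst.le ht.2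
    have h2 := norm_sharpL_le (incr X s t) (emb F U1 s)
    have h3 := norm_sharpR_le (emb F U2 s) (incr X s t)
    have h4 := hb.path s t hs.1 hst.le ht.2
    have := Real.rpow_nonneg (sub_nonneg.2 hst.le) γ
    calc ‖incr (emb F U) s t‖ ≤ v * (t - s) ^ (2 * γ) +
          (‖incr X s t‖ * ‖emb F U1 s‖ + ‖incr X s t‖ * ‖emb F U2 s‖) := by
          rw [e]
          exact (norm_add_le _ _).trans
            (add_le_add h1 ((norm_add_le _ _).trans (add_le_add h2 h3)))
      _ = v * (t - s) ^ (2 * γ) + ‖incr X s t‖ * (‖emb F U1 s‖ + ‖emb F U2 s‖) := by ring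
      _ ≤ v * (D * (t - s) ^ γ) + x * (t - s) ^ γ * B := by
          gcongr
          · exact (hDpow s hs t ht hst).1
          · exact hm s hs
      _ = (D * v + x * B) * (t - s) ^ γ := by ring
      _ ≤ (B + x * B) * (t - s) ^ γ := by
          gcongr
          rw [hBe]; linarith
      _ = _ := by ring
  have q4 : N2 (2 * γ) (Set.Icc l₁ l₂) (rem F X Z U) ≤
      ENNReal.ofReal (((K + 1) * ξ + K * x) * B) := holderSup_le hrem
  have hfac : 2 + ENNReal.ofReal (2 + K * (1 + T ^ γ)) * N1 γ (Set.Icc 0 T) X +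
      ENNReal.ofReal ((K + 1) * (1 + T ^ γ)) * areaNorm F (2 * γ) T XX =
      ENNReal.ofReal (2 + (2 + K * (1 + T ^ γ)) * x + (K + 1) * (1 + T ^ γ) * ξ) := by
    rw [ENNReal.ofReal_add (p := 2 + (2 + K * (1 + T ^ γ)) * x) (by positivity) (by positivity),
      ENNReal.ofReal_add (p := 2) (q := (2 + K * (1 + T ^ γ)) * x) (by positivity) (by positivity),
      ENNReal.ofReal_mul
      (p := 2 + K * (1 + T ^ γ)) (by positivity), ENNReal.ofReal_mul (p := (K + 1) * (1 + T ^ γ)) (by positivity), hx, hξ,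
      ENNReal.ofReal_ofNat]
  have hnorm : ENNReal.ofReal (w₁ + w₂ + v) ≤ normBQ F γ (Set.Icc l₁ l₂) X U U1 U2 := by
    rw [ENNReal.ofReal_add (by positivity) hv0, ENNReal.ofReal_add hw₁0 hw₂0, hw₁, hw₂, hv, normBQ]
    exact add_le_add ((add_le_add le_add_self le_add_self).trans le_add_self) le_rfl
  have hbr : ENNReal.ofReal B ≤ 1 + N0 (Set.Icc l₁ l₂) (emb F U) + ENNReal.ofReal ‖emb F U1 l₁‖ +
      ENNReal.ofReal ‖emb F U2 l₁‖ +
      ENNReal.ofReal D * normBQ F γ (Set.Icc l₁ l₂) X U U1 U2 := by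
    rw [hB, ENNReal.ofReal_add (by positivity) (by positivity),
      ENNReal.ofReal_add (by positivity) (by positivity),
      ENNReal.ofReal_add (by positivity) (by positivity),
      ENNReal.ofReal_add (by positivity) (by positivity), ENNReal.ofReal_one, ha₀,
      ENNReal.ofReal_mul hD0]
    exact add_le_add le_rfl (mul_le_mul' le_rfl hnorm)
  rw [hfac]
  refine le_trans ?_ (mul_le_mul' le_rfl hbr)
  rw [← ENNReal.ofReal_mul (by positivity)]
  -- The constants are what the four terms of `normQ` add up to: the `2` comes from the supremum and
  -- the Hölder seminorm of `U`, and `T ^ γ` comes from bounding `δZ` by its remainder.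
  have e : (2 + (2 + K * (1 + T ^ γ)) * x + (K + 1) * (1 + T ^ γ) * ξ) * B =
      (((K + 1) * ξ + K * x) * T ^ γ + x) * B + B + (1 + x) * B +
        ((K + 1) * ξ + K * x) * B := by ring
  rw [e, ENNReal.ofReal_add (by positivity) (by positivity),
    ENNReal.ofReal_add (by positivity) (by positivity),
    ENNReal.ofReal_add (by positivity) (by positivity)]
  exact add_le_add (add_le_add (add_le_add q1 q2) q3) q4

end IsRoughData

end Primitive

end ProductArea

end

/-! ### Assembly of the four items. -/

open ProductArea in
theorem proposition4p6 (γ T : ℝ) (hγ : 1 / 3 < γ) (hT : 0 < T) :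
    ∃ a b c : ℝ≥0,
    ∀ (H : Type u) [NormedAddCommGroup H] [InnerProductSpace ℂ H] [CompleteSpace H]
      (A : VonNeumannAlgebra H) (φ : A.toStarSubalgebra →ₗ[ℂ] ℂ), IsTrace A φ →
    ∀ X : ℝ → A.toStarSubalgebra,
      (∀ t ∈ Set.Icc 0 T, IsSelfAdjoint (X t)) →
      MemC1 γ (Set.Icc 0 T) X →
    ∀ XX : (∀ s : ℝ, ℝ → (PT ((genFiltr A X).alg s) 2 →L[ℂ] A.toStarSubalgebra)),
      IsProductLevyArea (genFiltr A X) γ T X XX →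
    ∀ (U : ∀ t, PT ((genFiltr A X).alg t) 2) (U1 U2 : ∀ t, PT ((genFiltr A X).alg t) 3),
      IsBicontrolled (genFiltr A X) γ T X U U1 U2 →
    -- (i) the sewing map applies to `δM`, and the integral belongs to `C_2^γ`
    (MemC3 (3 * γ) (Set.Icc 0 T) (cobd (expansion (genFiltr A X) X XX U U1 U2)) ∧
      (∃ N, IsSewing (3 * γ) T (cobd (expansion (genFiltr A X) X XX U U1 U2)) N ∧
        ∀ N', IsSewing (3 * γ) T (cobd (expansion (genFiltr A X) X XX U U1 U2)) N' →
          ∀ s t, 0 ≤ s → s ≤ t → t ≤ T → N' s t = N s t) ∧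
      MemC2 γ (Set.Icc 0 T) (roughInt (genFiltr A X) γ T X XX U U1 U2)) ∧
    -- (ii) the differentiable case
    (∀ X' : ℝ → A.toStarSubalgebra,
      (∀ t ∈ Set.Icc 0 T, HasDerivWithinAt X (X' t) (Set.Icc 0 T) t) →
      IntervalIntegrable X' MeasureTheory.volume 0 T →
      (∀ s t, 0 ≤ s → s ≤ t → t ≤ T → ∀ W : PT ((genFiltr A X).alg s) 2,
        XX s t W =
          ∫ r in s..t, sharp (mapPT (incl ((genFiltr A X).alg s)) 2 W) (incr X s r) * X' r) →
      ∀ s t, 0 ≤ s → s ≤ t → t ≤ T →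
        IntervalIntegrable (fun r => sharp (emb (genFiltr A X) U r) (X' r))
          MeasureTheory.volume s t ∧
        roughInt (genFiltr A X) γ T X XX U U1 U2 s t =
          ∫ r in s..t, sharp (emb (genFiltr A X) U r) (X' r)) ∧
    -- (iii) and (iv): the primitive and its bound
    (∀ Z₀ : A.toStarSubalgebra, ∃ Z : ℝ → A.toStarSubalgebra,
      (Z 0 = Z₀ ∧ ∀ s t, 0 ≤ s → s ≤ t → t ≤ T →
        incr Z s t = roughInt (genFiltr A X) γ T X XX U U1 U2 s t) ∧
      (∀ Z' : ℝ → A.toStarSubalgebra,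
        (Z' 0 = Z₀ ∧ ∀ s t, 0 ≤ s → s ≤ t → t ≤ T →
          incr Z' s t = roughInt (genFiltr A X) γ T X XX U U1 U2 s t) →
        ∀ t ∈ Set.Icc 0 T, Z' t = Z t) ∧
      IsControlled (genFiltr A X) γ T X (fun t => Z t - Z₀) U ∧
      (Z₀ ∈ (genFiltr A X).alg 0 → IsControlled (genFiltr A X) γ T X Z U) ∧
      ∀ l₁ l₂, 0 ≤ l₁ → l₁ ≤ l₂ → l₂ ≤ T →
        normQ (genFiltr A X) γ (Set.Icc l₁ l₂) X Z U ≤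
          (a + b * N1 γ (Set.Icc 0 T) X + c * areaNorm (genFiltr A X) (2 * γ) T XX) *
            (1 + N0 (Set.Icc l₁ l₂) (emb (genFiltr A X) U)
              + ENNReal.ofReal ‖emb (genFiltr A X) U1 l₁‖
              + ENNReal.ofReal ‖emb (genFiltr A X) U2 l₁‖
              + ENNReal.ofReal ((l₂ - l₁) ^ γ) *
                  normBQ (genFiltr A X) γ (Set.Icc l₁ l₂) X U U1 U2)) := by
  have h3γ : 1 < 3 * γ := by linarith
  refine ⟨2, (2 + sewC (3 * γ) * (1 + T ^ γ)).toNNReal,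
    ((sewC (3 * γ) + 1) * (1 + T ^ γ)).toNNReal, ?_⟩
  intro H _ _ _ A φ hφ X hsa hX XX hXX U U1 U2 hU
  -- The trace is used only here, for the conditional expectation that makes the inclusions of
  -- tensor powers isometric.
  have hdata : IsRoughData (genFiltr A X) γ T X XX U U1 U2 := by
    refine ⟨h3γ, hT, fun t => ?_, fun t k w => ?_, fun s t => mem_genFiltr A X, hsa, hX, hXX, hU⟩
    · obtain ⟨Q, hQ⟩ := genFiltr_isCommutantOf A X t
      exact hQ.isClosed
    · obtain ⟨Q, hQ⟩ := genFiltr_isCommutantOf A X t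
      obtain ⟨E, hE, hEi⟩ := hφ.exists_retraction hQ
      exact norm_mapPT_of_leftInverse (norm_incl_le _) hE hEi w
  refine ⟨⟨hdata.memC3_cobd_expansion, ?_, hdata.memC2_roughInt⟩, ?_, fun Z₀ => ?_⟩
  · obtain ⟨N, hN⟩ := hdata.exists_isSewing
    exact ⟨N, hN, fun N' hN' s t hs hst ht => hN.unique h3γ hN' hs hst ht⟩
  · intro X' hX' hint hXXint s t hs hst ht
    exact ⟨hdata.intervalIntegrable_sharp hint hs hst ht,
      hdata.roughInt_eq_integral hX' hint hXXint hs hst ht⟩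
  · have hadd := hdata.additiveOn_roughInt
    have hZ : ∀ s t, 0 ≤ s → s ≤ t → t ≤ T →
        incr (fun t => Z₀ + roughInt (genFiltr A X) γ T X XX U U1 U2 0 t) s t =
          roughInt (genFiltr A X) γ T X XX U U1 U2 s t := fun s t hs hst ht => by
      rw [incr, hadd 0 s t le_rfl hs hst ht]; abel
    -- The primitive is `Z₀ + J_{0t}`; additivity of `J` gives its increments, and `Z - Z₀` is
    -- adapted whether or not `Z₀` lies in `A_0`.
    refine ⟨fun t => Z₀ + roughInt (genFiltr A X) γ T X XX U U1 U2 0 t,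
      ⟨by simp only [hadd.diag le_rfl hT.le, add_zero], hZ⟩, ?_, ?_, ?_, ?_⟩
    · rintro Z' ⟨h0, hZ'⟩ t ht
      simp only [← hZ' 0 t le_rfl ht.1 ht.2, incr, h0]; abel
    · refine hdata.isControlled (fun s t hs hst ht => ?_) fun t ht => ?_
      · rw [← hZ s t hs hst ht]; simp only [incr]; abel
      · rw [add_sub_cancel_left]
        exact hdata.roughInt_mem le_rfl ht.1 ht.2
    · intro hZ₀
      exact hdata.isControlled hZ fun t ht =>
        add_mem ((genFiltr A X).mono ht.1 hZ₀) (hdata.roughInt_mem le_rfl ht.1 ht.2)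
    · intro l₁ l₂ hl₁ hl hl₂
      exact hdata.normQ_le hZ hl₁ hl hl₂
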